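/- **Programs.** Rules are normal rules $h\leftarrow body$, hard constraints $\leftarrow body$, choice rules $l\{h_1,\dots,h_k\}u\leftarrow body$ ($l,u\in\mathbb Z$) and weak constraints $:\sim body.[w@l,t_1,\dots,t_o]$, where $body$ is $b_1,\dots,b_n,\text{not }c_1,\dots,\text{not }c_m$. A rule is safe if each of its variables occurs in some $b_i$. A program is grounded over its Herbrand universe. The reduct $P^I$ of the grounding removes rules with some $c_j\in I$, removes the remaining negative literals, gives the head $\bot$ to hard constraints and to choice rules without $l\le|I\cap\{h_1,\dots,h_k\}|\le u$, and replaces every other choice rule by the rules with heads $h_i\in I$ and the same body; weak constraints play no role in it. $AS(P)$ is the set of answer sets, i.e. of those $I\subseteq HB_P$ that are the minimal model of $P^I$ (rules with body aggregates that are false in $I$ are removed too, and the remaining aggregates are evaluated in the model). $P^l_A$ is the sum of the weights $w$ over the distinct tuples $(w,l,t_1,\dots,t_o)$ of ground weak constraints of $P$ whose body is true in $A$; weights and levels are integers. $A_1\succ_P A_2$ iff for some $l$, $P^l_{A_1}<P^l_{A_2}$ and $P^m_{A_1}=P^m_{A_2}$ for all $m>l$; $AS^*(P)$ is the set of $A\in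 AS(P)$ for which no $A'\in AS(P)$ has $A'\succ_P A$. A partial interpretation is a pair $e=\langle e^{inc},e^{exc}\rangle$ of finite sets of ground atoms; $A$ extends $e$ if $e^{inc}\subseteq A$ and $e^{exc}\cap A=\emptyset$. **Tasks.** Let $T=\langle B,S_M,E^+,E^-,O^b,O^c\rangle$, where $B$ and the search space $S_M$ are finite sets of safe function-free rules, $E^+,E^-$ are finite sets of partial interpretations, and $O^b,O^c$ are finite sets of pairs of elements of $E^+$. Assume $E^+\neq\emptyset$ if $E^-\ne\emptyset$. The length $|R|$ of a rule is its number of literals, the tail $[w@l,t_1,\dots,t_o]$ of a weak constraint counting $0$ and a head $l\{h_1,\dots,h_k\}u$ counting $\sum_{l\le i\le u}\binom ki k$; $|H|=\sum_{R\in H}|R|$. A set $H\subseteq S_M$ is a positive hypothesis if every $e\in E^+$ is extended by some $A\in AS(B\cup H)$ and for every $\langle e_1,e_2\rangle\in O^b$ there are $A_1\succ_{B\cup H}A_2$ in $AS(B\cup H)$ extending $e_1$ and $e_2$. A positive $H$ gives rise to the violating interpretation $A$ if $A\in AS(B\cup H)$ extends some $e\in E^-$, and to the violating pair $\langle A_1,A_2\rangle$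 if $A_1,A_2\in AS(B\cup H)$ extend $e_1,e_2$ for some $\langle e_1,e_2\rangle\in O^c$ and $A_1\not\succ_{B\cup H}A_2$. Both are called violating reasons of $T$; $H$ is violating if it gives rise to at least one. For a set $VR=VI\cup VP$ of violating reasons ($VI$ interpretations, $VP$ pairs), a positive $H$ is remaining if $VI\cap AS(B\cup H)=\emptyset$ and $I_1\succ_{B\cup H}I_2$ for all $\langle I_1,I_2\rangle\in VP$ with $I_1,I_2\in AS(B\cup H)$. Optimal means of least length $|H|$ within the set in question. **Encoding.** Atoms of $T$ become terms; $R_{id}$, $e_{id}$, $n$, $o_{id1},o_{id2}$, $I_{id}$, $vp_{id1},vp_{id2}$ are distinct identifiers of rules of $S_M$, positive examples, one extra answer set, brave orderings, and elements of $VI$ and $VP$; $X,L,L_2,W,A,ATOM,T_1,T_2$ are fresh variables. $\mathrm{Lev}$ is the set of levels of ground weak constraints of $B\cup S_M$. For a rule $R$ (or set of atoms), $R[p,t]$ replaces every atom $a$ by $p(a,t)$. For a weak constraint $R=\,:\sim body.[wt@lev,t_1,\dots,t_k]$, $mw(R,p,q)$ is $w(wt,lev,args(t_1,\dots,t_k),X)\leftarrow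 q(X),body[p,X]$. "$R$ with $a$" adds $a$ to the body of $R$. $ext(h,e,t)$ is the rule with head $h$ and body $\{in\_as(a,t):a\in e^{inc}\}\cup\{\text{not }in\_as(a,t):a\in e^{exc}\}$, and $cover(e,t)$ is $\{ext(cov(t),e,t);\ \leftarrow\text{not }cov(t)\}$. $dominates(t_1,t_2)$ consists of - $dom\_lv(t_1,t_2,L)\leftarrow lv(L),\#sum\{w(W,L,A,t_1)=W,\,w(W,L,A,t_2)=-W\}<0$; - $non\_dom\_lv(t_1,t_2,L)\leftarrow lv(L),\#sum\{w(W,L,A,t_2)=W,\,w(W,L,A,t_1)=-W\}<0$; - $non\_bef(t_1,t_2,L)\leftarrow lv(L),lv(L_2),L<L_2,non\_dom\_lv(t_1,t_2,L_2)$; - $dom(t_1,t_2)\leftarrow dom\_lv(t_1,t_2,L),\text{not }non\_bef(t_1,t_2,L)$. $T_{meta}$ consists of: - for $R\in B$: $R[in\_as,X]$ with $as(X)$ if $R$ is not weak, $mw(R,in\_as,as)$ if $R$ is weak; - for $R\in S_M$: the same rule with $in\_h(R_{id})$ in addition, and $:\sim in\_h(R_{id}).[2|R|@0,R_{id}]$;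 the choice rule $\{in\_h(R_{id}):R\in S_M\}$; - for $e\in E^+$: $cover(e,e_{id})$ and the fact $as(e_{id})$; - for $e\in E^-$: $ext(v\_i,e,n)$ and the fact $as(n)$; moreover $violating\leftarrow v\_i$ and $:\sim\text{not }violating.[1@0]$; - for $o=\langle e_1,e_2\rangle\in O^b$: $as(o_{id1})$, $as(o_{id2})$, $cover(e_1,o_{id1})$, $cover(e_2,o_{id2})$, $dominates(o_{id1},o_{id2})$, $\leftarrow\text{not }dom(o_{id1},o_{id2})$; - the facts $lv(l)$ for $l\in\mathrm{Lev}$; - for $\langle e_1,e_2\rangle\in O^c$, with $i,j$ the identifiers of $e_1,e_2$: $dominates(i,j)$ and $v\_p(i,j)\leftarrow\text{not }dom(i,j)$; moreover $v\_p\leftarrow v\_p(T_1,T_2)$ and $violating\leftarrow v\_p$. For a rule $R$ that is not weak, with positive body $b^+$ and negative body $b^-$, let $\beta$ be the body $b^+[mmr,X]$, $\text{not }b^-[in\_vs,X]$. $reductify(R)$ is $mmr(h,X)\leftarrow\beta,vs(X)$ for a normal rule with head $h$; $mmr(\bot,X)\leftarrow\beta,vs(X)$ for a hard constraint; and for a choice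 rule with head $l\{h_1,\dots,h_k\}u$, writing $C=\{in\_vs(h_1,X),\dots,in\_vs(h_k,X)\}$, the rules $mmr(h_i,X)\leftarrow\beta,\,l\,C\,u,\,in\_vs(h_i,X)$ for $i\le k$, $mmr(\bot,X)\leftarrow\beta,\,(u+1)\,C$ and $mmr(\bot,X)\leftarrow\beta,\,C\,(l-1)$, where $l\,C\,u$ says that at least $l$ and at most $u$ atoms of $C$ are true, a missing bound being no restriction. $VR_{meta}(T)$ consists of: - for $I\in VI$: the facts $in\_vs(a,I_{id})$ ($a\in I$) and $vs(I_{id})$, and $\leftarrow\text{not }nas(I_{id})$; - for $vp=\langle I_1,I_2\rangle\in VP$: $dominates(vp_{id1},vp_{id2})$, the facts $in\_vs(a,vp_{idj})$ ($a\in I_j$) and $vs(vp_{idj})$ for $j=1,2$, and $\leftarrow\text{not }nas(vp_{id1}),\text{not }nas(vp_{id2}),\text{not }dom(vp_{id1},vp_{id2})$; - $nas(X)\leftarrow in\_vs(ATOM,X),\text{not }mmr(ATOM,X)$ and $nas(X)\leftarrow\text{not }in\_vs(ATOM,X),mmr(ATOM,X)$; - for $R\in B$: $reductify(R)$ if $R$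 is not weak, $mw(R,in\_vs,vs)$ if it is; for $R\in S_M$: the same rules with $in\_h(R_{id})$; and the facts $lv(l)$ for $l\in\mathrm{Lev}$. For a set $A$ of ground atoms let $\mathcal M^{-1}_{hyp}(A)=\{R\in S_M: in\_h(R_{id})\in A\}$. **Theorem.** Let $VR$ be a set of violating reasons of $T$ and let $AS=AS^*(T_{meta}\cup VR_{meta}(T))$. 1. If $violating\in A$ for some $A\in AS$, then the set of optimal remaining violating hypotheses is non-empty and equals $\{\mathcal M^{-1}_{hyp}(A)\mid A\in AS\}$. 2. If no $A\in AS$ contains $violating$, then the set of optimal remaining hypotheses equals $\{\mathcal M^{-1}_{hyp}(A)\mid A\in AS\}$, and none of these hypotheses is violating. -/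

import Mathlib

/-! # Answer set programs with weak constraints and body aggregates -/

namespace ASP

universe u v w x

/-- A signature: symbolic constants, function symbols and predicate symbols.  Integers are
always available as constants; the same name used with two arities gives two symbols. -/
structure Sig where
  Const : Type u
  Fun : Type v
  Pred : Type w

/-- Terms over `L` with variables in `V`. -/
inductive Term (L : Sig.{u, v, w}) (V : Type x) where
  | var (v : V)
  | int (n : ℤ)
  | sym (c : L.Const)
  | fn (f : L.Fun) (ts : List (Term L V))

/-- Atoms `p(t₁, …, tₙ)`. -/
structure Atom (L : Sig.{u, v, w}) (V : Type x) where
  pred : L.Pred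
  args : List (Term L V)

/-- Ground (variable free) terms. -/
abbrev GTerm (L : Sig.{u, v, w}) := Term L Empty

/-- Ground atoms. -/
abbrev GAtom (L : Sig.{u, v, w}) := Atom L Empty

/-- A symbol of the signature, functions and predicates with the arity they are used with. -/
inductive Symbol (L : Sig.{u, v, w}) where
  | int (n : ℤ)
  | sym (c : L.Const)
  | fn (f : L.Fun) (arity : ℕ)
  | pred (p : L.Pred) (arity : ℕ)

/-- Rule heads: an atom `h` (normal rule), nothing (hard constraint), an aggregate
`l {h₁, …, hₒ} u` (choice rule), or the tail `[w@l, t₁, …, tₒ]` of a weak constraint. -/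
inductive Head (L : Sig.{u, v, w}) (V : Type x) where
  | atom (h : Atom L V)
  | bot
  | choice (l : ℤ) (hs : List (Atom L V)) (u : ℤ)
  | weak (wt lev : Term L V) (ts : List (Term L V))

/-- An element `a = c * t` of a `#sum` aggregate: if the atom `a` is true, the integer `c * t`
is added to the sum. -/
structure SumElem (L : Sig.{u, v, w}) (V : Type x) where
  atom : Atom L V
  coeff : ℤ
  weight : Term L V

/-- Body elements other than literals: a comparison `s < t` of integers, a cardinality
aggregate `l {a₁, …, aₙ} u` in which each bound may be missing, and `#sum {…} < b`. -/
inductive Builtin (L : Sig.{u, v, w}) (V : Type x) where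
  | lt (s t : Term L V)
  | count (l : Option ℤ) (as : List (Atom L V)) (u : Option ℤ)
  | sumLt (es : List (SumElem L V)) (b : ℤ)

/-- A rule `head ← pos, not neg, builtins`; weak constraints count as rules. -/
structure Rule (L : Sig.{u, v, w}) (V : Type x) where
  head : Head L V
  pos : List (Atom L V) := []
  neg : List (Atom L V) := []
  builtins : List (Builtin L V) := []

/-- Programs. -/
abbrev Program (L : Sig.{u, v, w}) (V : Type x) := Set (Rule L V)

section Grammar

variable {L : Sig.{u, v, w}} {V : Type x}

/-- The ground instance of a term. -/
def Term.subst (σ : V → GTerm L) : Term L V → GTerm L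
  | .var v => σ v
  | .int n => .int n
  | .sym c => .sym c
  | .fn f ts => .fn f (ts.map (fun t => t.subst σ))

/-- The variables of a term. -/
def Term.vars : Term L V → List V
  | .var v => [v]
  | .int _ => []
  | .sym _ => []
  | .fn _ ts => ts.flatMap (fun t => t.vars)

/-- The symbols of a term. -/
def Term.symbols : Term L V → List (Symbol L)
  | .var _ => []
  | .int n => [.int n]
  | .sym c => [.sym c]
  | .fn f ts => .fn f ts.length :: ts.flatMap (fun t => t.symbols)

def Atom.subst (σ : V → GTerm L) (a : Atom L V) : GAtom L :=
  ⟨a.pred, a.args.map (Term.subst σ)⟩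

def Atom.vars (a : Atom L V) : List V := a.args.flatMap Term.vars

def Atom.symbols (a : Atom L V) : List (Symbol L) :=
  .pred a.pred a.args.length :: a.args.flatMap Term.symbols

def Head.vars : Head L V → List V
  | .atom h => h.vars
  | .bot => []
  | .choice _ hs _ => hs.flatMap Atom.vars
  | .weak wt lev ts => wt.vars ++ lev.vars ++ ts.flatMap Term.vars

def Head.symbols : Head L V → List (Symbol L)
  | .atom h => h.symbols
  | .bot => []
  | .choice _ hs _ => hs.flatMap Atom.symbols
  | .weak wt lev ts => wt.symbols ++ lev.symbols ++ ts.flatMap Term.symbols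

/-- The variables of a body element that are global in its rule.  A variable that occurs only
inside `#sum` aggregates is local to them. -/
def Builtin.globalVars : Builtin L V → List V
  | .lt s t => s.vars ++ t.vars
  | .count _ as _ => as.flatMap Atom.vars
  | .sumLt _ _ => []

def Builtin.symbols : Builtin L V → List (Symbol L)
  | .lt s t => s.symbols ++ t.symbols
  | .count _ as _ => as.flatMap Atom.symbols
  | .sumLt es _ => es.flatMap (fun e => e.atom.symbols ++ e.weight.symbols)

/-- The (global) variables of a rule. -/
def Rule.vars (r : Rule L V) : List V :=
  r.head.vars ++ r.pos.flatMap Atom.vars ++ r.neg.flatMap Atom.vars ++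
    r.builtins.flatMap Builtin.globalVars

def Rule.symbols (r : Rule L V) : List (Symbol L) :=
  r.head.symbols ++ r.pos.flatMap Atom.symbols ++ r.neg.flatMap Atom.symbols ++
    r.builtins.flatMap Builtin.symbols

/-- A normal rule, hard constraint, choice rule or weak constraint whose body consists of
literals only. -/
def Rule.IsBasic (r : Rule L V) : Prop := r.builtins = []

/-- Every variable occurs in a positive body literal. -/
def Rule.IsSafe (r : Rule L V) : Prop := ∀ v ∈ r.vars, ∃ b ∈ r.pos, v ∈ b.vars

def Rule.IsWeak (r : Rule L V) : Prop := ∃ wt lev ts, r.head = .weak wt lev ts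

/-- The length of a head in literals: an aggregate `l {h₁, …, hₖ} u` is counted as the
disjunction, over all subsets of size between `l` and `u`, of conjunctions of `k` literals. -/
def Head.length : Head L V → ℕ
  | .atom _ => 1
  | .bot => 0
  | .choice l hs u =>
      ∑ i ∈ Finset.range (hs.length + 1),
        if l ≤ (i : ℤ) ∧ (i : ℤ) ≤ u then hs.length.choose i * hs.length else 0
  | .weak _ _ _ => 0

/-- The length `|R|` of a basic rule. -/
def Rule.length (r : Rule L V) : ℕ := r.head.length + r.pos.length + r.neg.length

/-- The symbols that occur in a program. -/
def symbols (P : Program L V) : Set (Symbol L) := {s | ∃ r ∈ P, s ∈ r.symbols}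

/-- The Herbrand universe: the ground terms formed from symbols of the program. -/
def herbrandUniverse (P : Program L V) : Set (GTerm L) := {t | ∀ s ∈ t.symbols, s ∈ symbols P}

/-- The Herbrand base: the ground atoms formed from symbols of the program. -/
def herbrandBase (P : Program L V) : Set (GAtom L) := {a | ∀ s ∈ a.symbols, s ∈ symbols P}

/-- `σ` is a grounding substitution for the rule `r` in the program `P`.  (Values of `σ` at
variables that do not occur in `r` are irrelevant.) -/
def Grounds (P : Program L V) (r : Rule L V) (σ : V → GTerm L) : Prop :=
  ∀ v ∈ r.vars, σ v ∈ herbrandUniverse P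

end Grammar

section Semantics

variable {L : Sig.{u, v, w}} {V : Type x}

/-- The number of distinct atoms among the given ground instances that are true in `I`. -/
noncomputable def countTrue (σ : V → GTerm L) (as : List (Atom L V)) (I : Set (GAtom L)) : ℤ :=
  ({a | a ∈ I ∧ ∃ b ∈ as, a = b.subst σ} : Set (GAtom L)).ncard

/-- The pairs `(a, n)` of a true ground atom and an integer that occur as an instance `a = n`
of an element of a `#sum` aggregate; the global variables `G` are instantiated by `σ`, all
others are free to vary.  Instances whose weight is not an integer are ignored. -/
def sumInstances (G : List V) (σ : V → GTerm L) (es : List (SumElem L V))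
    (I : Set (GAtom L)) : Set (GAtom L × ℤ) :=
  {p | p.1 ∈ I ∧ ∃ e ∈ es, ∃ τ : V → GTerm L, (∀ v ∈ G, τ v = σ v) ∧
    p.1 = e.atom.subst τ ∧ ∃ n : ℤ, e.weight.subst τ = .int n ∧ p.2 = e.coeff * n}

/-- Truth of a body element in `I`. -/
def Builtin.Holds (G : List V) (σ : V → GTerm L) (I : Set (GAtom L)) : Builtin L V → Prop
  | .lt s t => ∃ m n : ℤ, s.subst σ = .int m ∧ t.subst σ = .int n ∧ m < n
  | .count l as u =>
      (∀ k ∈ l, k ≤ countTrue σ as I) ∧ (∀ k ∈ u, countTrue σ as I ≤ k)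
  | .sumLt es b => (∑ᶠ p ∈ sumInstances G σ es I, p.2) < b

/-- The body of the ground instance of `r` under `σ` is true in `I`. -/
def Rule.BodyHolds (r : Rule L V) (σ : V → GTerm L) (I : Set (GAtom L)) : Prop :=
  (∀ b ∈ r.pos, b.subst σ ∈ I) ∧ (∀ c ∈ r.neg, c.subst σ ∉ I) ∧
    (∀ d ∈ r.builtins, d.Holds r.vars σ I)

/-- What the head of a ground rule becomes in the reduct with respect to `I`, as a condition on
`J`: hard constraints and choice rules whose head is not satisfied by `I` get the head `⊥`; a
choice rule whose head is satisfied is split into rules for the head atoms that are in `I`.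
Weak constraints do not take part in the reduct. -/
def Head.ReductHolds (σ : V → GTerm L) (I J : Set (GAtom L)) : Head L V → Prop
  | .atom h => h.subst σ ∈ J
  | .bot => False
  | .choice l hs u =>
      (l ≤ countTrue σ hs I ∧ countTrue σ hs I ≤ u) ∧
        ∀ h ∈ hs, h.subst σ ∈ I → h.subst σ ∈ J
  | .weak _ _ _ => True

/-- `J` is a model of the reduct `P^I`: rules with a negative literal or a body aggregate that
is false in `I` are removed, and so are the negative literals of the other rules.  (Body
aggregates and comparisons, if there are any, are also evaluated in `J`.) -/
def ModelsReduct (P : Program L V) (I J : Set (GAtom L)) : Prop :=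
  ∀ r ∈ P, ∀ σ : V → GTerm L, Grounds P r σ →
    (∀ c ∈ r.neg, c.subst σ ∉ I) → (∀ d ∈ r.builtins, d.Holds r.vars σ I) →
    (∀ b ∈ r.pos, b.subst σ ∈ J) → (∀ d ∈ r.builtins, d.Holds r.vars σ J) →
    r.head.ReductHolds σ I J

/-- `AS(P)`: the Herbrand interpretations `I` that are a minimal model of `P^I`. -/
def answerSets (P : Program L V) : Set (Set (GAtom L)) :=
  {I | I ⊆ herbrandBase P ∧ ModelsReduct P I I ∧ ∀ J ⊆ I, ModelsReduct P I J → J = I}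

/-- `weak(P, A)`: the tuples `(w, l, (t₁, …, tₒ))` of the ground weak constraints whose body is
true in `A`.  Weights and levels are integers. -/
def weakTuples (P : Program L V) (A : Set (GAtom L)) : Set (ℤ × ℤ × List (GTerm L)) :=
  {q | ∃ r ∈ P, ∃ σ : V → GTerm L, Grounds P r σ ∧ r.BodyHolds σ A ∧
    ∃ wt lev ts, r.head = .weak wt lev ts ∧
      wt.subst σ = .int q.1 ∧ lev.subst σ = .int q.2.1 ∧ ts.map (Term.subst σ) = q.2.2}

/-- `P^l_A`: the sum of the weights at level `l`. -/
noncomputable def levelSum (P : Program L V) (l : ℤ) (A : Set (GAtom L)) : ℤ :=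
  ∑ᶠ q ∈ {q ∈ weakTuples P A | q.2.1 = l}, q.1

/-- `A₁ ≻_P A₂`. -/
def Dominates (P : Program L V) (A₁ A₂ : Set (GAtom L)) : Prop :=
  ∃ l : ℤ, levelSum P l A₁ < levelSum P l A₂ ∧ ∀ m > l, levelSum P m A₁ = levelSum P m A₂

/-- `AS*(P)`: the optimal answer sets. -/
def optimalAnswerSets (P : Program L V) : Set (Set (GAtom L)) :=
  {A ∈ answerSets P | ¬ ∃ A' ∈ answerSets P, Dominates P A' A}

end Semantics

end ASP

/-! # Learning from ordered answer sets -/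

namespace LOAS

open ASP

universe u v w

/-- The language of tasks: constants `K` and integers, predicates `P`, no function symbols. -/
abbrev objSig (K : Type u) (P : Type v) : Sig.{u, 0, v} := ⟨K, Empty, P⟩

abbrev OAtom (K : Type u) (P : Type v) := GAtom (objSig K P)

abbrev ORule (K : Type u) (P : Type v) (V : Type w) := Rule (objSig K P) V

/-- Partial interpretations. -/
structure PartialInterp (K : Type u) (P : Type v) where
  inc : Finset (OAtom K P)
  exc : Finset (OAtom K P)

/-- `A` extends `e`. -/
def Extends {K : Type u} {P : Type v} (A : Set (OAtom K P)) (e : PartialInterp K P) : Prop :=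
  (∀ a ∈ e.inc, a ∈ A) ∧ ∀ a ∈ e.exc, a ∉ A

/-- A task `⟨B, S, E⁺, E⁻, Oᵇ, Oᶜ⟩`: the background knowledge and the search space are finite
sets of safe normal rules, hard constraints, choice rules and weak constraints; the orderings
are over the positive examples. -/
structure Task (K : Type u) (P : Type v) (V : Type w) where
  B : Finset (ORule K P V)
  S : Finset (ORule K P V)
  Epos : Finset (PartialInterp K P)
  Eneg : Finset (PartialInterp K P)
  Ob : Finset (PartialInterp K P × PartialInterp K P)
  Oc : Finset (PartialInterp K P × PartialInterp K P)
  B_wf : ∀ r ∈ B, r.IsBasic ∧ r.IsSafe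
  S_wf : ∀ r ∈ S, r.IsBasic ∧ r.IsSafe
  Ob_pos : ∀ o ∈ Ob, o.1 ∈ Epos ∧ o.2 ∈ Epos
  Oc_pos : ∀ o ∈ Oc, o.1 ∈ Epos ∧ o.2 ∈ Epos

/-- A violating reason is an interpretation or a pair of interpretations. -/
inductive Reason (K : Type u) (P : Type v) where
  | interp (I : Set (OAtom K P))
  | pair (I₁ I₂ : Set (OAtom K P))

section Tasks

variable {K : Type u} {P : Type v} {V : Type w}

def BravelyRespects (Q : Program (objSig K P) V)
    (o : PartialInterp K P × PartialInterp K P) : Prop :=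
  ∃ A₁ ∈ answerSets Q, ∃ A₂ ∈ answerSets Q,
    Extends A₁ o.1 ∧ Extends A₂ o.2 ∧ Dominates Q A₁ A₂

/-- The program `B ∪ H`. -/
def Task.prog (T : Task K P V) (H : Finset (ORule K P V)) : Program (objSig K P) V :=
  {r | r ∈ T.B ∨ r ∈ H}

/-- The length `|H|` of a hypothesis. -/
def hypLength (H : Finset (ORule K P V)) : ℕ := ∑ r ∈ H, r.length

/-- Positive hypotheses. -/
def Task.IsPositive (T : Task K P V) (H : Finset (ORule K P V)) : Prop :=
  H ⊆ T.S ∧ (∀ e ∈ T.Epos, ∃ A ∈ answerSets (T.prog H), Extends A e) ∧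
    ∀ o ∈ T.Ob, BravelyRespects (T.prog H) o

/-- `⟨H, R⟩ ∈ VI(T) ∪ VP(T)`: `R` is a violating interpretation or a violating pair to which
the positive hypothesis `H` gives rise. -/
def Task.Violates (T : Task K P V) (H : Finset (ORule K P V)) : Reason K P → Prop
  | .interp A => T.IsPositive H ∧ A ∈ answerSets (T.prog H) ∧ ∃ e ∈ T.Eneg, Extends A e
  | .pair A₁ A₂ => T.IsPositive H ∧ A₁ ∈ answerSets (T.prog H) ∧ A₂ ∈ answerSets (T.prog H) ∧
      (∃ o ∈ T.Oc, Extends A₁ o.1 ∧ Extends A₂ o.2) ∧ ¬ Dominates (T.prog H) A₁ A₂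

/-- Violating hypotheses. -/
def Task.IsViolating (T : Task K P V) (H : Finset (ORule K P V)) : Prop :=
  ∃ R, T.Violates H R

/-- `R` is a violating reason of `T`. -/
def Task.IsReason (T : Task K P V) (R : Reason K P) : Prop := ∃ H, T.Violates H R

/-- Remaining hypotheses with respect to `VR`. -/
def Task.IsRemaining (T : Task K P V) (VR : Set (Reason K P))
    (H : Finset (ORule K P V)) : Prop :=
  T.IsPositive H ∧ (∀ I, .interp I ∈ VR → I ∉ answerSets (T.prog H)) ∧
    ∀ I₁ I₂, .pair I₁ I₂ ∈ VR → I₁ ∈ answerSets (T.prog H) → I₂ ∈ answerSets (T.prog H) →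
      Dominates (T.prog H) I₁ I₂

/-- The shortest members of a set of hypotheses. -/
def shortest (X : Set (Finset (ORule K P V))) : Set (Finset (ORule K P V)) :=
  {H ∈ X | ∀ H' ∈ X, hypLength H ≤ hypLength H'}

/-- The optimal remaining hypotheses. -/
def Task.optimalRemaining (T : Task K P V) (VR : Set (Reason K P)) :
    Set (Finset (ORule K P V)) :=
  shortest {H | T.IsRemaining VR H}

/-- The optimal remaining violating hypotheses. -/
def Task.optimalRemainingViolating (T : Task K P V) (VR : Set (Reason K P)) :
    Set (Finset (ORule K P V)) :=
  shortest {H | T.IsRemaining VR H ∧ T.IsViolating H}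

/-- The levels of the ground weak constraints of `B ∪ S`. -/
def Task.levels (T : Task K P V) : Set ℤ :=
  {l | ∃ r ∈ T.prog T.S, ∃ σ, Grounds (T.prog T.S) r σ ∧
    ∃ wt lev ts, r.head = .weak wt lev ts ∧ lev.subst σ = .int l}

end Tasks

/-! # The meta encoding -/

/-- Constants of the meta language: those of the task, `⊥`, and unique identifiers. -/
inductive MConst (K : Type u) (P : Type v) (V : Type w) where
  | obj (c : K)
  | bot
  /-- the identifier `R_id` of a rule of the search space -/
  | ruleId (r : ORule K P V)
  /-- the identifier `e_id` of a positive example -/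
  | exId (e : PartialInterp K P)
  /-- the identifier `n` of the answer set tested against the negative examples -/
  | n
  /-- the identifiers `o_id1`, `o_id2` of a brave ordering -/
  | ordId1 (o : PartialInterp K P × PartialInterp K P)
  | ordId2 (o : PartialInterp K P × PartialInterp K P)
  /-- the identifier `I_id` of a violating interpretation -/
  | viId (I : Set (OAtom K P))
  /-- the identifiers `vp_id1`, `vp_id2` of a violating pair -/
  | vpId1 (I₁ I₂ : Set (OAtom K P))
  | vpId2 (I₁ I₂ : Set (OAtom K P))

/-- Function symbols of the meta language: the predicates of the task, and `args`. -/
inductive MFun (P : Type v) where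
  | pred (p : P)
  | args

/-- Predicates of the meta language.  `v_p` is used with no arguments and with two. -/
inductive MPred where
  | in_as | as | in_h | cov | w | v_i | v_p | violating
  | lv | dom_lv | non_dom_lv | non_bef | dom
  | in_vs | vs | mmr | nas

/-- Variables of the meta language: those of the task, and eight new ones. -/
inductive MVar (V : Type w) where
  | obj (v : V)
  | X | L | L2 | W | A | ATOM | T1 | T2

abbrev metaSig (K : Type u) (P : Type v) (V : Type w) : Sig := ⟨MConst K P V, MFun P, MPred⟩

abbrev MTerm (K : Type u) (P : Type v) (V : Type w) := Term (metaSig K P V) (MVar V)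

abbrev MAtom (K : Type u) (P : Type v) (V : Type w) := Atom (metaSig K P V) (MVar V)

abbrev MRule (K : Type u) (P : Type v) (V : Type w) := Rule (metaSig K P V) (MVar V)

abbrev MProgram (K : Type u) (P : Type v) (V : Type w) := Program (metaSig K P V) (MVar V)

section Meta

variable {K : Type u} {P : Type v} {V : Type w}

/-- A term of the task as a term of the meta language. -/
def quoteTerm : Term (objSig K P) V → MTerm K P V
  | .var v => .var (.obj v)
  | .int n => .int n
  | .sym c => .sym (.obj c)
  | .fn f _ => f.elim

/-- An atom `p(t₁, …, tₙ)` of the task as a term of the meta language. -/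
def quoteAtom (a : Atom (objSig K P) V) : MTerm K P V :=
  .fn (.pred a.pred) (a.args.map quoteTerm)

/-- A ground term of the task as a term of the meta language. -/
def quoteGTerm : GTerm (objSig K P) → MTerm K P V
  | .var v => v.elim
  | .int n => .int n
  | .sym c => .sym (.obj c)
  | .fn f _ => f.elim

/-- A ground atom of the task as a term of the meta language. -/
def quoteGAtom (a : OAtom K P) : MTerm K P V :=
  .fn (.pred a.pred) (a.args.map quoteGTerm)

/-- The atom `p(t₁, …, tₙ)` of the meta language. -/
def mat (p : MPred) (ts : List (MTerm K P V)) : MAtom K P V := ⟨p, ts⟩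

/-- The fact `a.` -/
def fact (a : MAtom K P V) : MRule K P V := { head := .atom a }

/-- `reify(a, p, t)` for an atom `a` -/
def reifyAtom (p : MPred) (t : MTerm K P V) (a : Atom (objSig K P) V) : MAtom K P V :=
  mat p [quoteAtom a, t]

def reifyHead (p : MPred) (t : MTerm K P V) :
    Head (objSig K P) V → Head (metaSig K P V) (MVar V)
  | .atom h => .atom (reifyAtom p t h)
  | .bot => .bot
  | .choice l hs u => .choice l (hs.map (reifyAtom p t)) u
  | .weak wt lev ts => .weak (quoteTerm wt) (quoteTerm lev) (ts.map quoteTerm)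

/-- `reify(R, p, t)` for a basic rule `R`: every atom `a` is replaced by `p(a, t)`. -/
def reify (p : MPred) (t : MTerm K P V) (r : ORule K P V) : MRule K P V where
  head := reifyHead p t r.head
  pos := r.pos.map (reifyAtom p t)
  neg := r.neg.map (reifyAtom p t)

/-- `append(R, a)`: the atom `a` is added to the body. -/
def append (r : MRule K P V) (a : MAtom K P V) : MRule K P V :=
  { r with pos := r.pos ++ [a] }

/-- The variable `X`. -/
def varX : MTerm K P V := .var .X

/-- The body `p(e^inc₁, t), …, not p(e^exc₁, t), …` below the head `h`, for `p = in_as`. -/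
noncomputable def extendsRule (h : MAtom K P V) (e : PartialInterp K P) (t : MTerm K P V) :
    MRule K P V where
  head := .atom h
  pos := e.inc.toList.map fun a => mat .in_as [quoteGAtom a, t]
  neg := e.exc.toList.map fun a => mat .in_as [quoteGAtom a, t]

/-- `cover(e, t)` -/
noncomputable def cover (e : PartialInterp K P) (t : MTerm K P V) : MProgram K P V :=
  {extendsRule (mat .cov [t]) e t,
   { head := .bot, neg := [mat .cov [t]] }}

/-- `meta_weak(R, p₁, p₂, t)` for `R = :~ body.[wt@lev, t₁, …, tₙ]` -/
def metaWeak (wt lev : Term (objSig K P) V) (ts : List (Term (objSig K P) V))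
    (pos neg : List (Atom (objSig K P) V)) (p₁ p₂ : MPred) (t : MTerm K P V) :
    MRule K P V where
  head := .atom
    (mat .w [quoteTerm wt, quoteTerm lev, .fn .args (ts.map quoteTerm), t])
  pos := mat p₂ [t] :: pos.map (reifyAtom p₁ t)
  neg := neg.map (reifyAtom p₁ t)

/-- `#sum {w(W,L,A,t₁) = W, w(W,L,A,t₂) = -W} < 0` -/
def sumBelow (t₁ t₂ : MTerm K P V) : Builtin (metaSig K P V) (MVar V) :=
  .sumLt
    [⟨mat .w [.var .W, .var .L, .var .A, t₁], 1, .var .W⟩,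
     ⟨mat .w [.var .W, .var .L, .var .A, t₂], -1, .var .W⟩] 0

/-- `dominates(t₁, t₂)` -/
def dominates (t₁ t₂ : MTerm K P V) : MProgram K P V :=
  {{ head := .atom (mat .dom_lv [t₁, t₂, .var .L])
     pos := [mat .lv [.var .L]]
     builtins := [sumBelow t₁ t₂] },
   { head := .atom (mat .non_dom_lv [t₁, t₂, .var .L])
     pos := [mat .lv [.var .L]]
     builtins := [sumBelow t₂ t₁] },
   { head := .atom (mat .non_bef [t₁, t₂, .var .L])
     pos := [mat .lv [.var .L], mat .lv [.var .L2], mat .non_dom_lv [t₁, t₂, .var .L2]]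
     builtins := [.lt (.var .L) (.var .L2)] },
   { head := .atom (mat .dom [t₁, t₂])
     pos := [mat .dom_lv [t₁, t₂, .var .L]]
     neg := [mat .non_bef [t₁, t₂, .var .L]] }}

/-- The facts `lv(l)`. -/
def levelFacts (T : Task K P V) : MProgram K P V :=
  {r | ∃ l ∈ T.levels, r = fact (mat .lv [.int l])}

/-- `in_h(R_id)` -/
def inH (r : ORule K P V) : MAtom K P V := mat .in_h [.sym (.ruleId r)]

def metaB (T : Task K P V) : MProgram K P V :=
  {r' | ∃ r ∈ T.B, ¬ r.IsWeak ∧ r' = append (reify .in_as varX r) (mat .as [varX])} ∪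
  {r' | ∃ r ∈ T.B, ∃ wt lev ts, r.head = .weak wt lev ts ∧
    r' = metaWeak wt lev ts r.pos r.neg .in_as .as varX}

noncomputable def metaS (T : Task K P V) : MProgram K P V :=
  {r' | ∃ r ∈ T.S, ¬ r.IsWeak ∧
    r' = append (append (reify .in_as varX r) (mat .as [varX])) (inH r)} ∪
  {r' | ∃ r ∈ T.S, ∃ wt lev ts, r.head = .weak wt lev ts ∧
    r' = append (metaWeak wt lev ts r.pos r.neg .in_as .as varX) (inH r)} ∪
  {r' | ∃ r ∈ T.S, r' =
    { head := .weak (.int (2 * (r.length : ℤ))) (.int 0) [.sym (.ruleId r)], pos := [inH r] }} ∪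
  {{ head := .choice 0 (T.S.toList.map inH) (T.S.card : ℤ) }}

noncomputable def metaEpos (T : Task K P V) : MProgram K P V :=
  {r' | ∃ e ∈ T.Epos, r' ∈ cover e (.sym (.exId e)) ∪ {fact (mat .as [.sym (.exId e)])}}

noncomputable def metaEneg (T : Task K P V) : MProgram K P V :=
  {r' | ∃ e ∈ T.Eneg, r' = extendsRule (mat .v_i []) e (.sym .n) ∨
    r' = fact (mat .as [.sym .n])} ∪
  {{ head := .atom (mat .violating []), pos := [mat .v_i []] },
   { head := .weak (.int 1) (.int 0) [], neg := [mat .violating []] }}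

noncomputable def metaOb (T : Task K P V) : MProgram K P V :=
  {r' | ∃ o ∈ T.Ob, r' ∈
    ({fact (mat .as [.sym (.ordId1 o)]), fact (mat .as [.sym (.ordId2 o)])} : MProgram K P V) ∪
    cover o.1 (.sym (.ordId1 o)) ∪
    cover o.2 (.sym (.ordId2 o)) ∪
    dominates (.sym (.ordId1 o)) (.sym (.ordId2 o)) ∪
    {{ head := .bot, neg := [mat .dom [.sym (.ordId1 o), .sym (.ordId2 o)]] }}} ∪
  levelFacts T

def metaOc (T : Task K P V) : MProgram K P V :=
  {r' | ∃ o ∈ T.Oc, r' ∈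
    dominates (.sym (.exId o.1)) (.sym (.exId o.2)) ∪
    ({{ head := .atom (mat .v_p [.sym (.exId o.1), .sym (.exId o.2)])
        neg := [mat .dom [.sym (.exId o.1), .sym (.exId o.2)]] }} : MProgram K P V)} ∪
  {{ head := .atom (mat .v_p []), pos := [mat .v_p [.var .T1, .var .T2]] },
   { head := .atom (mat .violating []), pos := [mat .v_p []] }}

/-- The program `T_meta`. -/
noncomputable def taskMeta (T : Task K P V) : MProgram K P V :=
  metaB T ∪ metaS T ∪ metaEpos T ∪ metaEneg T ∪ metaOb T ∪ metaOc T

/-- The rule `mmr(h, X) :- reify(body⁺, mmr, X), reify(body⁻, not in_vs, X), extra, bs.` -/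
def mmrRule (h : MTerm K P V) (r : ORule K P V) (extra : List (MAtom K P V))
    (bs : List (Builtin (metaSig K P V) (MVar V))) : MRule K P V where
  head := .atom (mat .mmr [h, varX])
  pos := r.pos.map (reifyAtom .mmr varX) ++ extra
  neg := r.neg.map (reifyAtom .in_vs varX)
  builtins := bs

/-- `reductify(R)` for a basic rule `R` that is not a weak constraint -/
def reductify (r : ORule K P V) : MProgram K P V :=
  match r.head with
  | .atom h => {mmrRule (quoteAtom h) r [mat .vs [varX]] []}
  | .bot => {mmrRule (.sym .bot) r [mat .vs [varX]] []}
  | .choice l hs u =>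
      {r' | ∃ h ∈ hs, r' = mmrRule (quoteAtom h) r [reifyAtom .in_vs varX h]
        [.count (some l) (hs.map (reifyAtom .in_vs varX)) (some u)]} ∪
      {mmrRule (.sym .bot) r [] [.count (some (u + 1)) (hs.map (reifyAtom .in_vs varX)) none],
       mmrRule (.sym .bot) r [] [.count none (hs.map (reifyAtom .in_vs varX)) (some (l - 1))]}
  | .weak _ _ _ => ∅

/-- `reify(I, in_vs, t)` together with the fact `vs(t)` -/
def interpFacts (I : Set (OAtom K P)) (t : MTerm K P V) : MProgram K P V :=
  {r' | ∃ a ∈ I, r' = fact (mat .in_vs [quoteGAtom a, t])} ∪ {fact (mat .vs [t])}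

def metaVI (VR : Set (Reason K P)) : MProgram K P V :=
  {r' | ∃ I, .interp I ∈ VR ∧ r' ∈
    interpFacts I (.sym (.viId I)) ∪
    ({{ head := .bot, neg := [mat .nas [.sym (.viId I)]] }} : MProgram K P V)}

def metaVP (VR : Set (Reason K P)) : MProgram K P V :=
  {r' | ∃ I₁ I₂, .pair I₁ I₂ ∈ VR ∧ r' ∈
    dominates (.sym (.vpId1 I₁ I₂)) (.sym (.vpId2 I₁ I₂)) ∪
    interpFacts I₁ (.sym (.vpId1 I₁ I₂)) ∪
    interpFacts I₂ (.sym (.vpId2 I₁ I₂)) ∪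
    ({{ head := .bot
        neg := [mat .nas [.sym (.vpId1 I₁ I₂)], mat .nas [.sym (.vpId2 I₁ I₂)],
          mat .dom [.sym (.vpId1 I₁ I₂), .sym (.vpId2 I₁ I₂)]] }} : MProgram K P V)}

def metaAux (T : Task K P V) : MProgram K P V :=
  {r' | ∃ r ∈ T.B, r' ∈ reductify r} ∪
  {{ head := .atom (mat .nas [varX])
     pos := [mat .in_vs [.var .ATOM, varX]], neg := [mat .mmr [.var .ATOM, varX]] },
   { head := .atom (mat .nas [varX])
     pos := [mat .mmr [.var .ATOM, varX]], neg := [mat .in_vs [.var .ATOM, varX]] }} ∪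
  {r' | ∃ r ∈ T.S, ∃ r'' ∈ reductify r, r' = append r'' (inH r)} ∪
  {r' | ∃ r ∈ T.S, ∃ wt lev ts, r.head = .weak wt lev ts ∧
    r' = append (metaWeak wt lev ts r.pos r.neg .in_vs .vs varX) (inH r)} ∪
  {r' | ∃ r ∈ T.B, ∃ wt lev ts, r.head = .weak wt lev ts ∧
    r' = metaWeak wt lev ts r.pos r.neg .in_vs .vs varX} ∪
  levelFacts T

/-- The program `VR_meta(T)`. -/
def reasonMeta (T : Task K P V) (VR : Set (Reason K P)) : MProgram K P V :=
  metaVI VR ∪ metaVP VR ∪ metaAux T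

/-- The ground atom `in_h(R_id)`. -/
def inHAtom (r : ORule K P V) : GAtom (metaSig K P V) := ⟨.in_h, [.sym (.ruleId r)]⟩

/-- The ground atom `violating`. -/
def violatingAtom : GAtom (metaSig K P V) := ⟨.violating, []⟩

open Classical in
/-- `M⁻¹_hyp(A)`: the hypothesis represented by an answer set of the meta program. -/
noncomputable def decodeHyp (T : Task K P V) (A : Set (GAtom (metaSig K P V))) :
    Finset (ORule K P V) :=
  T.S.filter fun r => inHAtom r ∈ A

end Meta

end LOAS

/-! An answer set of the meta program consists of a guess and its evaluation. The guess is made of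
the atoms `in_h`, which select a hypothesis `H`, and of the atoms `in_as`, which give one answer set
of `B ∪ H` for each identifier: one per positive example, two per brave ordering, and `n` if there
are negative examples. All other predicates except `as`, which is given by facts, are evaluated by
rules that are stratified by `rank`.

The evaluation is handled by `StableAbove`: closure under the rules of positive rank, together with
the absence of unfounded sets of atoms of positive rank. Every answer set has this property. Every
choice of rank-zero atoms in the Herbrand base extends to a set that has it (`exists_stableAbove`).
A model of the reduct inside such a set that contains its rank-zero atoms is the whole set
(`StableAbove.eq_of_modelsReduct`). Minimality for the meta program thus comes down to minimality of
the guessed interpretations as models of their own reducts. Object programs and the meta program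
have different Herbrand universes; safety makes this harmless (`mem_answerSets_iff_of_safe`).

The meaning of the evaluated atoms is then read off from the rules. `w` lists the tails of weak
constraints, so the `#sum` aggregates compare level sums and `dom` decides domination
(`Coherent.dom_iff`). For an interpretation stored by `in_vs`, `mmr` computes the least model of the
reduct, with `⊥` treated as one more atom, and `nas` holds exactly when the stored set is not an
answer set (`nas_iff`). Hence the hard constraints say that `H` is a remaining hypothesis. This
gives `isRemaining_of_answerSet` in one direction and `exists_answerSet_of_isRemaining` in the
other. The atom `violating` certifies that `H` is violating; conversely a violating `H` has at least
one answer set containing `violating`, obtained by guessing a violating reason. The assumption on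
`E⁺` and `E⁻` guarantees that there is an answer set to put at the identifier `n`.

All weights sit at level 0, and the cost is `2|H|`, plus 1 if `violating` is absent (`score`).
Parity does the rest. If the optimum is even, every optimal answer set contains `violating`, and
they are the shortest remaining violating hypotheses. If it is odd, it equals `2|H| + 1` with `|H|`
least among all remaining hypotheses, and a violating one of that length would have cost `2|H|`. -/

namespace ASP

universe u v w x

/-! ### Grounding, unfounded sets and stratification for arbitrary programs -/

section Generic

variable {L : Sig.{u, v, w}} {V : Type x}

theorem Term.mem_symbols_subst_of_var {σ : V → GTerm L} {v : V} {s : Symbol L}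
    (hs : s ∈ (σ v).symbols) : ∀ t : Term L V, v ∈ t.vars → s ∈ (t.subst σ).symbols
  | .var w, h => by
      simp only [Term.vars, List.mem_singleton] at h
      subst h; simpa [Term.subst] using hs
  | .int _, h => by simp [Term.vars] at h
  | .sym _, h => by simp [Term.vars] at h
  | .fn f ts, h => by
      simp only [Term.vars, List.mem_flatMap] at h
      obtain ⟨t, ht, hv⟩ := h
      simp only [Term.subst, Term.symbols, List.mem_cons, List.mem_flatMap, List.mem_map]
      exact Or.inr ⟨_, ⟨t, ht, rfl⟩, Term.mem_symbols_subst_of_var hs t hv⟩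

theorem Term.mem_symbols_of_subst {σ : V → GTerm L} {s : Symbol L} :
    ∀ t : Term L V, s ∈ (t.subst σ).symbols → s ∈ t.symbols ∨ ∃ v ∈ t.vars, s ∈ (σ v).symbols
  | .var w, h => Or.inr ⟨w, by simp [Term.vars], by simpa [Term.subst] using h⟩
  | .int _, h => Or.inl (by simpa [Term.subst, Term.symbols] using h)
  | .sym _, h => Or.inl (by simpa [Term.subst, Term.symbols] using h)
  | .fn f ts, h => by
      simp only [Term.subst, Term.symbols, List.mem_cons, List.mem_flatMap, List.mem_map,
        List.length_map] at h
      rcases h with h | ⟨_, ⟨t, ht, rfl⟩, h⟩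
      · exact Or.inl (by simp [Term.symbols, h])
      · rcases Term.mem_symbols_of_subst t h with h | ⟨v, hv, h⟩
        · refine Or.inl ?_
          simp only [Term.symbols, List.mem_cons, List.mem_flatMap]
          exact Or.inr ⟨t, ht, h⟩
        · refine Or.inr ⟨v, ?_, h⟩
          simp only [Term.vars, List.mem_flatMap]
          exact ⟨t, ht, hv⟩

theorem Atom.mem_symbols_of_subst {σ : V → GTerm L} {s : Symbol L} {a : Atom L V}
    (h : s ∈ (a.subst σ).symbols) : s ∈ a.symbols ∨ ∃ v ∈ a.vars, s ∈ (σ v).symbols := by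
  simp only [Atom.symbols, Atom.subst, List.mem_cons, List.mem_flatMap, List.mem_map,
    List.length_map] at h
  rcases h with h | ⟨_, ⟨t, ht, rfl⟩, h⟩
  · exact Or.inl (by simp [Atom.symbols, h])
  · rcases Term.mem_symbols_of_subst t h with h | ⟨v, hv, h⟩
    · refine Or.inl ?_
      simp only [Atom.symbols, List.mem_cons, List.mem_flatMap]
      exact Or.inr ⟨t, ht, h⟩
    · refine Or.inr ⟨v, ?_, h⟩
      simp only [Atom.vars, List.mem_flatMap]
      exact ⟨t, ht, hv⟩

theorem mem_herbrandUniverse_of_atom {P : Program L V} {σ : V → GTerm L} {a : Atom L V} {v : V}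
    (ha : a.subst σ ∈ herbrandBase P) (hv : v ∈ a.vars) : σ v ∈ herbrandUniverse P := by
  intro s hs
  simp only [Atom.vars, List.mem_flatMap] at hv
  obtain ⟨t, ht, hv⟩ := hv
  refine ha s ?_
  simp only [Atom.symbols, Atom.subst, List.mem_cons, List.mem_flatMap, List.mem_map]
  exact Or.inr ⟨_, ⟨t, ht, rfl⟩, Term.mem_symbols_subst_of_var hs t hv⟩

/-- By safety each variable occurs in a positive body atom, and the true instances of these atoms
use symbols of `P` only. -/
theorem Grounds.of_safe {P : Program L V} {r : Rule L V} {σ : V → GTerm L} (hr : r.IsSafe)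
    {J : Set (GAtom L)} (hJ : J ⊆ herbrandBase P) (hb : ∀ b ∈ r.pos, b.subst σ ∈ J) :
    Grounds P r σ := by
  intro v hv
  obtain ⟨b, hbp, hvb⟩ := hr v hv
  exact mem_herbrandUniverse_of_atom (hJ (hb b hbp)) hvb

/-- The atom `h` occurs in the head, which is an atom or a choice. -/
def Head.Offers (h : Atom L V) : Head L V → Prop
  | .atom h' => h = h'
  | .choice _ hs _ => h ∈ hs
  | .bot => False
  | .weak _ _ _ => False

theorem Head.Offers.mem_vars {h : Atom L V} {hd : Head L V} (hh : hd.Offers h) {v : V}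
    (hv : v ∈ h.vars) : v ∈ hd.vars := by
  cases hd with
  | atom h' => cases hh; exact hv
  | choice l hs u => exact List.mem_flatMap.2 ⟨h, hh, hv⟩
  | bot => exact hh.elim
  | weak => exact hh.elim

theorem Head.Offers.mem_symbols {h : Atom L V} {hd : Head L V} (hh : hd.Offers h)
    {s : Symbol L} (hs : s ∈ h.symbols) : s ∈ hd.symbols := by
  cases hd with
  | atom h' => cases hh; exact hs
  | choice l hs' u => exact List.mem_flatMap.2 ⟨h, hh, hs⟩
  | bot => exact hh.elim
  | weak => exact hh.elim

theorem Grounds.head_mem {P : Program L V} {r : Rule L V} {σ : V → GTerm L} (hr : r ∈ P)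
    (hg : Grounds P r σ) {h : Atom L V} (hh : r.head.Offers h) :
    h.subst σ ∈ herbrandBase P := by
  intro s hs
  rcases Atom.mem_symbols_of_subst hs with hs | ⟨v, hv, hs⟩
  · exact ⟨r, hr, by simp [Rule.symbols, hh.mem_symbols hs]⟩
  · exact hg v (by simp [Rule.vars, hh.mem_vars hv]) s hs

/-- An answer set contains no non-empty unfounded set. -/
theorem exists_founding_rule {P : Program L V} {I : Set (GAtom L)} (hI : I ∈ answerSets P)
    {D : Set (GAtom L)} (hD : D ⊆ I) (hne : D.Nonempty) :
    ∃ r ∈ P, ∃ σ, Grounds P r σ ∧ r.BodyHolds σ I ∧ (∀ b ∈ r.pos, b.subst σ ∉ D) ∧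
      ∃ h, r.head.Offers h ∧ h.subst σ ∈ D := by
  by_contra hcon
  -- If no rule founds `D`, removing `D` leaves a model of the reduct: a rule whose positive body
  -- avoids `D` cannot have its head in `D`. Minimality of `I` then empties `D`.
  have hJ : I \ D = I := by
    refine hI.2.2 _ Set.sdiff_subset ?_
    intro r hr σ hg hn hbI hp hbJ
    have hm := hI.2.1 r hr σ hg hn hbI (fun b hb => (hp b hb).1) hbI
    have key : ∀ h, r.head.Offers h → h.subst σ ∉ D := fun h hh hd =>
      hcon ⟨r, hr, σ, hg, ⟨fun b hb => (hp b hb).1, hn, hbI⟩, fun b hb => (hp b hb).2,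
        h, hh, hd⟩
    revert hm key
    cases r.head with
    | atom h => exact fun hm key => ⟨hm, key _ rfl⟩
    | bot => exact fun hm _ => hm
    | choice l hs u => exact fun hm key => ⟨hm.1, fun h hh hI => ⟨hI, key _ hh⟩⟩
    | weak => exact fun _ _ => trivial
  obtain ⟨a, ha⟩ := hne
  have := hJ ▸ hD ha
  exact this.2 ha

/-! ### Safe programs without built-ins -/

/-- `J` is a model of the reduct of a program without built-ins, all substitutions being
allowed. -/
def ModelsReductAll (P : Program L V) (I J : Set (GAtom L)) : Prop :=
  ∀ r ∈ P, ∀ σ : V → GTerm L, (∀ c ∈ r.neg, c.subst σ ∉ I) → (∀ b ∈ r.pos, b.subst σ ∈ J) →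
    r.head.ReductHolds σ I J

theorem modelsReductAll_iff {P : Program L V} (hP : ∀ r ∈ P, r.IsBasic ∧ r.IsSafe)
    {I J : Set (GAtom L)} (hJ : J ⊆ herbrandBase P) :
    ModelsReductAll P I J ↔ ModelsReduct P I J := by
  constructor
  · exact fun h r hr σ _ hn _ hp _ => h r hr σ hn hp
  · intro h r hr σ hn hp
    have hb : r.builtins = [] := (hP r hr).1
    exact h r hr σ (Grounds.of_safe (hP r hr).2 hJ hp) hn (by simp [hb]) hp (by simp [hb])

/-- A true positive body already confines a safe rule to its Herbrand instances, so the Herbrand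
base can be dropped from the definition. This allows answer sets of `B ∪ H` to be compared with the
meta program, whose universe is another one. -/
theorem mem_answerSets_iff_of_safe {P : Program L V} (hP : ∀ r ∈ P, r.IsBasic ∧ r.IsSafe)
    {I : Set (GAtom L)} :
    I ∈ answerSets P ↔
      ModelsReductAll P I I ∧ ∀ J ⊆ I, ModelsReductAll P I J → J = I := by
  constructor
  · rintro ⟨hb, hm, hmin⟩
    exact ⟨(modelsReductAll_iff hP hb).2 hm, fun J hJ h =>
      hmin J hJ ((modelsReductAll_iff hP (hJ.trans hb)).1 h)⟩
  · rintro ⟨hm, hmin⟩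
    -- Rules grounded by atoms of the base have their heads in the base, so cutting `I` down to the
    -- base gives a model of the reduct; minimality over all substitutions shows that nothing was
    -- cut off.
    have hb : I ∩ herbrandBase P = I := by
      refine hmin _ Set.inter_subset_left ?_
      intro r hr σ hn hp
      have hg : Grounds P r σ :=
        Grounds.of_safe (hP r hr).2 (Set.inter_subset_right (s := I)) hp
      have := hm r hr σ hn (fun b hb => (hp b hb).1)
      have key : ∀ h, r.head.Offers h → h.subst σ ∈ herbrandBase P := fun h hh =>
        hg.head_mem hr hh
      revert this key
      cases r.head with
      | atom h => exact fun this key => ⟨this, key _ rfl⟩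
      | bot => exact fun this _ => this
      | choice l hs u => exact fun this key => ⟨this.1, fun h hh hI => ⟨hI, key _ hh⟩⟩
      | weak => exact fun _ _ => trivial
    have hb' : I ⊆ herbrandBase P := hb ▸ Set.inter_subset_right
    exact ⟨hb', (modelsReductAll_iff hP hb').1 hm, fun J hJ h =>
      hmin J hJ ((modelsReductAll_iff hP (hJ.trans hb')).2 h)⟩

/-! ### Stratified programs -/

def Builtin.atoms : Builtin L V → List (Atom L V)
  | .lt _ _ => []
  | .count _ as _ => as
  | .sumLt es _ => es.map SumElem.atom

/-- Agreement is required predicate by predicate, because strata are sets of predicates. -/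
theorem Builtin.holds_congr {G : List V} {σ : V → GTerm L} {I I' : Set (GAtom L)}
    (d : Builtin L V)
    (h : ∀ a ∈ d.atoms, ∀ g : GAtom L, g.pred = a.pred → (g ∈ I ↔ g ∈ I')) :
    d.Holds G σ I ↔ d.Holds G σ I' := by
  cases d with
  | lt s t => exact Iff.rfl
  | count l as u =>
    have : countTrue σ as I = countTrue σ as I' := by
      unfold countTrue
      congr 2
      ext g
      constructor
      · rintro ⟨hg, b, hb, rfl⟩
        exact ⟨(h b hb _ rfl).1 hg, b, hb, rfl⟩
      · rintro ⟨hg, b, hb, rfl⟩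
        exact ⟨(h b hb _ rfl).2 hg, b, hb, rfl⟩
    simp only [Builtin.Holds, this]
  | sumLt es b =>
    have : sumInstances G σ es I = sumInstances G σ es I' := by
      ext p
      constructor
      · rintro ⟨hp, e, he, τ, hτ, hpe, hn⟩
        exact ⟨(h e.atom (List.mem_map_of_mem he) _ (by rw [hpe]; rfl)).1 hp,
          e, he, τ, hτ, hpe, hn⟩
      · rintro ⟨hp, e, he, τ, hτ, hpe, hn⟩
        exact ⟨(h e.atom (List.mem_map_of_mem he) _ (by rw [hpe]; rfl)).2 hp,
          e, he, τ, hτ, hpe, hn⟩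
    simp only [Builtin.Holds, this]

/-- The rules whose head predicate has positive rank are stratified by the rank. -/
def Stratified (P : Program L V) (rk : L.Pred → ℕ) : Prop :=
  ∀ r ∈ P, ∀ h, r.head = .atom h → 0 < rk h.pred →
    (∀ b ∈ r.pos, rk b.pred ≤ rk h.pred) ∧ (∀ c ∈ r.neg, rk c.pred < rk h.pred) ∧
      ∀ d ∈ r.builtins, ∀ a ∈ d.atoms, rk a.pred < rk h.pred

/-- `J` is closed under the rules of positive rank, negative literals and built-ins being
evaluated in `I`. -/
def ClosedAbove (P : Program L V) (rk : L.Pred → ℕ) (I J : Set (GAtom L)) : Prop :=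
  ∀ r ∈ P, ∀ h, r.head = .atom h → 0 < rk h.pred → ∀ σ, Grounds P r σ →
    (∀ c ∈ r.neg, c.subst σ ∉ I) → (∀ d ∈ r.builtins, d.Holds r.vars σ I) →
    (∀ b ∈ r.pos, b.subst σ ∈ J) → h.subst σ ∈ J

/-- `A` is stable with respect to the rules of positive rank. -/
structure StableAbove (P : Program L V) (rk : L.Pred → ℕ) (A : Set (GAtom L)) : Prop where
  subset_base : A ⊆ herbrandBase P
  closed : ClosedAbove P rk A A
  founded : ∀ D ⊆ A, D.Nonempty → (∀ a ∈ D, 0 < rk a.pred) →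
    ∃ r ∈ P, ∃ h, r.head = .atom h ∧ ∃ σ, Grounds P r σ ∧ r.BodyHolds σ A ∧ h.subst σ ∈ D ∧
      ∀ b ∈ r.pos, b.subst σ ∉ D

/-- Foundedness is the absence of unfounded sets. A founding rule could also be a choice rule, but
by `hrk` those offer atoms of rank zero only. -/
theorem StableAbove.of_answerSet {P : Program L V} {rk : L.Pred → ℕ} {A : Set (GAtom L)}
    (hrk : ∀ r ∈ P, ∀ l hs u, r.head = .choice l hs u → ∀ h ∈ hs, rk h.pred = 0)
    (hA : A ∈ answerSets P) : StableAbove P rk A where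
  subset_base := hA.1
  closed := by
    intro r hr h hh _ σ hg hn hb hp
    have := hA.2.1 r hr σ hg hn hb hp hb
    rwa [hh] at this
  founded := by
    intro D hD hne hpos
    obtain ⟨r, hr, σ, hg, hb, hp, h, hh, hhD⟩ := exists_founding_rule hA hD hne
    refine ⟨r, hr, h, ?_, σ, hg, hb, hhD, hp⟩
    have h0 : 0 < rk h.pred := hpos _ hhD
    cases hd : r.head with
    | atom h' => rw [hd] at hh; cases hh; rfl
    | bot => rw [hd] at hh; exact hh.elim
    | choice l hs u =>
      rw [hd] at hh
      exact absurd (hrk r hr l hs u hd h hh) h0.ne'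
    | weak => rw [hd] at hh; exact hh.elim

/-- Take the atoms of `A` missing from `J` of the least possible rank `n`. Foundedness gives a rule
that derives one of them with a body avoiding them. Its positive body is then in `J`, and its
aggregates concern ranks below `n`, where `J` and `A` agree; so `J` must contain the head. -/
theorem StableAbove.eq_of_modelsReduct {P : Program L V} {rk : L.Pred → ℕ} {A J : Set (GAtom L)}
    (hA : StableAbove P rk A) (hP : Stratified P rk) (hJ : J ⊆ A) (hm : ModelsReduct P A J)
    (h0 : ∀ a ∈ A, rk a.pred = 0 → a ∈ J) : J = A := by
  by_contra hne
  have hex : ∃ n, ∃ a ∈ A, a ∉ J ∧ rk a.pred = n := by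
    by_contra hcon
    push Not at hcon
    exact hne (hJ.antisymm fun a ha => by_contra fun haJ => hcon _ a ha haJ rfl)
  classical
  obtain ⟨a, ha, haJ, han⟩ := Nat.find_spec hex
  set n := Nat.find hex with hn
  have hlt : ∀ g ∈ A, rk g.pred < n → g ∈ J := fun g hg hgn => by_contra fun hgJ =>
    Nat.find_min hex hgn ⟨g, hg, hgJ, rfl⟩
  obtain ⟨r, hr, h, hh, σ, hg, hb, hhD, hp⟩ :=
    hA.founded {g | g ∈ A ∧ g ∉ J ∧ rk g.pred = n} (fun g hg => hg.1) ⟨a, ha, haJ, han⟩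
      (fun g hg => Nat.pos_of_ne_zero fun h => hg.2.1 (h0 g hg.1 h))
  have hpos : 0 < rk h.pred := Nat.pos_of_ne_zero fun hz => hhD.2.1 (h0 _ hhD.1 hz)
  have hhn : rk h.pred = n := hhD.2.2
  obtain ⟨s1, s2, s3⟩ := hP r hr h hh hpos
  have := hm r hr σ hg hb.2.1 hb.2.2
    (fun b hbp => by
      by_contra hbJ
      have hbA := hb.1 b hbp
      rcases lt_or_eq_of_le (s1 b hbp) with hlt' | heq
      · exact hbJ (hlt _ hbA (hhn ▸ hlt'))
      · exact hp b hbp ⟨hbA, hbJ, heq.trans hhn⟩)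
    (fun d hd => (Builtin.holds_congr d (fun b hbd g hgb =>
      ⟨fun hgA => hlt g hgA (by rw [hgb, ← hhn]; exact s3 d hd b hbd), fun h => hJ h⟩)).1
      (hb.2.2 d hd))
  rw [hh] at this
  exact hhD.2.1 this

/-- The least set that contains `G` and is closed above with respect to `I`. -/
def leastAbove (P : Program L V) (rk : L.Pred → ℕ) (G I : Set (GAtom L)) : Set (GAtom L) :=
  ⋂₀ {J | G ⊆ J ∧ ClosedAbove P rk I J}

theorem leastAbove_subset {P : Program L V} {rk : L.Pred → ℕ} {G I J : Set (GAtom L)}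
    (hG : G ⊆ J) (hJ : ClosedAbove P rk I J) : leastAbove P rk G I ⊆ J :=
  Set.sInter_subset_of_mem ⟨hG, hJ⟩

theorem subset_leastAbove {P : Program L V} {rk : L.Pred → ℕ} {G I : Set (GAtom L)} :
    G ⊆ leastAbove P rk G I := Set.subset_sInter fun _ h => h.1

theorem closedAbove_leastAbove {P : Program L V} {rk : L.Pred → ℕ} {G I : Set (GAtom L)} :
    ClosedAbove P rk I (leastAbove P rk G I) := by
  intro r hr h hh h0 σ hg hn hb hp
  refine Set.mem_sInter.2 fun J hJ => hJ.2 r hr h hh h0 σ hg hn hb fun b hbp => ?_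
  exact Set.mem_sInter.1 (hp b hbp) J hJ

/-- Up to rank `n`, negation and aggregates look only at ranks below `n`, so the least closure at
these ranks does not see the rest of `I`. -/
theorem leastAbove_local {P : Program L V} {rk : L.Pred → ℕ} (hP : Stratified P rk)
    {G I I' : Set (GAtom L)} {n : ℕ} (hI : ∀ a, rk a.pred < n → (a ∈ I ↔ a ∈ I')) :
    ∀ a ∈ leastAbove P rk G I, rk a.pred < n + 1 → a ∈ leastAbove P rk G I' := by
  have : leastAbove P rk G I ⊆ {a | rk a.pred < n + 1 → a ∈ leastAbove P rk G I'} := by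
    refine leastAbove_subset (fun a ha _ => subset_leastAbove ha) ?_
    intro r hr h hh h0 σ hg hn hb hp hlt
    have hlt : rk h.pred < n + 1 := hlt
    obtain ⟨s1, s2, s3⟩ := hP r hr h hh h0
    refine closedAbove_leastAbove r hr h hh h0 σ hg (fun c hc hcI => hn c hc ?_) (fun d hd => ?_)
      (fun b hbp => hp b hbp (lt_of_le_of_lt (s1 b hbp) hlt))
    · exact (hI _ (lt_of_lt_of_le (s2 c hc) (Nat.lt_succ_iff.1 hlt))).2 hcI
    · refine (Builtin.holds_congr d fun a had g hga => hI g ?_).1 (hb d hd)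
      rw [hga]
      exact lt_of_lt_of_le (s3 d hd a had) (Nat.lt_succ_iff.1 hlt)
  exact fun a ha => this ha

/-- A choice of the atoms of rank zero extends to a set that is stable above. -/
theorem exists_stableAbove {P : Program L V} {rk : L.Pred → ℕ} (hP : Stratified P rk) {N : ℕ}
    (hN : ∀ p, rk p < N) {G : Set (GAtom L)} (hG : G ⊆ herbrandBase P)
    (hG0 : ∀ a ∈ G, rk a.pred = 0) :
    ∃ A, StableAbove P rk A ∧ ∀ a, rk a.pred = 0 → (a ∈ A ↔ a ∈ G) := by
  -- After `n` rounds the ranks below `n` no longer change, whatever the starting set. Since `N`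
  -- bounds all ranks, `It N` is a fixed point.
  let It : ℕ → Set (GAtom L) := fun n => (leastAbove P rk G)^[n] ∅
  have hstep : ∀ n, It (n + 1) = leastAbove P rk G (It n) := fun n =>
    Function.iterate_succ_apply' _ _ _
  have hagree : ∀ n, ∀ a, rk a.pred < n → (a ∈ It n ↔ a ∈ It (n + 1)) := by
    intro n
    induction n with
    | zero => intro a ha; exact absurd ha (Nat.not_lt_zero _)
    | succ n ih =>
      intro a ha
      rw [hstep n, hstep (n + 1)]
      exact ⟨fun h => leastAbove_local hP ih a h ha,
        fun h => leastAbove_local hP (fun b hb => (ih b hb).symm) a h ha⟩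
  have hfix : leastAbove P rk G (It N) = It N := by
    rw [← hstep]
    ext a
    exact (hagree N a (hN _)).symm
  generalize It N = A at hfix
  have hGA : G ⊆ A := hfix ▸ subset_leastAbove
  refine ⟨A, ⟨?_, ?_, ?_⟩, fun a ha => ⟨fun haA => ?_, fun h => hGA h⟩⟩
  · rw [← hfix]
    refine leastAbove_subset hG ?_
    intro r hr h hh _ σ hg _ _ _
    exact hg.head_mem hr (by rw [hh]; rfl)
  · have := closedAbove_leastAbove (P := P) (rk := rk) (G := G) (I := A)
    rwa [hfix] at this
  · intro D hD hne hpos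
    by_contra hcon
    -- `A` is the least set that contains `G` and is closed with respect to `A`. An unfounded `D` of
    -- positive rank could be removed without losing `G` or closure.
    have : A ⊆ A \ D := by
      conv_lhs => rw [← hfix]
      refine leastAbove_subset (fun a ha => ⟨hGA ha, fun haD => ?_⟩) ?_
      · exact (hpos a haD).ne' (hG0 a ha)
      · intro r hr h hh h0 σ hg hn hb hp
        have hhA : h.subst σ ∈ A := by
          have := closedAbove_leastAbove (P := P) (rk := rk) (G := G) (I := A)
          rw [hfix] at this
          exact this r hr h hh h0 σ hg hn hb (fun b hbp => (hp b hbp).1)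
        exact ⟨hhA, fun hhD => hcon ⟨r, hr, h, hh, σ, hg, ⟨fun b hbp => (hp b hbp).1, hn, hb⟩,
          hhD, fun b hbp => (hp b hbp).2⟩⟩
    obtain ⟨a, ha⟩ := hne
    exact (this (hD ha)).2 ha
  · have : A ⊆ {a | rk a.pred = 0 → a ∈ G} := by
      conv_lhs => rw [← hfix]
      refine leastAbove_subset (fun a ha _ => ha) ?_
      intro r hr h hh h0 σ _ _ _ _ hz
      exact absurd hz h0.ne'
    exact this haA ha

end Generic

end ASP

namespace LOAS

open ASP

universe u v w

/-! ### Object terms and atoms inside the meta language -/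

section Quotation

variable {K : Type u} {P : Type v} {V : Type w}

/-- A ground term of the task as a ground term of the meta language. -/
def qTerm : GTerm (objSig K P) → GTerm (metaSig K P V)
  | .var v => v.elim
  | .int n => .int n
  | .sym c => .sym (.obj c)
  | .fn f _ => f.elim

/-- A ground atom of the task as a ground term of the meta language. -/
def qAtom (a : OAtom K P) : GTerm (metaSig K P V) := .fn (.pred a.pred) (a.args.map qTerm)

theorem qTerm_injective : Function.Injective (qTerm : GTerm (objSig K P) → GTerm (metaSig K P V)) := by
  intro s t h
  cases s with
  | var v => exact v.elim
  | fn f _ => exact f.elim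
  | int n =>
    cases t with
    | var v => exact v.elim
    | fn f _ => exact f.elim
    | int m => simp only [qTerm, Term.int.injEq] at h; rw [h]
    | sym c => simp [qTerm] at h
  | sym c =>
    cases t with
    | var v => exact v.elim
    | fn f _ => exact f.elim
    | int m => simp [qTerm] at h
    | sym c' => simp only [qTerm, Term.sym.injEq, MConst.obj.injEq] at h; rw [h]

theorem qAtom_injective : Function.Injective (qAtom : OAtom K P → GTerm (metaSig K P V)) := by
  rintro ⟨p, as⟩ ⟨q, bs⟩ h
  simp only [qAtom, Term.fn.injEq, MFun.pred.injEq] at h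
  obtain ⟨rfl, h⟩ := h
  rw [(List.map_injective_iff.2 qTerm_injective) h]

@[simp] theorem qAtom_inj {a b : OAtom K P} :
    (qAtom a : GTerm (metaSig K P V)) = qAtom b ↔ a = b := qAtom_injective.eq_iff

theorem qTerm_eq_int {t : GTerm (objSig K P)} {n : ℤ} :
    (qTerm t : GTerm (metaSig K P V)) = .int n ↔ t = .int n := by
  constructor
  · intro h; exact qTerm_injective (V := V) (by simpa [qTerm] using h)
  · rintro rfl; rfl

theorem quoteGTerm_subst (σ : MVar V → GTerm (metaSig K P V)) (t : GTerm (objSig K P)) :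
    (quoteGTerm t : MTerm K P V).subst σ = qTerm t := by
  cases t with
  | var v => exact v.elim
  | fn f _ => exact f.elim
  | int n => simp [quoteGTerm, qTerm, Term.subst]
  | sym c => simp [quoteGTerm, qTerm, Term.subst]

@[simp] theorem quoteGAtom_subst (σ : MVar V → GTerm (metaSig K P V)) (a : OAtom K P) :
    (quoteGAtom a : MTerm K P V).subst σ = qAtom a := by
  simp [quoteGAtom, qAtom, Term.subst, quoteGTerm_subst]

theorem quoteTerm_subst {σ : V → GTerm (objSig K P)} {σ' : MVar V → GTerm (metaSig K P V)}
    (t : Term (objSig K P) V) (h : ∀ v ∈ t.vars, σ' (.obj v) = qTerm (σ v)) :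
    (quoteTerm t).subst σ' = qTerm (t.subst σ) := by
  cases t with
  | var v => simpa [quoteTerm, Term.subst] using h v (by simp [Term.vars])
  | fn f _ => exact f.elim
  | int n => simp [quoteTerm, qTerm, Term.subst]
  | sym c => simp [quoteTerm, qTerm, Term.subst]

theorem quoteAtom_subst {σ : V → GTerm (objSig K P)} {σ' : MVar V → GTerm (metaSig K P V)}
    (a : Atom (objSig K P) V) (h : ∀ v ∈ a.vars, σ' (.obj v) = qTerm (σ v)) :
    (quoteAtom a).subst σ' = qAtom (a.subst σ) := by
  simp only [quoteAtom, Term.subst, qAtom, Atom.subst, List.map_map, Term.fn.injEq, true_and]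
  refine List.map_congr_left fun t ht => ?_
  exact quoteTerm_subst t fun v hv => h v (List.mem_flatMap.2 ⟨t, ht, hv⟩)

theorem exists_eq_qTerm_of_quoteAtom {σ' : MVar V → GTerm (metaSig K P V)}
    {a : Atom (objSig K P) V} {b : OAtom K P} (h : (quoteAtom a).subst σ' = qAtom b) {v : V}
    (hv : v ∈ a.vars) : ∃ t, σ' (.obj v) = qTerm t := by
  simp only [quoteAtom, Term.subst, qAtom, List.map_map, Term.fn.injEq] at h
  obtain ⟨t, ht, hv⟩ := List.mem_flatMap.1 hv
  have hmem : (quoteTerm t).subst σ' ∈ List.map qTerm b.args := by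
    rw [← h.2]
    exact List.mem_map.2 ⟨t, ht, rfl⟩
  cases t with
  | var w =>
    simp only [Term.vars, List.mem_singleton] at hv
    subst hv
    obtain ⟨s, _, hs⟩ := List.mem_map.1 hmem
    exact ⟨s, by simpa [quoteTerm, Term.subst] using hs.symm⟩
  | fn f _ => exact f.elim
  | int n => simp [Term.vars] at hv
  | sym c => simp [Term.vars] at hv

/-- On the variables of the rule `r`, the substitution `σ'` is the quotation of `σ`. -/
def Quotes (r : ORule K P V) (σ : V → GTerm (objSig K P))
    (σ' : MVar V → GTerm (metaSig K P V)) : Prop :=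
  ∀ v ∈ r.vars, σ' (.obj v) = qTerm (σ v)

/-- Meta substitutions may send object variables to identifiers or to quoted atoms. If the positive
body matches quoted ground atoms, safety excludes this, and the substitution comes from an object
substitution. -/
theorem exists_quotes {r : ORule K P V} (hr : r.IsSafe) {σ' : MVar V → GTerm (metaSig K P V)}
    (h : ∀ b ∈ r.pos, ∃ a : OAtom K P, (quoteAtom b).subst σ' = qAtom a) :
    ∃ σ, Quotes r σ σ' := by
  have : ∀ v : V, ∃ t : GTerm (objSig K P), v ∈ r.vars → σ' (.obj v) = qTerm t := by
    intro v
    by_cases hv : v ∈ r.vars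
    · obtain ⟨b, hb, hvb⟩ := hr v hv
      obtain ⟨a, ha⟩ := h b hb
      obtain ⟨t, ht⟩ := exists_eq_qTerm_of_quoteAtom ha hvb
      exact ⟨t, fun _ => ht⟩
    -- An arbitrary value: nothing is required outside the variables of `r`.
    · exact ⟨.int 0, fun h => absurd h hv⟩
  choose σ hσ using this
  exact ⟨σ, fun v hv => hσ v hv⟩

/-- The quotation of `σ`, all new variables having the value `t`. -/
def liftSubst (σ : V → GTerm (objSig K P)) (t : GTerm (metaSig K P V)) :
    MVar V → GTerm (metaSig K P V)
  | .obj v => qTerm (σ v)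
  | _ => t

theorem quotes_liftSubst (r : ORule K P V) (σ : V → GTerm (objSig K P))
    (t : GTerm (metaSig K P V)) : Quotes r σ (liftSubst σ t) := fun _ _ => rfl

section Quotes

variable {r : ORule K P V} {σ : V → GTerm (objSig K P)} {σ' : MVar V → GTerm (metaSig K P V)}

theorem Quotes.atom (h : Quotes r σ σ') {a : Atom (objSig K P) V}
    (ha : ∀ v ∈ a.vars, v ∈ r.vars) (p : MPred) :
    (reifyAtom p varX a).subst σ' = ⟨p, [qAtom (a.subst σ), σ' .X]⟩ := by
  simp [reifyAtom, mat, Atom.subst, varX, Term.subst]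
  exact quoteAtom_subst a fun v hv => h v (ha v hv)

theorem Quotes.pos (h : Quotes r σ σ') {a : Atom (objSig K P) V} (ha : a ∈ r.pos) (p : MPred) :
    (reifyAtom p varX a).subst σ' = ⟨p, [qAtom (a.subst σ), σ' .X]⟩ :=
  h.atom (fun v hv => by
    have := List.mem_flatMap.2 ⟨a, ha, hv⟩
    simp only [Rule.vars, List.mem_append]; tauto) p

theorem Quotes.neg (h : Quotes r σ σ') {a : Atom (objSig K P) V} (ha : a ∈ r.neg) (p : MPred) :
    (reifyAtom p varX a).subst σ' = ⟨p, [qAtom (a.subst σ), σ' .X]⟩ :=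
  h.atom (fun v hv => by
    have := List.mem_flatMap.2 ⟨a, ha, hv⟩
    simp only [Rule.vars, List.mem_append]; tauto) p

theorem Quotes.head (h : Quotes r σ σ') {a : Atom (objSig K P) V} (ha : r.head.Offers a)
    (p : MPred) :
    (reifyAtom p varX a).subst σ' = ⟨p, [qAtom (a.subst σ), σ' .X]⟩ :=
  h.atom (fun v hv => by
    have := ha.mem_vars hv
    simp only [Rule.vars, List.mem_append]; tauto) p

theorem Quotes.quoteHead (h : Quotes r σ σ') {a : Atom (objSig K P) V} (ha : r.head.Offers a) :
    (quoteAtom a).subst σ' = qAtom (a.subst σ) :=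
  quoteAtom_subst a fun v hv => h v (by
    have := ha.mem_vars hv
    simp only [Rule.vars, List.mem_append]; tauto)

theorem Quotes.weak (h : Quotes r σ σ') {wt lev : Term (objSig K P) V}
    {ts : List (Term (objSig K P) V)} (hw : r.head = .weak wt lev ts) :
    (quoteTerm wt).subst σ' = qTerm (wt.subst σ) ∧
    (quoteTerm lev).subst σ' = qTerm (lev.subst σ) ∧
    (ts.map quoteTerm).map (Term.subst σ') = (ts.map (Term.subst σ)).map qTerm := by
  have hv : ∀ v ∈ wt.vars ++ lev.vars ++ ts.flatMap Term.vars, σ' (.obj v) = qTerm (σ v) := by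
    intro v hv
    refine h v ?_
    simp only [Rule.vars, hw, Head.vars, List.mem_append] at hv ⊢
    tauto
  refine ⟨quoteTerm_subst _ fun v hw => hv v (by simp [hw]),
    quoteTerm_subst _ fun v hw => hv v (by simp [hw]), ?_⟩
  simp only [List.map_map]
  refine List.map_congr_left fun t ht => quoteTerm_subst _ fun v hw => hv v ?_
  have := List.mem_flatMap.2 ⟨t, ht, hw⟩
  simp [this]

end Quotes

/-- The interpretation that `A` represents by the atoms `p(a, t)`. -/
def proj (p : MPred) (A : Set (GAtom (metaSig K P V))) (t : GTerm (metaSig K P V)) :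
    Set (OAtom K P) := {a | ⟨p, [qAtom a, t]⟩ ∈ A}

/-- The map from `a` to `p(a, t)` is injective, so distinct true head atoms are counted alike in
both languages. -/
theorem countTrue_reify {r : ORule K P V} {σ : V → GTerm (objSig K P)}
    {σ' : MVar V → GTerm (metaSig K P V)} (h : Quotes r σ σ') {l u : ℤ}
    {hs : List (Atom (objSig K P) V)} (hh : r.head = .choice l hs u) (p : MPred)
    (A : Set (GAtom (metaSig K P V))) :
    countTrue σ' (hs.map (reifyAtom p varX)) A = countTrue σ hs (proj p A (σ' .X)) := by
  unfold countTrue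
  have hinj : Function.Injective
      (fun a : OAtom K P => (⟨p, [qAtom a, σ' .X]⟩ : GAtom (metaSig K P V))) := by
    intro a b hab
    simpa using hab
  rw [← Set.ncard_image_of_injective _ hinj]
  congr 2
  ext g
  simp only [Set.mem_ofPred_eq, List.mem_map, exists_exists_and_eq_and, Set.mem_image]
  constructor
  · rintro ⟨hg, b, hb, rfl⟩
    have := h.head (a := b) (by rw [hh]; exact hb) p
    exact ⟨b.subst σ, ⟨by rw [this] at hg; exact hg, b, hb, rfl⟩, this.symm⟩
  · rintro ⟨_, ⟨ha, b, hb, rfl⟩, rfl⟩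
    exact ⟨ha, b, hb, (h.head (a := b) (by rw [hh]; exact hb) p).symm⟩

end Quotation

/-! ### Finiteness of the weak constraint tuples of an object program -/

section Finiteness

variable {K : Type u} {P : Type v} {V : Type w}

theorem finite_lists {α : Type*} {s : Set α} (hs : s.Finite) (n : ℕ) :
    {l : List α | l.length = n ∧ ∀ x ∈ l, x ∈ s}.Finite := by
  induction n with
  | zero =>
    refine (Set.finite_singleton []).subset ?_
    rintro l ⟨hl, _⟩
    exact List.length_eq_zero_iff.1 hl
  | succ n ih =>
    refine ((hs.prod ih).image fun p : α × List α => p.1 :: p.2).subset ?_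
    rintro l ⟨hl, hm⟩
    cases l with
    | nil => simp at hl
    | cons a l =>
      refine ⟨(a, l), ⟨hm a (by simp), by simpa using hl, fun x hx => hm x (by simp [hx])⟩, rfl⟩

theorem symbols_finite {L : Sig} {Q : Program L V} (hQ : Q.Finite) : (symbols Q).Finite := by
  have : symbols Q = ⋃ r ∈ Q, {s | s ∈ r.symbols} := by
    ext s; simp [symbols]
  rw [this]
  exact hQ.biUnion fun r _ => List.finite_toSet _

/-- Without function symbols every ground term is a single symbol of the program. -/
theorem herbrandUniverse_finite {Q : Program (objSig K P) V} (hQ : Q.Finite) :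
    (herbrandUniverse Q).Finite := by
  refine ((symbols_finite hQ).image (fun s : Symbol (objSig K P) => match s with
    | .int n => (Term.int n : GTerm (objSig K P))
    | .sym c => .sym c
    | .fn f _ => f.elim
    | .pred _ _ => .int 0)).subset ?_
  intro t ht
  cases t with
  | var v => exact v.elim
  | fn f _ => exact f.elim
  | int n => exact ⟨.int n, ht _ (by simp [Term.symbols]), rfl⟩
  | sym c => exact ⟨.sym c, ht _ (by simp [Term.symbols]), rfl⟩

/-- The tails of the ground weak constraints of `Q` whose body is true in `I`. -/
def tails (Q : Program (objSig K P) V) (I : Set (OAtom K P)) :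
    Set (GTerm (objSig K P) × GTerm (objSig K P) × List (GTerm (objSig K P))) :=
  {q | ∃ r ∈ Q, ∃ σ : V → GTerm (objSig K P), (∀ b ∈ r.pos, b.subst σ ∈ I) ∧
    (∀ c ∈ r.neg, c.subst σ ∉ I) ∧ ∃ wt lev ts, r.head = .weak wt lev ts ∧
      q = (wt.subst σ, lev.subst σ, ts.map (Term.subst σ))}

/-- `tails` omits the Herbrand condition and admits weights and levels that are not integers, as the
atoms `w` do; safety makes the first difference void. -/
theorem mem_weakTuples_iff {Q : Program (objSig K P) V} (hQ : ∀ r ∈ Q, r.IsBasic ∧ r.IsSafe)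
    {I : Set (OAtom K P)} (hI : I ⊆ herbrandBase Q) {n l : ℤ} {ts : List (GTerm (objSig K P))} :
    (n, l, ts) ∈ weakTuples Q I ↔ (.int n, .int l, ts) ∈ tails Q I := by
  constructor
  · rintro ⟨r, hr, σ, hg, hb, wt, lev, ts, hh, h1, h2, h3⟩
    refine ⟨r, hr, σ, hb.1, hb.2.1, wt, lev, ts, hh, ?_⟩
    simp_all
  · rintro ⟨r, hr, σ, hp, hn, wt, lev, ts, hh, heq⟩
    have hb : r.builtins = [] := (hQ r hr).1
    simp only [Prod.mk.injEq] at heq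
    exact ⟨r, hr, σ, Grounds.of_safe (hQ r hr).2 hI hp, ⟨hp, hn, by simp [hb]⟩, wt, lev, ts, hh,
      heq.1.symm, heq.2.1.symm, heq.2.2.symm⟩

/-- `levelSum` is a `finsum` and would silently be zero on infinite support. Weights and levels are
integers among the finitely many symbols, and each rule fixes the length of its list of terms. -/
theorem weakTuples_finite {Q : Program (objSig K P) V} (hQ : Q.Finite) (I : Set (OAtom K P)) :
    (weakTuples Q I).Finite := by
  have hint : {n : ℤ | Symbol.int n ∈ symbols Q}.Finite :=
    (symbols_finite hQ).preimage fun a _ b _ h => by simpa using h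
  have h1 : (⋃ r ∈ Q, match r.head with
    | .weak _ _ ts => {n : ℤ | Symbol.int n ∈ symbols Q} ×ˢ ({n : ℤ | Symbol.int n ∈ symbols Q} ×ˢ
        {l : List (GTerm (objSig K P)) | l.length = ts.length ∧ ∀ x ∈ l, x ∈ herbrandUniverse Q})
    | _ => ∅).Finite := by
    refine hQ.biUnion fun r _ => ?_
    cases r.head with
    | weak wt lev ts => exact hint.prod (hint.prod (finite_lists (herbrandUniverse_finite hQ) _))
    | _ => exact Set.finite_empty
  refine h1.subset ?_
  rintro ⟨n, l, ts'⟩ ⟨r, hr, σ, hg, hb, wt, lev, ts, hh, h1, h2, h3⟩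
  refine Set.mem_biUnion (x := r) hr ?_
  rw [hh]
  have key : ∀ t : Term (objSig K P) V, (∀ s ∈ t.symbols, s ∈ r.head.symbols) →
      (∀ v ∈ t.vars, v ∈ r.head.vars) → t.subst σ ∈ herbrandUniverse Q := by
    intro t hs hv s hst
    rcases Term.mem_symbols_of_subst t hst with h | ⟨v, hvt, h⟩
    · exact ⟨r, hr, by simp [Rule.symbols, hs s h]⟩
    · exact hg v (by simp [Rule.vars, hv v hvt]) s h
  simp only at h1 h2 h3
  refine ⟨?_, ?_, ?_⟩
  · exact (h1 ▸ key wt (by simp +contextual [hh, Head.symbols])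
      (by simp +contextual [hh, Head.vars])) _ (by simp [Term.symbols])
  · exact (h2 ▸ key lev (by simp +contextual [hh, Head.symbols])
      (by simp +contextual [hh, Head.vars])) _ (by simp [Term.symbols])
  · refine ⟨by simp [← h3], ?_⟩
    simp only [← h3, List.mem_map]
    rintro _ ⟨t, ht, rfl⟩
    refine key t (fun s hs => ?_) (fun v hv => ?_)
    · have := List.mem_flatMap.2 ⟨t, ht, hs⟩
      simp [hh, Head.symbols, this]
    · have := List.mem_flatMap.2 ⟨t, ht, hv⟩
      simp [hh, Head.vars, this]

theorem Task.prog_finite (T : Task K P V) (H : Finset (ORule K P V)) : (T.prog H).Finite :=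
  (T.B.finite_toSet.union H.finite_toSet)

theorem Task.prog_wf (T : Task K P V) {H : Finset (ORule K P V)} (hH : H ⊆ T.S) :
    ∀ r ∈ T.prog H, r.IsBasic ∧ r.IsSafe := by
  rintro r (hr | hr)
  · exact T.B_wf r hr
  · exact T.S_wf r (hH hr)

end Finiteness

end LOAS

namespace LOAS

open ASP

universe u v w

/-! ### The meta program as a list of rule schemes, and its strata -/

section Rules

variable {K : Type u} {P : Type v} {V : Type w}

/-- `c` names an answer set that the meta program guesses. -/
inductive AsId (T : Task K P V) : MConst K P V → Prop
  | ex {e} (he : e ∈ T.Epos) : AsId T (.exId e)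
  | n (h : T.Eneg.Nonempty) : AsId T .n
  | ord1 {o} (ho : o ∈ T.Ob) : AsId T (.ordId1 o)
  | ord2 {o} (ho : o ∈ T.Ob) : AsId T (.ordId2 o)

/-- The answer set named by `c` has to extend `e`. -/
inductive CoverId (T : Task K P V) : PartialInterp K P → MConst K P V → Prop
  | ex {e} (he : e ∈ T.Epos) : CoverId T e (.exId e)
  | ord1 {o} (ho : o ∈ T.Ob) : CoverId T o.1 (.ordId1 o)
  | ord2 {o} (ho : o ∈ T.Ob) : CoverId T o.2 (.ordId2 o)

/-- `c` names the interpretation `I`, which occurs in a violating reason. -/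
inductive VsId (VR : Set (Reason K P)) : MConst K P V → Set (OAtom K P) → Prop
  | interp {I} (h : .interp I ∈ VR) : VsId VR (.viId I) I
  | fst {I₁ I₂} (h : .pair I₁ I₂ ∈ VR) : VsId VR (.vpId1 I₁ I₂) I₁
  | snd {I₁ I₂} (h : .pair I₁ I₂ ∈ VR) : VsId VR (.vpId2 I₁ I₂) I₂

/-- The meta program compares the interpretations named by the two constants. -/
inductive DomPair (T : Task K P V) (VR : Set (Reason K P)) : MConst K P V → MConst K P V → Prop
  | ob {o} (ho : o ∈ T.Ob) : DomPair T VR (.ordId1 o) (.ordId2 o)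
  | oc {o} (ho : o ∈ T.Oc) : DomPair T VR (.exId o.1) (.exId o.2)
  | vp {I₁ I₂} (h : .pair I₁ I₂ ∈ VR) : DomPair T VR (.vpId1 I₁ I₂) (.vpId2 I₁ I₂)

/-- `r` is a rule of the background knowledge or of the search space, and `c` is the condition
under which it is in the program that is represented. -/
inductive Src (T : Task K P V) : ORule K P V → List (MAtom K P V) → Prop
  | bg {r} (hr : r ∈ T.B) : Src T r []
  | hyp {r} (hr : r ∈ T.S) : Src T r [inH r]

/-- The atoms `c` are added to the positive body. -/
def addPos (r : MRule K P V) (c : List (MAtom K P V)) : MRule K P V :=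
  { r with pos := r.pos ++ c }

theorem addPos_nil (r : MRule K P V) : addPos r [] = r := by
  cases r; simp [addPos]

/-- The rules of the meta program, indexed by the predicate of their head atom. -/
inductive MetaRule (T : Task K P V) (VR : Set (Reason K P)) : Option MPred → MRule K P V → Prop
  | normal {r c h} (hs' : Src T r c) (hh : r.head = .atom h) : MetaRule T VR (some .in_as)
      (addPos (append (reify .in_as varX r) (mat .as [varX])) c)
  | hard {r c} (hs' : Src T r c) (hh : r.head = .bot) : MetaRule T VR none
      (addPos (append (reify .in_as varX r) (mat .as [varX])) c)
  | choice {r c l hs u} (hs' : Src T r c) (hh : r.head = .choice l hs u) : MetaRule T VR none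
      (addPos (append (reify .in_as varX r) (mat .as [varX])) c)
  | weakAs {r c wt lev ts} (hs' : Src T r c) (hh : r.head = .weak wt lev ts) :
      MetaRule T VR (some .w) (addPos (metaWeak wt lev ts r.pos r.neg .in_as .as varX) c)
  | weakVs {r c wt lev ts} (hs' : Src T r c) (hh : r.head = .weak wt lev ts) :
      MetaRule T VR (some .w) (addPos (metaWeak wt lev ts r.pos r.neg .in_vs .vs varX) c)
  | score {r} (hr : r ∈ T.S) : MetaRule T VR none
      { head := .weak (.int (2 * (r.length : ℤ))) (.int 0) [.sym (.ruleId r)], pos := [inH r] }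
  | guess : MetaRule T VR none { head := .choice 0 (T.S.toList.map inH) (T.S.card : ℤ) }
  | cov {e c} (h : CoverId T e c) : MetaRule T VR (some .cov)
      (extendsRule (mat .cov [.sym c]) e (.sym c))
  | covered {e c} (h : CoverId T e c) : MetaRule T VR none
      { head := .bot, neg := [mat .cov [.sym c]] }
  | as {c} (h : AsId T c) : MetaRule T VR (some .as) (fact (mat .as [.sym c]))
  | violInterp {e} (he : e ∈ T.Eneg) : MetaRule T VR (some .v_i)
      (extendsRule (mat .v_i []) e (.sym .n))
  | violating_of_interp : MetaRule T VR (some .violating)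
      { head := .atom (mat .violating []), pos := [mat .v_i []] }
  | violating_of_pair : MetaRule T VR (some .violating)
      { head := .atom (mat .violating []), pos := [mat .v_p []] }
  | penalty : MetaRule T VR none { head := .weak (.int 1) (.int 0) [], neg := [mat .violating []] }
  | dom_lv {c d} (h : DomPair T VR c d) : MetaRule T VR (some .dom_lv)
      { head := .atom (mat .dom_lv [.sym c, .sym d, .var .L])
        pos := [mat .lv [.var .L]]
        builtins := [sumBelow (.sym c) (.sym d)] }
  | non_dom_lv {c d} (h : DomPair T VR c d) : MetaRule T VR (some .non_dom_lv)
      { head := .atom (mat .non_dom_lv [.sym c, .sym d, .var .L])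
        pos := [mat .lv [.var .L]]
        builtins := [sumBelow (.sym d) (.sym c)] }
  | non_bef {c d} (h : DomPair T VR c d) : MetaRule T VR (some .non_bef)
      { head := .atom (mat .non_bef [.sym c, .sym d, .var .L])
        pos := [mat .lv [.var .L], mat .lv [.var .L2],
          mat .non_dom_lv [.sym c, .sym d, .var .L2]]
        builtins := [.lt (.var .L) (.var .L2)] }
  | dom {c d} (h : DomPair T VR c d) : MetaRule T VR (some .dom)
      { head := .atom (mat .dom [.sym c, .sym d])
        pos := [mat .dom_lv [.sym c, .sym d, .var .L]]
        neg := [mat .non_bef [.sym c, .sym d, .var .L]] }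
  | brave {o} (ho : o ∈ T.Ob) : MetaRule T VR none
      { head := .bot, neg := [mat .dom [.sym (.ordId1 o), .sym (.ordId2 o)]] }
  | lv {l} (hl : l ∈ T.levels) : MetaRule T VR (some .lv) (fact (mat .lv [.int l]))
  | violPair {o} (ho : o ∈ T.Oc) : MetaRule T VR (some .v_p)
      { head := .atom (mat .v_p [.sym (.exId o.1), .sym (.exId o.2)])
        neg := [mat .dom [.sym (.exId o.1), .sym (.exId o.2)]] }
  | somePair : MetaRule T VR (some .v_p)
      { head := .atom (mat .v_p []), pos := [mat .v_p [.var .T1, .var .T2]] }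
  | in_vs {c I a} (h : VsId VR c I) (ha : a ∈ I) : MetaRule T VR (some .in_vs)
      (fact (mat .in_vs [quoteGAtom a, .sym c]))
  | vs {c I} (h : VsId VR c I) : MetaRule T VR (some .vs) (fact (mat .vs [.sym c]))
  | excludeInterp {I} (h : .interp I ∈ VR) : MetaRule T VR none
      { head := .bot, neg := [mat .nas [.sym (.viId I)]] }
  | excludePair {I₁ I₂} (h : .pair I₁ I₂ ∈ VR) : MetaRule T VR none
      { head := .bot
        neg := [mat .nas [.sym (.vpId1 I₁ I₂)], mat .nas [.sym (.vpId2 I₁ I₂)],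
          mat .dom [.sym (.vpId1 I₁ I₂), .sym (.vpId2 I₁ I₂)]] }
  | mmrNormal {r c h} (hs' : Src T r c) (hh : r.head = .atom h) : MetaRule T VR (some .mmr)
      (addPos (mmrRule (quoteAtom h) r [mat .vs [varX]] []) c)
  | mmrHard {r c} (hs' : Src T r c) (hh : r.head = .bot) : MetaRule T VR (some .mmr)
      (addPos (mmrRule (.sym .bot) r [mat .vs [varX]] []) c)
  | mmrChoice {r c l hs u h} (hs' : Src T r c) (hh : r.head = .choice l hs u) (hm : h ∈ hs) :
      MetaRule T VR (some .mmr)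
      (addPos (mmrRule (quoteAtom h) r [reifyAtom .in_vs varX h]
        [.count (some l) (hs.map (reifyAtom .in_vs varX)) (some u)]) c)
  | mmrAbove {r c l hs u} (hs' : Src T r c) (hh : r.head = .choice l hs u) :
      MetaRule T VR (some .mmr) (addPos (mmrRule (.sym .bot) r []
        [.count (some (u + 1)) (hs.map (reifyAtom .in_vs varX)) none]) c)
  | mmrBelow {r c l hs u} (hs' : Src T r c) (hh : r.head = .choice l hs u) :
      MetaRule T VR (some .mmr) (addPos (mmrRule (.sym .bot) r []
        [.count none (hs.map (reifyAtom .in_vs varX)) (some (l - 1))]) c)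
  | nasIn : MetaRule T VR (some .nas) { head := .atom (mat .nas [varX])
                                        pos := [mat .in_vs [.var .ATOM, varX]]
                                        neg := [mat .mmr [.var .ATOM, varX]] }
  | nasOut : MetaRule T VR (some .nas) { head := .atom (mat .nas [varX])
                                         pos := [mat .mmr [.var .ATOM, varX]]
                                         neg := [mat .in_vs [.var .ATOM, varX]] }

/-- The program `T_meta ∪ VR_meta(T)`. -/
abbrev fullMeta (T : Task K P V) (VR : Set (Reason K P)) : MProgram K P V :=
  taskMeta T ∪ reasonMeta T VR

variable {T : Task K P V} {VR : Set (Reason K P)}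

theorem exists_metaRule_of_reify {r : ORule K P V} {c : List (MAtom K P V)} (hs : Src T r c)
    (hw : ¬ r.IsWeak) : ∃ p, MetaRule T VR p
      (addPos (append (reify .in_as varX r) (mat .as [varX])) c) := by
  cases hh : r.head with
  | atom h => exact ⟨_, .normal hs hh⟩
  | bot => exact ⟨_, .hard hs hh⟩
  | choice l hs' u => exact ⟨_, .choice hs hh⟩
  | weak wt lev ts => exact absurd ⟨wt, lev, ts, hh⟩ hw

theorem exists_metaRule_of_reductify {r : ORule K P V} {c : List (MAtom K P V)}
    (hs : Src T r c) {r' : MRule K P V} (hr' : r' ∈ reductify r) :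
    ∃ p, MetaRule T VR p (addPos r' c) := by
  cases hh : r.head with
  | atom h => rw [reductify, hh] at hr'; cases hr'; exact ⟨_, .mmrNormal hs hh⟩
  | bot => rw [reductify, hh] at hr'; cases hr'; exact ⟨_, .mmrHard hs hh⟩
  | choice l hs' u =>
    rw [reductify, hh] at hr'
    rcases hr' with ⟨h, hm, rfl⟩ | rfl | rfl
    · exact ⟨_, .mmrChoice hs hh hm⟩
    · exact ⟨_, .mmrAbove hs hh⟩
    · exact ⟨_, .mmrBelow hs hh⟩
  | weak => rw [reductify, hh] at hr'; exact hr'.elim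

theorem exists_metaRule_of_dominates {c d : MConst K P V} (h : DomPair T VR c d)
    {r : MRule K P V} (hr : r ∈ dominates (.sym c) (.sym d)) : ∃ p, MetaRule T VR p r := by
  rcases hr with rfl | rfl | rfl | rfl
  exacts [⟨_, .dom_lv h⟩, ⟨_, .non_dom_lv h⟩, ⟨_, .non_bef h⟩, ⟨_, .dom h⟩]

theorem exists_metaRule_of_cover {e : PartialInterp K P} {c : MConst K P V} (h : CoverId T e c)
    {r : MRule K P V} (hr : r ∈ cover e (.sym c)) : ∃ p, MetaRule T VR p r := by
  rcases hr with rfl | rfl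
  exacts [⟨_, .cov h⟩, ⟨_, .covered h⟩]

theorem exists_metaRule_of_interpFacts {I : Set (OAtom K P)} {c : MConst K P V}
    (h : VsId VR c I) {r : MRule K P V} (hr : r ∈ interpFacts I (.sym c)) :
    ∃ p, MetaRule T VR p r := by
  rcases hr with ⟨a, ha, rfl⟩ | rfl
  exacts [⟨_, .in_vs h ha⟩, ⟨_, .vs h⟩]

theorem exists_metaRule {r : MRule K P V} (hr : r ∈ fullMeta T VR) :
    ∃ p, MetaRule T VR p r := by
  rcases hr with (((((hr | hr) | hr) | hr) | hr) | hr) | ((hr | hr) | hr)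
  · rcases hr with ⟨r, hr, hw, rfl⟩ | ⟨r, hr, wt, lev, ts, hh, rfl⟩
    · simpa [addPos_nil] using exists_metaRule_of_reify (.bg hr) hw
    · exact ⟨_, by simpa [addPos_nil] using MetaRule.weakAs (VR := VR) (.bg hr) hh⟩
  · rcases hr with ((⟨r, hr, hw, rfl⟩ | ⟨r, hr, wt, lev, ts, hh, rfl⟩) | ⟨r, hr, rfl⟩) | rfl
    · exact exists_metaRule_of_reify (.hyp hr) hw
    · exact ⟨_, .weakAs (.hyp hr) hh⟩
    · exact ⟨_, .score hr⟩
    · exact ⟨_, .guess⟩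
  · obtain ⟨e, he, hr | rfl⟩ := hr
    · exact exists_metaRule_of_cover (.ex he) hr
    · exact ⟨_, .as (.ex he)⟩
  · rcases hr with ⟨e, he, rfl | rfl⟩ | rfl | rfl
    · exact ⟨_, .violInterp he⟩
    · exact ⟨_, .as (.n ⟨e, he⟩)⟩
    · exact ⟨_, .violating_of_interp⟩
    · exact ⟨_, .penalty⟩
  · rcases hr with ⟨o, ho, ((((rfl | rfl) | hr) | hr) | hr) | rfl⟩ | ⟨l, hl, rfl⟩
    · exact ⟨_, .as (.ord1 ho)⟩
    · exact ⟨_, .as (.ord2 ho)⟩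
    · exact exists_metaRule_of_cover (.ord1 ho) hr
    · exact exists_metaRule_of_cover (.ord2 ho) hr
    · exact exists_metaRule_of_dominates (.ob ho) hr
    · exact ⟨_, .brave ho⟩
    · exact ⟨_, .lv hl⟩
  · rcases hr with ⟨o, ho, hr | rfl⟩ | rfl | rfl
    · exact exists_metaRule_of_dominates (.oc ho) hr
    · exact ⟨_, .violPair ho⟩
    · exact ⟨_, .somePair⟩
    · exact ⟨_, .violating_of_pair⟩
  · obtain ⟨I, hI, hr | rfl⟩ := hr
    · exact exists_metaRule_of_interpFacts (.interp hI) hr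
    · exact ⟨_, .excludeInterp hI⟩
  · obtain ⟨I₁, I₂, hI, ((hr | hr) | hr) | rfl⟩ := hr
    · exact exists_metaRule_of_dominates (.vp hI) hr
    · exact exists_metaRule_of_interpFacts (.fst hI) hr
    · exact exists_metaRule_of_interpFacts (.snd hI) hr
    · exact ⟨_, .excludePair hI⟩
  · rcases hr with ((((⟨r, hr, hr'⟩ | rfl | rfl) | ⟨r, hr, r'', hr'', rfl⟩) |
      ⟨r, hr, wt, lev, ts, hh, rfl⟩) | ⟨r, hr, wt, lev, ts, hh, rfl⟩) | ⟨l, hl, rfl⟩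
    · simpa [addPos_nil] using exists_metaRule_of_reductify (.bg hr) hr'
    · exact ⟨_, .nasIn⟩
    · exact ⟨_, .nasOut⟩
    · exact exists_metaRule_of_reductify (.hyp hr) hr''
    · exact ⟨_, .weakVs (.hyp hr) hh⟩
    · exact ⟨_, by simpa [addPos_nil] using MetaRule.weakVs (VR := VR) (.bg hr) hh⟩
    · exact ⟨_, .lv hl⟩

theorem reify_mem {r : ORule K P V} {c : List (MAtom K P V)} (hs : Src T r c)
    (hw : ¬ r.IsWeak) :
    addPos (append (reify .in_as varX r) (mat .as [varX])) c ∈ fullMeta T VR := by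
  cases hs with
  | bg hr =>
    rw [addPos_nil]
    exact .inl (.inl (.inl (.inl (.inl (.inl (.inl ⟨r, hr, hw, rfl⟩))))))
  | hyp hr => exact .inl (.inl (.inl (.inl (.inl (.inr (.inl (.inl (.inl ⟨r, hr, hw, rfl⟩))))))))

theorem reductify_mem {r : ORule K P V} {c : List (MAtom K P V)} (hs : Src T r c)
    {r' : MRule K P V} (hr' : r' ∈ reductify r) : addPos r' c ∈ fullMeta T VR := by
  refine .inr (.inr ?_)
  cases hs with
  | bg hr =>
    rw [addPos_nil]
    exact .inl (.inl (.inl (.inl (.inl ⟨r, hr, hr'⟩))))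
  | hyp hr => exact .inl (.inl (.inl (.inr ⟨r, hr, r', hr', rfl⟩)))

theorem dominates_mem {c d : MConst K P V} (h : DomPair T VR c d)
    {r : MRule K P V} (hr : r ∈ dominates (.sym c) (.sym d)) : r ∈ fullMeta T VR := by
  cases h with
  | ob ho => exact .inl (.inl (.inr (.inl ⟨_, ho, .inl (.inr hr)⟩)))
  | oc ho => exact .inl (.inr (.inl ⟨_, ho, .inl hr⟩))
  | vp h => exact .inr (.inl (.inr ⟨_, _, h, .inl (.inl (.inl hr))⟩))

theorem cover_mem {e : PartialInterp K P} {c : MConst K P V} (h : CoverId T e c)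
    {r : MRule K P V} (hr : r ∈ cover e (.sym c)) : r ∈ fullMeta T VR := by
  cases h with
  | ex he => exact .inl (.inl (.inl (.inl (.inr ⟨_, he, .inl hr⟩))))
  | ord1 ho => exact .inl (.inl (.inr (.inl ⟨_, ho, .inl (.inl (.inl (.inr hr)))⟩)))
  | ord2 ho => exact .inl (.inl (.inr (.inl ⟨_, ho, .inl (.inl (.inr hr))⟩)))

theorem interpFacts_mem {I : Set (OAtom K P)} {c : MConst K P V}
    (h : VsId VR c I) {r : MRule K P V} (hr : r ∈ interpFacts I (.sym c)) :
    r ∈ fullMeta T VR := by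
  cases h with
  | interp h => exact .inr (.inl (.inl ⟨_, h, .inl hr⟩))
  | fst h => exact .inr (.inl (.inr ⟨_, _, h, .inl (.inl (.inr hr))⟩))
  | snd h => exact .inr (.inl (.inr ⟨_, _, h, .inl (.inr hr)⟩))

theorem not_isWeak {r : ORule K P V} {hd : Head (objSig K P) V} (hh : r.head = hd)
    (hd' : ∀ wt lev ts, hd ≠ .weak wt lev ts) : ¬ r.IsWeak := by
  rintro ⟨wt, lev, ts, h⟩
  exact hd' wt lev ts (hh.symm.trans h)

theorem MetaRule.mem {p : Option MPred} {r : MRule K P V} (hr : MetaRule T VR p r) :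
    r ∈ fullMeta T VR := by
  cases hr with
  | normal hs hh => exact reify_mem hs (not_isWeak hh (by simp))
  | hard hs hh => exact reify_mem hs (not_isWeak hh (by simp))
  | choice hs hh => exact reify_mem hs (not_isWeak hh (by simp))
  | weakAs hs hh =>
    cases hs with
    | bg hr =>
      rw [addPos_nil]
      exact .inl (.inl (.inl (.inl (.inl (.inl (.inr ⟨_, hr, _, _, _, hh, rfl⟩))))))
    | hyp hr =>
      exact .inl (.inl (.inl (.inl (.inl (.inr (.inl (.inl (.inr ⟨_, hr, _, _, _, hh, rfl⟩))))))))
  | weakVs hs hh =>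
    refine .inr (.inr ?_)
    cases hs with
    | bg hr =>
      rw [addPos_nil]
      exact .inl (.inr ⟨_, hr, _, _, _, hh, rfl⟩)
    | hyp hr => exact .inl (.inl (.inr ⟨_, hr, _, _, _, hh, rfl⟩))
  | score hr => exact .inl (.inl (.inl (.inl (.inl (.inr (.inl (.inr ⟨_, hr, rfl⟩)))))))
  | guess => exact .inl (.inl (.inl (.inl (.inl (.inr (.inr rfl))))))
  | cov h => exact cover_mem h (.inl rfl)
  | covered h => exact cover_mem h (.inr rfl)
  | as h =>
    cases h with
    | ex he => exact .inl (.inl (.inl (.inl (.inr ⟨_, he, .inr rfl⟩))))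
    | n h =>
      obtain ⟨e, he⟩ := h
      exact .inl (.inl (.inl (.inr (.inl ⟨e, he, .inr rfl⟩))))
    | ord1 ho => exact .inl (.inl (.inr (.inl ⟨_, ho, .inl (.inl (.inl (.inl (.inl rfl))))⟩)))
    | ord2 ho => exact .inl (.inl (.inr (.inl ⟨_, ho, .inl (.inl (.inl (.inl (.inr rfl))))⟩)))
  | violInterp he => exact .inl (.inl (.inl (.inr (.inl ⟨_, he, .inl rfl⟩))))
  | violating_of_interp => exact .inl (.inl (.inl (.inr (.inr (.inl rfl)))))
  | penalty => exact .inl (.inl (.inl (.inr (.inr (.inr rfl)))))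
  | dom_lv h => exact dominates_mem h (.inl rfl)
  | non_dom_lv h => exact dominates_mem h (.inr (.inl rfl))
  | non_bef h => exact dominates_mem h (.inr (.inr (.inl rfl)))
  | dom h => exact dominates_mem h (.inr (.inr (.inr rfl)))
  | brave ho => exact .inl (.inl (.inr (.inl ⟨_, ho, .inr rfl⟩)))
  | lv hl => exact .inl (.inl (.inr (.inr ⟨_, hl, rfl⟩)))
  | violPair ho => exact .inl (.inr (.inl ⟨_, ho, .inr rfl⟩))
  | somePair => exact .inl (.inr (.inr (.inl rfl)))
  | violating_of_pair => exact .inl (.inr (.inr (.inr rfl)))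
  | in_vs h ha => exact interpFacts_mem h (.inl ⟨_, ha, rfl⟩)
  | vs h => exact interpFacts_mem h (.inr rfl)
  | excludeInterp h => exact .inr (.inl (.inl ⟨_, h, .inr rfl⟩))
  | excludePair h => exact .inr (.inl (.inr ⟨_, _, h, .inr rfl⟩))
  | mmrNormal hs hh => exact reductify_mem hs (by rw [reductify, hh]; rfl)
  | mmrHard hs hh => exact reductify_mem hs (by rw [reductify, hh]; rfl)
  | mmrChoice hs hh hm =>
    exact reductify_mem hs (by rw [reductify, hh]; exact .inl ⟨_, hm, rfl⟩)
  | mmrAbove hs hh => exact reductify_mem hs (by rw [reductify, hh]; exact .inr (.inl rfl))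
  | mmrBelow hs hh => exact reductify_mem hs (by rw [reductify, hh]; exact .inr (.inr rfl))
  | nasIn => exact .inr (.inr (.inl (.inl (.inl (.inl (.inr (.inl rfl)))))))
  | nasOut => exact .inr (.inr (.inl (.inl (.inl (.inl (.inr (.inr rfl)))))))

/-- The predicate of an atomic head. -/
def headPred {L : Sig} {W : Type*} : Head L W → Option L.Pred
  | .atom h => some h.pred
  | _ => none

theorem MetaRule.headPred_eq {p : Option MPred} {r : MRule K P V} (hr : MetaRule T VR p r) :
    headPred r.head = p := by
  cases hr with
  | normal hs hh => simp [addPos, append, reify, hh, reifyHead, headPred, reifyAtom, mat]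
  | hard hs hh => simp [addPos, append, reify, hh, reifyHead, headPred]
  | choice hs hh => simp [addPos, append, reify, hh, reifyHead, headPred]
  | _ => rfl

/-- Once the index is known to be the head predicate, `cases` on `MetaRule` leaves only the rules
that can derive the atom in question. -/
theorem metaRule_of_head {r : MRule K P V} (hr : r ∈ fullMeta T VR) {h : MAtom K P V}
    (hh : r.head = .atom h) : MetaRule T VR (some h.pred) r := by
  obtain ⟨p, hp⟩ := exists_metaRule hr
  have := hp.headPred_eq
  rw [hh] at this
  change some h.pred = p at this
  exact this ▸ hp

/-- The strata of the meta program. -/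
def rank : MPred → ℕ
  | .in_as | .as | .in_h => 0
  | .in_vs | .vs | .lv | .cov | .v_i => 1
  | .w | .mmr => 2
  | .dom_lv | .non_dom_lv | .non_bef | .nas => 3
  | .dom => 4
  | .v_p => 5
  | .violating => 6

theorem rank_lt (p : MPred) : rank p < 7 := by cases p <;> decide

theorem Src.rank_eq {r : ORule K P V} {c : List (MAtom K P V)} (hs : Src T r c) :
    ∀ b ∈ c, rank b.pred = 0 := by
  cases hs <;> simp [inH, mat, rank]

/-- Dependencies within a stratum are positive: `mmr` on itself, `non_bef` on `non_dom_lv`, and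
`v_p` without arguments on `v_p` with two. Aggregates look at `w` and `in_vs`, which are settled in
lower strata. -/
theorem stratified_fullMeta : Stratified (fullMeta T VR) (rank : (metaSig K P V).Pred → ℕ) := by
  intro r hr h hh h0
  have hr := metaRule_of_head hr hh
  obtain ⟨hp, hpe⟩ : ∃ p, h.pred = p := ⟨_, rfl⟩
  rw [hpe] at hr h0 ⊢
  clear hpe hh
  have hmem : ∀ {c : List (MAtom K P V)} {n : ℕ}, (∀ b ∈ c, rank b.pred = 0) →
      ∀ b ∈ c, rank b.pred ≤ n := fun h b hb => (h b hb).le.trans (Nat.zero_le _)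
  cases hr with
  | normal hs hh => exact absurd h0 (by decide)
  | as h => exact absurd h0 (by decide)
  | weakAs hs hh | weakVs hs hh =>
    have := hmem (n := 2) hs.rank_eq
    refine ⟨?_, ?_, ?_⟩ <;> simp [addPos, metaWeak, mat, reifyAtom, rank, or_imp, forall_and]
    exact this
  | mmrNormal hs hh | mmrHard hs hh | mmrChoice hs hh | mmrAbove hs hh | mmrBelow hs hh =>
    have := hmem (n := 2) hs.rank_eq
    refine ⟨?_, ?_, ?_⟩ <;>
      simp [addPos, mmrRule, mat, reifyAtom, rank, or_imp, forall_and, Builtin.atoms]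
    try exact this
  | _ =>
    refine ⟨?_, ?_, ?_⟩ <;>
      simp [extendsRule, fact, mat, rank, varX, sumBelow, Builtin.atoms]

end Rules

end LOAS

namespace LOAS

open ASP

universe u v w

/-! ### Reading facts, stored interpretations and weak constraint tuples off a stable set -/

section Structure

variable {K : Type u} {P : Type v} {V : Type w} {T : Task K P V} {VR : Set (Reason K P)}
  {A : Set (GAtom (metaSig K P V))}

theorem decodeHyp_subset : decodeHyp T A ⊆ T.S := by
  classical exact Finset.filter_subset _ _

theorem mem_decodeHyp {r : ORule K P V} : r ∈ decodeHyp T A ↔ r ∈ T.S ∧ inHAtom r ∈ A := by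
  simp [decodeHyp]

/-- `A` represents the program `B ∪ H` together with the answer sets of `B ∪ H` named by the
identifiers, and is stable with respect to the rules that evaluate them. -/
structure Coherent (T : Task K P V) (VR : Set (Reason K P)) (A : Set (GAtom (metaSig K P V))) :
    Prop where
  stable : StableAbove (fullMeta T VR) rank A
  as_iff : ∀ ts, ⟨.as, ts⟩ ∈ A ↔ ∃ c, AsId T c ∧ ts = [.sym c]
  in_as : ∀ ts, ⟨.in_as, ts⟩ ∈ A → ∃ a c, AsId T c ∧ ts = [qAtom a, .sym c]
  answer : ∀ c, AsId T c → proj .in_as A (.sym c) ∈ answerSets (T.prog (decodeHyp T A))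

/-- Foundedness applied to a singleton. With `derive` for the converse, it yields the "if and only
if" readings of the meta predicates; only the recursive predicate `mmr` needs larger sets. -/
theorem support (hA : StableAbove (fullMeta T VR) rank A) {p : MPred} (hp : 0 < rank p)
    {ts : List (GTerm (metaSig K P V))} (ha : ⟨p, ts⟩ ∈ A) :
    ∃ r σ h, MetaRule T VR (some p) r ∧ r.head = .atom h ∧ h.subst σ = ⟨p, ts⟩ ∧
      r.BodyHolds σ A := by
  obtain ⟨r, hr, h, hh, σ, hg, hb, hd, -⟩ := hA.founded {⟨p, ts⟩} (by simpa using ha)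
    (Set.singleton_nonempty _) (by simpa using hp)
  have hd : h.subst σ = ⟨p, ts⟩ := hd
  have hr := metaRule_of_head hr hh
  have hpp : h.pred = p := congrArg Atom.pred hd
  rw [hpp] at hr
  exact ⟨r, σ, h, hr, hh, hd, hb⟩

theorem derive (hA : StableAbove (fullMeta T VR) rank A) {p : MPred}
    {r : MRule K P V} (hr : MetaRule T VR (some p) r) (hp : 0 < rank p) {h : MAtom K P V}
    (hh : r.head = .atom h) {σ : MVar V → GTerm (metaSig K P V)}
    (hg : Grounds (fullMeta T VR) r σ) (hb : r.BodyHolds σ A) : h.subst σ ∈ A := by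
  refine hA.closed r hr.mem h hh ?_ σ hg hb.2.1 hb.2.2 hb.1
  have := hr.headPred_eq
  rw [hh] at this
  cases this
  exact hp

theorem derive_of_safe (hA : StableAbove (fullMeta T VR) rank A) {p : MPred}
    {r : MRule K P V} (hr : MetaRule T VR (some p) r) (hp : 0 < rank p) {h : MAtom K P V}
    (hh : r.head = .atom h) {σ : MVar V → GTerm (metaSig K P V)}
    (hs : r.IsSafe) (hb : r.BodyHolds σ A) : h.subst σ ∈ A :=
  derive hA hr hp hh (Grounds.of_safe hs hA.subset_base hb.1) hb

theorem Src.safe {r : ORule K P V} {c : List (MAtom K P V)} (h : Src T r c) : r.IsSafe := by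
  cases h with
  | bg hr => exact (T.B_wf r hr).2
  | hyp hr => exact (T.S_wf r hr).2

theorem inH_subst (r : ORule K P V) (σ : MVar V → GTerm (metaSig K P V)) :
    (inH r).subst σ = inHAtom r := by
  simp [inH, mat, Atom.subst, inHAtom, Term.subst]

theorem Src.mem_prog {r : ORule K P V} {c : List (MAtom K P V)} (h : Src T r c)
    {σ : MVar V → GTerm (metaSig K P V)} (hc : ∀ b ∈ c, b.subst σ ∈ A) :
    r ∈ T.prog (decodeHyp T A) := by
  cases h with
  | bg hr => exact Or.inl hr
  | hyp hr => exact Or.inr (mem_decodeHyp.2 ⟨hr, by simpa [inH_subst] using hc⟩)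

/-- For a rule of the hypothesis the added condition is the ground atom `in_h(R_id)`; being variable
free, it affects neither safety nor the substitution. -/
theorem exists_src {r : ORule K P V} (hr : r ∈ T.prog (decodeHyp T A)) :
    ∃ c, Src T r c ∧ (∀ b ∈ c, b.vars = []) ∧
      ∀ σ : MVar V → GTerm (metaSig K P V), ∀ b ∈ c, b.subst σ ∈ A := by
  rcases hr with hr | hr
  · exact ⟨[], .bg hr, by simp, by simp⟩
  · obtain ⟨hr, hA⟩ := mem_decodeHyp.1 hr
    exact ⟨_, .hyp hr, by simp [inH, mat, Atom.vars, Term.vars], by simpa [inH_subst] using fun _ => hA⟩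

theorem AsId.not_vsId {c : MConst K P V} {I : Set (OAtom K P)} (h : AsId T c) :
    ¬ VsId VR c I := by
  intro h'
  cases h <;> cases h'

theorem VsId.unique {c : MConst K P V} {I J : Set (OAtom K P)} (h : VsId VR c I)
    (h' : VsId VR c J) : I = J := by
  cases h <;> cases h' <;> rfl

theorem vars_quoteGAtom (a : OAtom K P) : (quoteGAtom a : MTerm K P V).vars = [] := by
  refine List.eq_nil_iff_forall_not_mem.2 fun v hv => ?_
  simp only [quoteGAtom, Term.vars, List.mem_flatMap, List.mem_map] at hv
  obtain ⟨_, ⟨t, ht, rfl⟩, hv⟩ := hv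
  cases t with
  | var v => exact v.elim
  | fn f _ => exact f.elim
  | int n => simp [quoteGTerm, Term.vars] at hv
  | sym c => simp [quoteGTerm, Term.vars] at hv

theorem in_vs_iff (hA : StableAbove (fullMeta T VR) rank A)
    (ts : List (GTerm (metaSig K P V))) :
    ⟨.in_vs, ts⟩ ∈ A ↔ ∃ c I a, VsId VR c I ∧ a ∈ I ∧ ts = [qAtom a, .sym c] := by
  constructor
  · intro h
    obtain ⟨r, σ, h, hr, hh, hs, hb⟩ := support hA (by decide) h
    cases hr with
    | @in_vs c I a hc ha =>
      obtain rfl := Head.atom.inj hh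
      refine ⟨c, I, a, hc, ha, ?_⟩
      simpa [mat, Atom.subst, Term.subst] using hs.symm
  · rintro ⟨c, I, a, hc, ha, rfl⟩
    have := derive (σ := fun _ => .int 0) hA (MetaRule.in_vs hc ha) (by decide) rfl
      (by
        intro v hv
        simp [fact, mat, Rule.vars, Head.vars, Atom.vars, Term.vars, vars_quoteGAtom] at hv)
      ⟨by simp [fact], by simp [fact], by simp [fact]⟩
    simpa [mat, Atom.subst, Term.subst] using this

theorem vs_iff (hA : StableAbove (fullMeta T VR) rank A)
    (ts : List (GTerm (metaSig K P V))) :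
    ⟨.vs, ts⟩ ∈ A ↔ ∃ c I, VsId VR c I ∧ ts = [.sym c] := by
  constructor
  · intro h
    obtain ⟨r, σ, h, hr, hh, hs, hb⟩ := support hA (by decide) h
    cases hr with
    | @vs c I hc =>
      obtain rfl := Head.atom.inj hh
      refine ⟨c, I, hc, ?_⟩
      simpa [mat, Atom.subst, Term.subst] using hs.symm
  · rintro ⟨c, I, hc, rfl⟩
    have := derive (σ := fun _ => .int 0) hA (MetaRule.vs hc) (by decide) rfl
      (by
        intro v hv
        simp [fact, mat, Rule.vars, Head.vars, Atom.vars, Term.vars] at hv)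
      ⟨by simp [fact], by simp [fact], by simp [fact]⟩
    simpa [mat, Atom.subst, Term.subst] using this

theorem lv_iff (hA : StableAbove (fullMeta T VR) rank A)
    (ts : List (GTerm (metaSig K P V))) :
    ⟨.lv, ts⟩ ∈ A ↔ ∃ l ∈ T.levels, ts = [.int l] := by
  constructor
  · intro h
    obtain ⟨r, σ, h, hr, hh, hs, hb⟩ := support hA (by decide) h
    cases hr with
    | @lv l hl =>
      obtain rfl := Head.atom.inj hh
      refine ⟨l, hl, ?_⟩
      simpa [mat, Atom.subst, Term.subst] using hs.symm
  · rintro ⟨l, hl, rfl⟩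
    have := derive (σ := fun _ => .int 0) hA (MetaRule.lv hl) (by decide) rfl
      (by
        intro v hv
        simp [fact, mat, Rule.vars, Head.vars, Atom.vars, Term.vars] at hv)
      ⟨by simp [fact], by simp [fact], by simp [fact]⟩
    simpa [mat, Atom.subst, Term.subst] using this

theorem VsId.proj_eq (hA : StableAbove (fullMeta T VR) rank A) {c : MConst K P V}
    {I : Set (OAtom K P)} (h : VsId VR c I) : proj .in_vs A (.sym c) = I := by
  ext a
  change (⟨.in_vs, _⟩ : GAtom (metaSig K P V)) ∈ A ↔ _
  rw [in_vs_iff hA]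
  constructor
  · rintro ⟨c', I', a', h', ha, heq⟩
    simp only [List.cons.injEq, qAtom_inj, Term.sym.injEq, and_true] at heq
    obtain ⟨rfl, rfl⟩ := heq
    rwa [h.unique h']
  · exact fun ha => ⟨c, I, a, h, ha, rfl⟩

/-- The interpretation that the identifier `c` names in `A`. -/
def Named (T : Task K P V) (VR : Set (Reason K P)) (A : Set (GAtom (metaSig K P V)))
    (c : MConst K P V) (I : Set (OAtom K P)) : Prop :=
  (AsId T c ∧ I = proj .in_as A (.sym c)) ∨ VsId VR c I

theorem Named.unique {c : MConst K P V} {I J : Set (OAtom K P)} (h : Named T VR A c I)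
    (h' : Named T VR A c J) : I = J := by
  rcases h with ⟨h, rfl⟩ | h <;> rcases h' with ⟨h', rfl⟩ | h'
  · rfl
  · exact absurd h' h.not_vsId
  · exact absurd h h'.not_vsId
  · exact h.unique h'

/-! ### Weak constraints -/

/-- The predicates `p` and `q` are left open to treat guessed interpretations (`in_as`, `as`) and
stored ones (`in_vs`, `vs`) at once. The converse is `w_of_tails`. -/
theorem tails_of_body {r : ORule K P V} {c : List (MAtom K P V)}
    (hs : Src T r c) {wt lev : Term (objSig K P) V} {ts : List (Term (objSig K P) V)}
    (hh : r.head = .weak wt lev ts) {p q : MPred} {σ : MVar V → GTerm (metaSig K P V)}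
    (hb : (addPos (metaWeak wt lev ts r.pos r.neg p q varX) c).BodyHolds σ A)
    (hq : ∀ x, ⟨p, [x, σ .X]⟩ ∈ A → ∃ a : OAtom K P, x = qAtom a) :
    ∃ t ∈ tails (T.prog (decodeHyp T A)) (proj p A (σ .X)),
      (mat .w [quoteTerm wt, quoteTerm lev, .fn .args (ts.map quoteTerm), varX]).subst σ =
        ⟨.w, [qTerm t.1, qTerm t.2.1, .fn .args (t.2.2.map qTerm), σ .X]⟩ := by
  obtain ⟨hp, hn, -⟩ := hb
  have hp' : ∀ b ∈ r.pos, (reifyAtom p varX b).subst σ ∈ A := fun b hb =>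
    hp _ (by simp only [addPos, metaWeak, List.mem_append, List.mem_cons, List.mem_map]
             exact .inl (.inr ⟨b, hb, rfl⟩))
  obtain ⟨τ, hτ⟩ := exists_quotes (σ' := σ) hs.safe (fun b hb => hq _ (by
    have := hp' b hb
    simpa [reifyAtom, mat, Atom.subst, varX, Term.subst] using this))
  obtain ⟨h1, h2, h3⟩ := hτ.weak hh
  refine ⟨_, ⟨r, hs.mem_prog (σ := σ) fun b hb => hp b (by
      simp only [addPos, List.mem_append]; exact .inr hb), τ, ?_, ?_, wt, lev, ts, hh, rfl⟩, ?_⟩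
  · intro b hb
    have := hp' b hb
    rw [hτ.pos hb] at this
    exact this
  · intro b hb hbA
    refine hn (reifyAtom p varX b) (List.mem_map_of_mem hb) ?_
    rw [hτ.neg hb]
    exact hbA
  · simp only [mat, Atom.subst, List.map_cons, List.map_nil, h1, h2, Term.subst, varX]
    simp only [Atom.mk.injEq, true_and, List.cons.injEq, Term.fn.injEq, and_true]
    exact h3

theorem obj_mem_vars_reifyAtom {p : MPred} {b : Atom (objSig K P) V} {w : V}
    (hwb : w ∈ b.vars) : .obj w ∈ (reifyAtom p varX b : MAtom K P V).vars := by
  simp only [reifyAtom, mat, Atom.vars, List.flatMap_cons, List.mem_append]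
  refine Or.inl ?_
  obtain ⟨t, ht, hwt⟩ := List.mem_flatMap.1 hwb
  simp only [quoteAtom, Term.vars, List.mem_flatMap, List.mem_map]
  refine ⟨_, ⟨t, ht, rfl⟩, ?_⟩
  cases t with
  | var x =>
    simp only [Term.vars, List.mem_singleton] at hwt
    simp [quoteTerm, Term.vars, hwt]
  | fn f _ => exact f.elim
  | int n => simp [Term.vars] at hwt
  | sym c => simp [Term.vars] at hwt

/-- Object variables are bound by the reified positive body of the safe rule `r`, the remaining ones
by `hv`, and `c` adds no variables. -/
theorem safe_addPos {r : ORule K P V} (hr : r.IsSafe) {p : MPred} {R : MRule K P V}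
    {c : List (MAtom K P V)}
    (hp : ∀ b ∈ r.pos, reifyAtom p varX b ∈ R.pos)
    (hv : ∀ v ∈ R.vars, (∃ w ∈ r.vars, v = .obj w) ∨ ∃ b ∈ R.pos, v ∈ b.vars)
    (hc : ∀ b ∈ c, b.vars = []) : (addPos R c).IsSafe := by
  intro v hv'
  have hvR : v ∈ R.vars := by
    simp only [Rule.vars, addPos, List.flatMap_append, List.mem_append] at hv' ⊢
    have : v ∉ List.flatMap Atom.vars c := by
      simp only [List.mem_flatMap, not_exists, not_and]
      intro b hb
      simp [hc b hb]
    tauto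
  rcases hv v hvR with ⟨w, hw, rfl⟩ | ⟨b, hb, hvb⟩
  · obtain ⟨b, hb, hwb⟩ := hr w hw
    exact ⟨_, List.mem_append_left _ (hp b hb), obj_mem_vars_reifyAtom hwb⟩
  · exact ⟨b, List.mem_append_left _ hb, hvb⟩

theorem mem_vars_quoteTerm {t : Term (objSig K P) V} {v : MVar V}
    (hv : v ∈ (quoteTerm t : MTerm K P V).vars) : ∃ w ∈ t.vars, v = .obj w := by
  cases t with
  | var x => simpa [quoteTerm, Term.vars] using hv
  | fn f _ => exact f.elim
  | int n => simp [quoteTerm, Term.vars] at hv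
  | sym c => simp [quoteTerm, Term.vars] at hv

theorem mem_vars_quoteAtom {a : Atom (objSig K P) V} {v : MVar V}
    (hv : v ∈ (quoteAtom a : MTerm K P V).vars) : ∃ w ∈ a.vars, v = .obj w := by
  simp only [quoteAtom, Term.vars, List.mem_flatMap, List.mem_map] at hv
  obtain ⟨_, ⟨t, ht, rfl⟩, hv⟩ := hv
  obtain ⟨w, hw, rfl⟩ := mem_vars_quoteTerm hv
  exact ⟨w, List.mem_flatMap.2 ⟨t, ht, hw⟩, rfl⟩

theorem mem_vars_reifyAtom {p : MPred} {a : Atom (objSig K P) V} {v : MVar V}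
    (hv : v ∈ (reifyAtom p varX a : MAtom K P V).vars) : (∃ w ∈ a.vars, v = .obj w) ∨ v = .X := by
  simp only [reifyAtom, mat, Atom.vars, List.flatMap_cons, List.flatMap_nil, List.mem_append,
    varX, Term.vars, List.mem_singleton, List.not_mem_nil, or_false] at hv
  rcases hv with hv | hv
  · exact .inl (mem_vars_quoteAtom hv)
  · exact .inr hv

theorem mem_vars_map_reifyAtom {p : MPred} {as : List (Atom (objSig K P) V)} {v : MVar V}
    (hv : v ∈ (as.map (reifyAtom p varX : _ → MAtom K P V)).flatMap Atom.vars) :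
    (∃ w ∈ as.flatMap Atom.vars, v = .obj w) ∨ v = .X := by
  simp only [List.mem_flatMap, List.mem_map] at hv
  obtain ⟨_, ⟨a, ha, rfl⟩, hv⟩ := hv
  rcases mem_vars_reifyAtom hv with ⟨w, hw, rfl⟩ | rfl
  · exact .inl ⟨w, List.mem_flatMap.2 ⟨a, ha, hw⟩, rfl⟩
  · exact .inr rfl

theorem w_of_tails (hA : StableAbove (fullMeta T VR) rank A) {p q : MPred}
    (hpq : ∀ {r c wt lev ts}, Src T r c → r.head = .weak wt lev ts → MetaRule T VR (some .w)
      (addPos (metaWeak wt lev ts r.pos r.neg p q varX) c)) {x : GTerm (metaSig K P V)}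
    (hx : ⟨q, [x]⟩ ∈ A)
    {t} (ht : t ∈ tails (T.prog (decodeHyp T A)) (proj p A x)) :
    ⟨.w, [qTerm t.1, qTerm t.2.1, .fn .args (t.2.2.map qTerm), x]⟩ ∈ A := by
  obtain ⟨r, hr, σ, hp, hn, wt, lev, ts, hh, rfl⟩ := ht
  obtain ⟨c, hs, hcv, hc⟩ := exists_src hr
  have hq := quotes_liftSubst r σ x
  obtain ⟨h1, h2, h3⟩ := hq.weak hh
  have := derive_of_safe (σ := liftSubst σ x) hA (hpq hs hh) (by decide) rfl ?_ ⟨?_, ?_, ?_⟩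
  · simp only [mat, Atom.subst, List.map_cons, List.map_nil, h1, h2, Term.subst, varX] at this
    rw [h3] at this
    exact this
  · refine safe_addPos (p := p) hs.safe ?_ ?_ hcv
    · intro b hb
      exact List.mem_cons_of_mem _ (List.mem_map_of_mem hb)
    · intro v hv
      have hX : ∃ b ∈ (metaWeak wt lev ts r.pos r.neg p q varX : MRule K P V).pos,
          MVar.X ∈ b.vars :=
        ⟨mat q [varX], by simp [metaWeak], by simp [mat, varX, Atom.vars, Term.vars]⟩
      have hsub : ∀ w, w ∈ wt.vars ∨ w ∈ lev.vars ∨ w ∈ ts.flatMap Term.vars ∨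
          w ∈ r.pos.flatMap Atom.vars ∨ w ∈ r.neg.flatMap Atom.vars → w ∈ r.vars := by
        intro w hw
        simp only [Rule.vars, hh, Head.vars, List.mem_append]
        tauto
      simp only [Rule.vars, metaWeak, List.mem_append, Head.vars, mat, List.flatMap_cons,
        List.flatMap_nil, Term.vars, List.mem_flatMap (l := ts.map quoteTerm), Atom.vars, varX,
        List.mem_singleton, List.not_mem_nil, or_false] at hv
      rcases hv with (((hv | hv | ⟨_, hv', hv⟩ | rfl) | rfl | hv) | hv)
      · obtain ⟨w, hw, rfl⟩ := mem_vars_quoteTerm hv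
        exact .inl ⟨w, hsub w (by tauto), rfl⟩
      · obtain ⟨w, hw, rfl⟩ := mem_vars_quoteTerm hv
        exact .inl ⟨w, hsub w (by tauto), rfl⟩
      · obtain ⟨t, ht, rfl⟩ := List.mem_map.1 hv'
        obtain ⟨w, hw, rfl⟩ := mem_vars_quoteTerm hv
        have := List.mem_flatMap.2 ⟨t, ht, hw⟩
        exact .inl ⟨w, hsub w (by tauto), rfl⟩
      · exact .inr hX
      · exact .inr hX
      · rcases mem_vars_map_reifyAtom hv with ⟨w, hw, rfl⟩ | rfl
        · exact .inl ⟨w, hsub w (by tauto), rfl⟩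
        · exact .inr hX
      · rcases mem_vars_map_reifyAtom hv with ⟨w, hw, rfl⟩ | rfl
        · exact .inl ⟨w, hsub w (by tauto), rfl⟩
        · exact .inr hX
  · intro b hb
    simp only [addPos, metaWeak, List.mem_append, List.mem_cons, List.mem_map] at hb
    rcases hb with (rfl | ⟨b, hb, rfl⟩) | hb
    · simpa [mat, Atom.subst, varX, Term.subst, liftSubst] using hx
    · rw [hq.pos hb]; exact hp b hb
    · exact hc _ b hb
  · intro b hb
    simp only [addPos, metaWeak, List.mem_map] at hb
    obtain ⟨b, hb, rfl⟩ := hb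
    rw [hq.neg hb]
    exact hn b hb
  · simp [addPos, metaWeak]

/-- `tails` appears instead of `weakTuples` because the rules for `w` do not check that weight and
level are integers; that is left to the aggregate and to `lv`. -/
theorem Coherent.w_iff (hA : Coherent T VR A) (ts : List (GTerm (metaSig K P V))) :
    ⟨.w, ts⟩ ∈ A ↔ ∃ c I, Named T VR A c I ∧ ∃ t ∈ tails (T.prog (decodeHyp T A)) I,
      ts = [qTerm t.1, qTerm t.2.1, .fn .args (t.2.2.map qTerm), .sym c] := by
  constructor
  · intro h
    obtain ⟨r, σ, h, hr, hh, hs, hb⟩ := support hA.stable (by decide) h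
    cases hr with
    | weakAs hs' hw =>
      obtain rfl := Head.atom.inj hh
      have hX := hb.1 (mat .as [varX]) (by simp [addPos, metaWeak])
      simp only [mat, Atom.subst, varX, List.map_cons, List.map_nil, Term.subst] at hX
      obtain ⟨c, hc, hcX⟩ := (hA.as_iff _).1 hX
      simp only [List.cons.injEq, and_true] at hcX
      obtain ⟨t, ht, heq⟩ := tails_of_body hs' hw hb (fun x hx => by
        obtain ⟨a, c, -, h⟩ := hA.in_as _ hx
        simp only [List.cons.injEq] at h
        exact ⟨a, h.1⟩)
      rw [heq, hcX] at hs
      exact ⟨c, _, .inl ⟨hc, rfl⟩, t, by rwa [hcX] at ht, (congrArg Atom.args hs).symm⟩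
    | weakVs hs' hw =>
      obtain rfl := Head.atom.inj hh
      have hX := hb.1 (mat .vs [varX]) (by simp [addPos, metaWeak])
      simp only [mat, Atom.subst, varX, List.map_cons, List.map_nil, Term.subst] at hX
      obtain ⟨c, I, hc, hcX⟩ := (vs_iff hA.stable _).1 hX
      simp only [List.cons.injEq, and_true] at hcX
      obtain ⟨t, ht, heq⟩ := tails_of_body hs' hw hb (fun x hx => by
        obtain ⟨c, I, a, -, -, h⟩ := (in_vs_iff hA.stable _).1 hx
        simp only [List.cons.injEq] at h
        exact ⟨a, h.1⟩)
      rw [heq, hcX] at hs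
      refine ⟨c, I, .inr hc, t, ?_, (congrArg Atom.args hs).symm⟩
      rwa [hcX, hc.proj_eq hA.stable] at ht
  · rintro ⟨c, I, hc | hc, t, ht, rfl⟩
    · obtain ⟨hc, rfl⟩ := hc
      exact w_of_tails hA.stable (p := .in_as) (q := .as) MetaRule.weakAs
        ((hA.as_iff _).2 ⟨c, hc, rfl⟩) ht
    · refine w_of_tails hA.stable (p := .in_vs) (q := .vs) MetaRule.weakVs
        ((vs_iff hA.stable _).2 ⟨c, I, hc, rfl⟩) ?_
      rwa [hc.proj_eq hA.stable]

end Structure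

end LOAS

namespace LOAS

open ASP

universe u v w

/-! ### The atoms `dom` decide domination -/

section Comparison

variable {K : Type u} {P : Type v} {V : Type w} {T : Task K P V} {VR : Set (Reason K P)}
  {A : Set (GAtom (metaSig K P V))}

/-- Enlarging `B ∪ H` to `B ∪ S` enlarges the Herbrand universe, so ground weak constraints of the
former are among those of the latter, and a level outside `T.levels` carries no tuple. -/
theorem levelSum_eq_zero {H : Finset (ORule K P V)} (hH : H ⊆ T.S) {l : ℤ} (hl : l ∉ T.levels)
    (I : Set (OAtom K P)) : levelSum (T.prog H) l I = 0 := by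
  refine finsum_mem_eq_zero_of_forall_eq_zero ?_
  rintro ⟨n, m, us⟩ ⟨⟨r, hr, σ, hg, -, wt, lev, ts, hh, h1, h2, h3⟩, rfl⟩
  refine absurd ?_ hl
  have hsub : ∀ r ∈ T.prog H, r ∈ T.prog T.S := fun r hr => hr.imp id fun h => hH h
  refine ⟨r, hsub r hr, σ, fun v hv s hs => ?_, wt, lev, ts, hh, h2⟩
  obtain ⟨r', hr', hs⟩ := hg v hv s hs
  exact ⟨r', hsub r' hr', hs⟩

theorem finite_levelSum_lt {Q : Program (objSig K P) V} (hQ : Q.Finite) (I J : Set (OAtom K P)) :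
    {l | levelSum Q l I < levelSum Q l J}.Finite := by
  refine (((weakTuples_finite hQ I).union (weakTuples_finite hQ J)).image
    fun q => q.2.1).subset ?_
  intro l hl
  by_contra hcon
  have h0 : ∀ I', weakTuples Q I' ⊆ weakTuples Q I ∪ weakTuples Q J → levelSum Q l I' = 0 := by
    intro I' hI'
    refine finsum_mem_eq_zero_of_forall_eq_zero ?_
    rintro q ⟨hq, hql⟩
    exact absurd ⟨q, hI' hq, hql⟩ hcon
  have hl : levelSum Q l I < levelSum Q l J := hl
  rw [h0 I Set.subset_union_left, h0 J Set.subset_union_right] at hl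
  exact lt_irrefl _ hl

/-- The encoding asks only that `J` be nowhere better above `l`, while domination asks for equality
there. The two agree once `l` is replaced by the highest level at which `I` is better. -/
theorem dominates_iff {H : Finset (ORule K P V)} (hH : H ⊆ T.S) (I J : Set (OAtom K P)) :
    Dominates (T.prog H) I J ↔
      ∃ l ∈ T.levels, levelSum (T.prog H) l I < levelSum (T.prog H) l J ∧
        ∀ m ∈ T.levels, l < m → ¬ levelSum (T.prog H) m J < levelSum (T.prog H) m I := by
  constructor
  · rintro ⟨l, hl, hm⟩
    refine ⟨l, ?_, hl, fun m _ hlm => by rw [hm m hlm]; exact lt_irrefl _⟩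
    by_contra hcon
    rw [levelSum_eq_zero hH hcon, levelSum_eq_zero hH hcon] at hl
    exact lt_irrefl _ hl
  · rintro ⟨l, -, hl, hm⟩
    -- Finitely many levels have `I` strictly better, so there is a highest one, `k ≥ l`. Above it
    -- neither side is strictly better.
    obtain ⟨k, hk, hmax⟩ := (finite_levelSum_lt (T.prog_finite H) I J).exists_maximal ⟨l, hl⟩
    refine ⟨k, hk, fun m hkm => ?_⟩
    have hlk : l ≤ k := by
      by_contra hlt
      exact hlt (hmax (y := l) hl (le_of_not_ge hlt))
    by_cases hml : m ∈ T.levels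
    · refine le_antisymm (not_lt.1 (hm m hml (hlk.trans_lt hkm))) (not_lt.1 fun hlt => ?_)
      exact absurd (hmax (y := m) hlt hkm.le) (not_le.2 hkm)
    · rw [levelSum_eq_zero hH hml, levelSum_eq_zero hH hml]

/-- The `#sum` aggregate of `dominates(c, d)` is the difference of the sums of weights. -/
theorem Coherent.sum_eq (hA : Coherent T VR A) {c d : MConst K P V} {I J : Set (OAtom K P)}
    (hc : Named T VR A c I) (hd : Named T VR A d J)
    (hI : I ∈ answerSets (T.prog (decodeHyp T A))) (hJ : J ∈ answerSets (T.prog (decodeHyp T A)))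
    {G : List (MVar V)} (hL : .L ∈ G) (hW : .W ∉ G) (hAr : .A ∉ G)
    {σ : MVar V → GTerm (metaSig K P V)} {l : ℤ} (hσ : σ .L = .int l) :
    ∑ᶠ p ∈ sumInstances G σ
      [⟨mat .w [.var .W, .var .L, .var .A, .sym c], 1, .var .W⟩,
       ⟨mat .w [.var .W, .var .L, .var .A, .sym d], -1, .var .W⟩] A, p.2 =
    levelSum (T.prog (decodeHyp T A)) l I - levelSum (T.prog (decodeHyp T A)) l J := by
  set Q := T.prog (decodeHyp T A) with hQ
  -- `f c s` sends a weak constraint tuple to the aggregate instance it produces, where `s` is the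
  -- coefficient 1 or -1. On a fixed level it is injective, since the atom contains weight and
  -- terms.
  let f : MConst K P V → ℤ → ℤ × ℤ × List (GTerm (objSig K P)) → GAtom (metaSig K P V) × ℤ :=
    fun c s q => (⟨.w, [.int q.1, .int l, .fn .args (q.2.2.map qTerm), .sym c]⟩, s * q.1)
  let S : Set (OAtom K P) → Set (ℤ × ℤ × List (GTerm (objSig K P))) :=
    fun I => {q ∈ weakTuples Q I | q.2.1 = l}
  have hfin : ∀ I, (S I).Finite := fun I => (weakTuples_finite (T.prog_finite _) I).subset
    fun q hq => hq.1
  have hinj : ∀ c s I, Set.InjOn (f c s) (S I) := by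
    rintro c s I ⟨n, m, us⟩ ⟨_, h⟩ ⟨n', m', us'⟩ ⟨_, h'⟩ heq
    simp only at h h'
    subst h h'
    simp only [f, Prod.mk.injEq, Atom.mk.injEq, List.cons.injEq, Term.int.injEq, Term.fn.injEq,
      true_and] at heq
    obtain ⟨⟨rfl, hu, -⟩, -⟩ := heq
    rw [(List.map_injective_iff.2 qTerm_injective) hu]
  have hmem : ∀ c s I, Named T VR A c I → I ∈ answerSets Q → ∀ p : GAtom (metaSig K P V) × ℤ,
      (p.1 ∈ A ∧ ∃ τ : MVar V → GTerm (metaSig K P V), (∀ v ∈ G, τ v = σ v) ∧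
        p.1 = (mat .w [.var .W, .var .L, .var .A, .sym c] : MAtom K P V).subst τ ∧
        ∃ n : ℤ, (Term.var .W : MTerm K P V).subst τ = .int n ∧ p.2 = s * n) ↔
      p ∈ f c s '' S I := by
    rintro c s I hc hI ⟨a, k⟩
    constructor
    · rintro ⟨ha, τ, hτ, rfl, n, hn, rfl⟩
      simp only [mat, Atom.subst, List.map_cons, List.map_nil, Term.subst] at ha hn
      obtain ⟨c', I', hc', t, ht, heq⟩ := (hA.w_iff _).1 ha
      simp only [List.cons.injEq, Term.sym.injEq, and_true] at heq
      obtain ⟨h1, h2, h3, rfl⟩ := heq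
      obtain rfl := hc.unique hc'
      rw [hτ _ hL, hσ] at h2
      rw [hn] at h1
      have e1 := qTerm_eq_int.1 h1.symm
      have e2 := qTerm_eq_int.1 h2.symm
      obtain ⟨t1, t2, t3⟩ := t
      simp only at e1 e2 h3
      subst e1 e2
      refine ⟨(n, l, t3), ⟨(mem_weakTuples_iff (T.prog_wf decodeHyp_subset) hI.1).2 ht, rfl⟩, ?_⟩
      simp only [f, mat, Atom.subst, List.map_cons, List.map_nil, Term.subst, hn, hτ _ hL, hσ, h3]
    · rintro ⟨⟨n, m, us⟩, ⟨hq, hm⟩, heq⟩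
      simp only at hm
      subst hm
      simp only [f, Prod.mk.injEq] at heq
      obtain ⟨rfl, rfl⟩ := heq
      classical
      -- The variables `W` and `A` are local to the aggregate, so they can be reset to the weight
      -- and to the quoted terms.
      refine ⟨(hA.w_iff _).2 ⟨c, I, hc, _,
          (mem_weakTuples_iff (T.prog_wf decodeHyp_subset) hI.1).1 hq, rfl⟩,
        Function.update (Function.update σ .W (.int n)) .A (.fn .args (us.map qTerm)), ?_, ?_,
        n, ?_, rfl⟩
      · intro v hv
        rw [Function.update_of_ne (ne_of_mem_of_not_mem hv hAr),
          Function.update_of_ne (ne_of_mem_of_not_mem hv hW)]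
      · simp [mat, Atom.subst, Term.subst, hσ, Function.update]
      · simp [Term.subst, Function.update]
  have hset : sumInstances G σ
      [⟨mat .w [.var .W, .var .L, .var .A, .sym c], 1, .var .W⟩,
       ⟨mat .w [.var .W, .var .L, .var .A, .sym d], -1, .var .W⟩] A =
      f c 1 '' S I ∪ f d (-1) '' S J := by
    ext p
    rw [Set.mem_union, ← hmem c 1 I hc hI, ← hmem d (-1) J hd hJ]
    constructor
    · rintro ⟨hp, e, he, τ, h⟩
      simp only [List.mem_cons, List.not_mem_nil, or_false] at he
      rcases he with rfl | rfl
      · exact .inl ⟨hp, τ, h⟩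
      · exact .inr ⟨hp, τ, h⟩
    · rintro (⟨hp, τ, h⟩ | ⟨hp, τ, h⟩)
      · exact ⟨hp, _, List.mem_cons_self, τ, h⟩
      · exact ⟨hp, _, List.mem_cons_of_mem _ List.mem_cons_self, τ, h⟩
  -- The two families may overlap when `c = d`, as for an ordering of an example with itself. A
  -- common element has equal weights `n` and `-n`, so it contributes nothing.
  have hinter : ∑ᶠ p ∈ f c 1 '' S I ∩ f d (-1) '' S J, p.2 = 0 := by
    refine finsum_mem_eq_zero_of_forall_eq_zero ?_
    rintro _ ⟨⟨q, -, rfl⟩, ⟨q', -, heq⟩⟩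
    simp only [f, Prod.mk.injEq, Atom.mk.injEq, List.cons.injEq, Term.int.injEq, true_and] at heq ⊢
    have := heq.1.1
    have := heq.2
    omega
  have hsum : ∀ c s I, ∑ᶠ p ∈ f c s '' S I, p.2 = s * levelSum Q l I := by
    intro c s I
    rw [finsum_mem_image (hinj c s I), levelSum]
    exact (mul_finsum_mem _ _).symm
  rw [hset, ← add_zero (finsum _), ← hinter, finsum_mem_union_inter ((hfin I).image _)
    ((hfin J).image _), hsum, hsum]
  ring

variable {c d : MConst K P V} {I J : Set (OAtom K P)}

/-- The level argument is an arbitrary term `x`, because the rule for `dom` does not itself restrict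
`L`; the atom `lv(L)` in the body forces a level of the task. -/
theorem Coherent.dom_lv_iff (hA : Coherent T VR A) (hcd : DomPair T VR c d)
    (hc : Named T VR A c I) (hd : Named T VR A d J)
    (hI : I ∈ answerSets (T.prog (decodeHyp T A))) (hJ : J ∈ answerSets (T.prog (decodeHyp T A)))
    (x : GTerm (metaSig K P V)) :
    ⟨.dom_lv, [.sym c, .sym d, x]⟩ ∈ A ↔ ∃ l ∈ T.levels, x = .int l ∧
      levelSum (T.prog (decodeHyp T A)) l I < levelSum (T.prog (decodeHyp T A)) l J := by
  constructor
  · intro h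
    obtain ⟨r, σ, h, hr, hh, hs, hb⟩ := support hA.stable (by decide) h
    cases hr with
    | dom_lv h =>
      obtain rfl := Head.atom.inj hh
      simp only [mat, Atom.subst, List.map_cons, List.map_nil, Term.subst, Atom.mk.injEq, true_and,
        List.cons.injEq, Term.sym.injEq, and_true] at hs
      obtain ⟨rfl, rfl, rfl⟩ := hs
      have hlv := hb.1 _ (List.mem_singleton_self _)
      simp only [mat, Atom.subst, List.map_cons, List.map_nil, Term.subst] at hlv
      obtain ⟨l, hl, hx⟩ := (lv_iff hA.stable _).1 hlv
      simp only [List.cons.injEq, and_true] at hx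
      have hsum := hb.2.2 _ (List.mem_singleton_self _)
      simp only [sumBelow, Builtin.Holds] at hsum
      rw [hA.sum_eq hc hd hI hJ (by simp [Rule.vars, Head.vars, mat, Atom.vars, Term.vars])
        (by simp [Rule.vars, Head.vars, mat, Atom.vars, Term.vars, Builtin.globalVars])
        (by simp [Rule.vars, Head.vars, mat, Atom.vars, Term.vars, Builtin.globalVars]) hx] at hsum
      exact ⟨l, hl, hx, by omega⟩
  · rintro ⟨l, hl, rfl, hlt⟩
    have := derive_of_safe (σ := fun _ => .int l) hA.stable (MetaRule.dom_lv hcd) (by decide) rfl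
      (by simp [Rule.IsSafe, Rule.vars, Head.vars, mat, Atom.vars, Term.vars, Builtin.globalVars,
        sumBelow])
      ⟨by simpa [mat, Atom.subst, Term.subst] using (lv_iff hA.stable _).2 ⟨l, hl, rfl⟩, by simp,
       by
        intro b hb
        obtain rfl := List.mem_singleton.1 hb
        simp only [sumBelow, Builtin.Holds]
        rw [hA.sum_eq hc hd hI hJ (by simp [Rule.vars, Head.vars, mat, Atom.vars, Term.vars])
          (by simp [Rule.vars, Head.vars, mat, Atom.vars, Term.vars, Builtin.globalVars])
          (by simp [Rule.vars, Head.vars, mat, Atom.vars, Term.vars, Builtin.globalVars]) rfl]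
        omega⟩
    simpa [mat, Atom.subst, Term.subst] using this

theorem Coherent.non_dom_lv_iff (hA : Coherent T VR A) (hcd : DomPair T VR c d)
    (hc : Named T VR A c I) (hd : Named T VR A d J)
    (hI : I ∈ answerSets (T.prog (decodeHyp T A))) (hJ : J ∈ answerSets (T.prog (decodeHyp T A)))
    (x : GTerm (metaSig K P V)) :
    ⟨.non_dom_lv, [.sym c, .sym d, x]⟩ ∈ A ↔ ∃ l ∈ T.levels, x = .int l ∧
      levelSum (T.prog (decodeHyp T A)) l J < levelSum (T.prog (decodeHyp T A)) l I := by
  constructor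
  · intro h
    obtain ⟨r, σ, h, hr, hh, hs, hb⟩ := support hA.stable (by decide) h
    cases hr with
    | non_dom_lv h =>
      obtain rfl := Head.atom.inj hh
      simp only [mat, Atom.subst, List.map_cons, List.map_nil, Term.subst, Atom.mk.injEq, true_and,
        List.cons.injEq, Term.sym.injEq, and_true] at hs
      obtain ⟨rfl, rfl, rfl⟩ := hs
      have hlv := hb.1 _ (List.mem_singleton_self _)
      simp only [mat, Atom.subst, List.map_cons, List.map_nil, Term.subst] at hlv
      obtain ⟨l, hl, hx⟩ := (lv_iff hA.stable _).1 hlv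
      simp only [List.cons.injEq, and_true] at hx
      have hsum := hb.2.2 _ (List.mem_singleton_self _)
      simp only [sumBelow, Builtin.Holds] at hsum
      rw [hA.sum_eq hd hc hJ hI (by simp [Rule.vars, Head.vars, mat, Atom.vars, Term.vars])
        (by simp [Rule.vars, Head.vars, mat, Atom.vars, Term.vars, Builtin.globalVars])
        (by simp [Rule.vars, Head.vars, mat, Atom.vars, Term.vars, Builtin.globalVars]) hx] at hsum
      exact ⟨l, hl, hx, by omega⟩
  · rintro ⟨l, hl, rfl, hlt⟩
    have := derive_of_safe (σ := fun _ => .int l) hA.stable (MetaRule.non_dom_lv hcd) (by decide)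
      rfl
      (by simp [Rule.IsSafe, Rule.vars, Head.vars, mat, Atom.vars, Term.vars, Builtin.globalVars,
        sumBelow])
      ⟨by simpa [mat, Atom.subst, Term.subst] using (lv_iff hA.stable _).2 ⟨l, hl, rfl⟩, by simp,
       by
        intro b hb
        obtain rfl := List.mem_singleton.1 hb
        simp only [sumBelow, Builtin.Holds]
        rw [hA.sum_eq hd hc hJ hI (by simp [Rule.vars, Head.vars, mat, Atom.vars, Term.vars])
          (by simp [Rule.vars, Head.vars, mat, Atom.vars, Term.vars, Builtin.globalVars])
          (by simp [Rule.vars, Head.vars, mat, Atom.vars, Term.vars, Builtin.globalVars]) rfl]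
        omega⟩
    simpa [mat, Atom.subst, Term.subst] using this

theorem Coherent.non_bef_iff (hA : Coherent T VR A) (hcd : DomPair T VR c d)
    (hc : Named T VR A c I) (hd : Named T VR A d J)
    (hI : I ∈ answerSets (T.prog (decodeHyp T A))) (hJ : J ∈ answerSets (T.prog (decodeHyp T A)))
    {l : ℤ} (hl : l ∈ T.levels) :
    ⟨.non_bef, [.sym c, .sym d, .int l]⟩ ∈ A ↔ ∃ m ∈ T.levels, l < m ∧
      levelSum (T.prog (decodeHyp T A)) m J < levelSum (T.prog (decodeHyp T A)) m I := by
  constructor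
  · intro h
    obtain ⟨r, σ, h, hr, hh, hs, hb⟩ := support hA.stable (by decide) h
    cases hr with
    | non_bef h =>
      obtain rfl := Head.atom.inj hh
      simp only [mat, Atom.subst, List.map_cons, List.map_nil, Term.subst, Atom.mk.injEq, true_and,
        List.cons.injEq, Term.sym.injEq, and_true] at hs
      obtain ⟨rfl, rfl, hx⟩ := hs
      have hnd := hb.1 _ (List.mem_cons_of_mem _ (List.mem_cons_of_mem _
        (List.mem_singleton_self _)))
      simp only [mat, Atom.subst, List.map_cons, List.map_nil, Term.subst] at hnd
      obtain ⟨m, hm, hx2, hlt⟩ := (hA.non_dom_lv_iff hcd hc hd hI hJ _).1 hnd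
      obtain ⟨l', m', h1, h2, hlm⟩ := hb.2.2 _ (List.mem_singleton_self _)
      simp only [Term.subst, hx, hx2, Term.int.injEq] at h1 h2
      subst h1 h2
      exact ⟨m, hm, hlm, hlt⟩
  · rintro ⟨m, hm, hlm, hlt⟩
    have := derive_of_safe
      (σ := fun v => match v with | .L => .int l | _ => .int m) hA.stable
      (MetaRule.non_bef hcd) (by decide) rfl
      (by
        simp [Rule.IsSafe, Rule.vars, Head.vars, mat, Atom.vars, Term.vars, Builtin.globalVars])
      ⟨by
        simp only [List.forall_mem_cons, List.not_mem_nil, false_imp_iff, implies_true, and_true,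
          mat, Atom.subst, Term.subst, List.map_cons, List.map_nil]
        exact ⟨(lv_iff hA.stable _).2 ⟨l, hl, rfl⟩, (lv_iff hA.stable _).2 ⟨m, hm, rfl⟩,
          (hA.non_dom_lv_iff hcd hc hd hI hJ _).2 ⟨m, hm, rfl, hlt⟩⟩, by simp,
       by simp [Builtin.Holds, Term.subst, hlm]⟩
    simpa [mat, Atom.subst, Term.subst] using this

theorem Coherent.dom_iff (hA : Coherent T VR A) (hcd : DomPair T VR c d)
    (hc : Named T VR A c I) (hd : Named T VR A d J)
    (hI : I ∈ answerSets (T.prog (decodeHyp T A))) (hJ : J ∈ answerSets (T.prog (decodeHyp T A))) :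
    ⟨.dom, [.sym c, .sym d]⟩ ∈ A ↔ Dominates (T.prog (decodeHyp T A)) I J := by
  rw [dominates_iff decodeHyp_subset]
  constructor
  · intro h
    obtain ⟨r, σ, h, hr, hh, hs, hb⟩ := support hA.stable (by decide) h
    cases hr with
    | dom h =>
      obtain rfl := Head.atom.inj hh
      simp only [mat, Atom.subst, List.map_cons, List.map_nil, Term.subst, Atom.mk.injEq, true_and,
        List.cons.injEq, Term.sym.injEq, and_true] at hs
      obtain ⟨rfl, rfl⟩ := hs
      have h1 := hb.1 _ (List.mem_singleton_self _)
      have h2 := hb.2.1 _ (List.mem_singleton_self _)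
      simp only [mat, Atom.subst, List.map_cons, List.map_nil, Term.subst] at h1 h2
      obtain ⟨l, hl, hx, hlt⟩ := (hA.dom_lv_iff hcd hc hd hI hJ _).1 h1
      rw [hx, hA.non_bef_iff hcd hc hd hI hJ hl] at h2
      exact ⟨l, hl, hlt, fun m hm hlm hlt => h2 ⟨m, hm, hlm, hlt⟩⟩
  · rintro ⟨l, hl, hlt, hm⟩
    have := derive_of_safe (σ := fun _ => .int l) hA.stable (MetaRule.dom hcd) (by decide) rfl
      (by simp [Rule.IsSafe, Rule.vars, Head.vars, mat, Atom.vars, Term.vars])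
      ⟨by simpa [mat, Atom.subst, Term.subst] using
          (hA.dom_lv_iff hcd hc hd hI hJ _).2 ⟨l, hl, rfl, hlt⟩,
       by
        simp only [List.forall_mem_singleton, mat, Atom.subst, Term.subst, List.map_cons,
          List.map_nil]
        rw [hA.non_bef_iff hcd hc hd hI hJ hl]
        rintro ⟨m, hm1, hm2, hm3⟩
        exact hm m hm1 hm2 hm3, by simp⟩
    simpa [mat, Atom.subst, Term.subst] using this

end Comparison

/-! ### The atoms `cov`, `v_i`, `v_p` and `violating` -/

section Extension

variable {K : Type u} {P : Type v} {V : Type w} {T : Task K P V} {VR : Set (Reason K P)}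
  {A : Set (GAtom (metaSig K P V))}

theorem bodyHolds_extendsRule (h : MAtom K P V) (e : PartialInterp K P) (c : MConst K P V)
    (σ : MVar V → GTerm (metaSig K P V)) :
    (extendsRule h e (.sym c)).BodyHolds σ A ↔ Extends (proj .in_as A (.sym c)) e := by
  simp [extendsRule, Rule.BodyHolds, Extends, proj, mat, Atom.subst, Term.subst]

theorem extendsRule_safe {h : MAtom K P V} (hh : h.vars = []) (e : PartialInterp K P)
    (c : MConst K P V) : (extendsRule h e (.sym c)).IsSafe := by
  intro v hv
  have : ∀ a : OAtom K P, (mat .in_as [quoteGAtom a, .sym c] : MAtom K P V).vars = [] := by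
    intro a
    simp [mat, Atom.vars, Term.vars, vars_quoteGAtom]
  simp [extendsRule, Rule.vars, Head.vars, hh, List.flatMap_map, this] at hv

theorem cov_iff (hA : StableAbove (fullMeta T VR) rank A) (c : MConst K P V) :
    ⟨.cov, [.sym c]⟩ ∈ A ↔ ∃ e, CoverId T e c ∧ Extends (proj .in_as A (.sym c)) e := by
  constructor
  · intro h
    obtain ⟨r, σ, h, hr, hh, hs, hb⟩ := support hA (by decide) h
    cases hr with
    | @cov e c' hc =>
      obtain rfl := Head.atom.inj hh
      simp only [mat, Atom.subst, List.map_cons, List.map_nil, Term.subst, Atom.mk.injEq, true_and,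
        List.cons.injEq, Term.sym.injEq, and_true] at hs
      subst hs
      exact ⟨e, hc, (bodyHolds_extendsRule _ _ _ _).1 hb⟩
  · rintro ⟨e, hc, he⟩
    have := derive_of_safe (σ := fun _ => .int 0) hA (MetaRule.cov hc) (by decide) rfl
      (extendsRule_safe (by simp [mat, Atom.vars, Term.vars]) _ _)
      ((bodyHolds_extendsRule _ _ _ _).2 he)
    simpa [mat, Atom.subst, Term.subst] using this

theorem v_i_iff (hA : StableAbove (fullMeta T VR) rank A) :
    ⟨.v_i, []⟩ ∈ A ↔ ∃ e ∈ T.Eneg, Extends (proj .in_as A (.sym .n)) e := by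
  constructor
  · intro h
    obtain ⟨r, σ, h, hr, hh, hs, hb⟩ := support hA (by decide) h
    cases hr with
    | violInterp he => exact ⟨_, he, (bodyHolds_extendsRule _ _ _ _).1 hb⟩
  · rintro ⟨e, he, hext⟩
    have := derive_of_safe (σ := fun _ => .int 0) hA (MetaRule.violInterp he) (by decide) rfl
      (extendsRule_safe (by simp [mat, Atom.vars]) _ _)
      ((bodyHolds_extendsRule _ _ _ _).2 hext)
    simpa [mat, Atom.subst, Term.subst] using this

theorem v_p_pair_iff (hA : StableAbove (fullMeta T VR) rank A) (s t : GTerm (metaSig K P V)) :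
    ⟨.v_p, [s, t]⟩ ∈ A ↔ ∃ o ∈ T.Oc, s = .sym (.exId o.1) ∧ t = .sym (.exId o.2) ∧
      ⟨.dom, [.sym (.exId o.1), .sym (.exId o.2)]⟩ ∉ A := by
  constructor
  · intro h
    obtain ⟨r, σ, h, hr, hh, hs, hb⟩ := support hA (by decide) h
    cases hr with
    | @violPair o ho =>
      obtain rfl := Head.atom.inj hh
      simp only [mat, Atom.subst, List.map_cons, List.map_nil, Term.subst, Atom.mk.injEq, true_and,
        List.cons.injEq, and_true] at hs
      refine ⟨o, ho, hs.1.symm, hs.2.symm, ?_⟩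
      have := hb.2.1 _ (List.mem_singleton_self _)
      simpa [mat, Atom.subst, Term.subst] using this
    | somePair =>
      obtain rfl := Head.atom.inj hh
      simp [mat, Atom.subst] at hs
  · rintro ⟨o, ho, rfl, rfl, hn⟩
    have := derive_of_safe (σ := fun _ => .int 0) hA (MetaRule.violPair ho) (by decide) rfl
      (by simp [Rule.IsSafe, Rule.vars, Head.vars, mat, Atom.vars, Term.vars])
      ⟨by simp, by simpa [mat, Atom.subst, Term.subst] using hn, by simp⟩
    simpa [mat, Atom.subst, Term.subst] using this

theorem v_p_iff (hA : StableAbove (fullMeta T VR) rank A) :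
    ⟨.v_p, []⟩ ∈ A ↔ ∃ o ∈ T.Oc, ⟨.dom, [.sym (.exId o.1), .sym (.exId o.2)]⟩ ∉ A := by
  constructor
  · intro h
    obtain ⟨r, σ, h, hr, hh, hs, hb⟩ := support hA (by decide) h
    cases hr with
    | violPair ho =>
      obtain rfl := Head.atom.inj hh
      simp [mat, Atom.subst] at hs
    | somePair =>
      have := hb.1 _ (List.mem_singleton_self _)
      simp only [mat, Atom.subst, List.map_cons, List.map_nil, Term.subst] at this
      obtain ⟨o, ho, -, -, h⟩ := (v_p_pair_iff hA _ _).1 this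
      exact ⟨o, ho, h⟩
  · rintro ⟨o, ho, hn⟩
    have := derive_of_safe
      (σ := fun v => match v with | .T1 => .sym (.exId o.1) | _ => .sym (.exId o.2)) hA
      MetaRule.somePair (by decide) rfl
      (by simp [Rule.IsSafe, Rule.vars, Head.vars, mat, Atom.vars, Term.vars])
      ⟨by simpa [mat, Atom.subst, Term.subst] using
        (v_p_pair_iff hA _ _).2 ⟨o, ho, rfl, rfl, hn⟩, by simp, by simp⟩
    simpa [mat, Atom.subst, Term.subst] using this

theorem violating_iff_dom (hA : StableAbove (fullMeta T VR) rank A) :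
    violatingAtom ∈ A ↔ (∃ e ∈ T.Eneg, Extends (proj .in_as A (.sym .n)) e) ∨
      ∃ o ∈ T.Oc, ⟨.dom, [.sym (.exId o.1), .sym (.exId o.2)]⟩ ∉ A := by
  rw [← v_i_iff hA, ← v_p_iff hA]
  constructor
  · intro h
    obtain ⟨r, σ, h, hr, hh, hs, hb⟩ := support hA (by decide) h
    cases hr with
    | violating_of_interp => exact .inl (hb.1 _ (List.mem_singleton_self _))
    | violating_of_pair => exact .inr (hb.1 _ (List.mem_singleton_self _))
  · rintro (h | h)
    · exact derive_of_safe (σ := fun _ => .int 0) hA MetaRule.violating_of_interp (by decide) rfl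
        (by simp [Rule.IsSafe, Rule.vars, Head.vars, mat, Atom.vars])
        ⟨by simpa [mat, Atom.subst] using h, by simp, by simp⟩
    · exact derive_of_safe (σ := fun _ => .int 0) hA MetaRule.violating_of_pair (by decide) rfl
        (by simp [Rule.IsSafe, Rule.vars, Head.vars, mat, Atom.vars])
        ⟨by simpa [mat, Atom.subst] using h, by simp, by simp⟩

/-- The meaning of the atom `violating`. -/
theorem Coherent.violating_iff (hA : Coherent T VR A) :
    violatingAtom ∈ A ↔ (∃ e ∈ T.Eneg, Extends (proj .in_as A (.sym .n)) e) ∨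
      ∃ o ∈ T.Oc, ¬ Dominates (T.prog (decodeHyp T A)) (proj .in_as A (.sym (.exId o.1)))
        (proj .in_as A (.sym (.exId o.2))) := by
  rw [violating_iff_dom hA.stable]
  refine or_congr_right (exists_congr fun o => and_congr_right fun ho => not_congr ?_)
  have h1 : AsId T (.exId o.1) := .ex (T.Oc_pos o ho).1
  have h2 : AsId T (.exId o.2) := .ex (T.Oc_pos o ho).2
  exact hA.dom_iff (.oc ho) (.inl ⟨h1, rfl⟩) (.inl ⟨h2, rfl⟩) (hA.answer _ h1) (hA.answer _ h2)

end Extension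

end LOAS

namespace LOAS

open ASP

universe u v w

/-! ### The atoms `mmr` and `nas` decide whether a stored interpretation is an answer set -/

section Stability

variable {K : Type u} {P : Type v} {V : Type w} {T : Task K P V} {VR : Set (Reason K P)}
  {A : Set (GAtom (metaSig K P V))} {c : MConst K P V} {I : Set (OAtom K P)}

theorem vars_subset {r : ORule K P V} {w : V}
    (h : w ∈ r.head.vars ∨ w ∈ r.pos.flatMap Atom.vars ∨ w ∈ r.neg.flatMap Atom.vars) :
    w ∈ r.vars := by
  simp only [Rule.vars, List.mem_append]
  tauto

/-- Common to all rules produced by `reductify`: once the body literals of `r` hold for `c`, only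
the extra atoms and the cardinality bounds that distinguish these rules remain to be checked. -/
theorem mmr_derive (hA : StableAbove (fullMeta T VR) rank A) (hc : VsId VR c I)
    {r : ORule K P V} {d : List (MAtom K P V)} (hs : Src T r d) (hdv : ∀ b ∈ d, b.vars = [])
    (hd : ∀ σ : MVar V → GTerm (metaSig K P V), ∀ b ∈ d, b.subst σ ∈ A)
    {h : MTerm K P V} {extra : List (MAtom K P V)} {bs : List (Builtin (metaSig K P V) (MVar V))}
    (hr : MetaRule T VR (some .mmr) (addPos (mmrRule h r extra bs) d))
    {σ : V → GTerm (objSig K P)}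
    (hv : ∀ v, v ∈ h.vars ∨ v ∈ extra.flatMap Atom.vars ∨ v ∈ bs.flatMap Builtin.globalVars →
      (∃ w ∈ r.vars, v = .obj w) ∨ v = .X)
    (hn : ∀ b ∈ r.neg, b.subst σ ∉ I) (hp : ∀ b ∈ r.pos, b.subst σ ∈ proj .mmr A (.sym c))
    (he : ∀ b ∈ extra, b.subst (liftSubst σ (.sym c)) ∈ A)
    (hbs : ∀ G, ∀ b ∈ bs, b.Holds G (liftSubst σ (.sym c)) A) :
    ⟨.mmr, [h.subst (liftSubst σ (.sym c)), .sym c]⟩ ∈ A := by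
  have hq := quotes_liftSubst r σ (.sym c)
  have hpos : ∀ b ∈ r.pos, (reifyAtom .mmr varX b).subst (liftSubst σ (.sym c)) ∈ A := by
    intro b hb
    rw [hq.pos hb]
    exact hp b hb
  -- The `⊥` rules for choice heads have no `vs(X)` in the body, and with an empty positive body `X`
  -- is not bound at all. Grounding is therefore checked by hand: `c` occurs in the fact `vs(c)`.
  have hX : (liftSubst σ (.sym c)) .X ∈ herbrandUniverse (fullMeta T VR) := by
    have h1 : (mat .vs [varX] : MAtom K P V).subst (liftSubst σ (.sym c)) ∈
        herbrandBase (fullMeta T VR) := hA.subset_base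
          ((vs_iff hA _).2 ⟨c, I, hc, by simp [mat, varX, Term.subst, liftSubst]⟩)
    exact mem_herbrandUniverse_of_atom h1 (by simp [mat, varX, Atom.vars, Term.vars])
  have hg : Grounds (fullMeta T VR) (addPos (mmrRule h r extra bs) d) (liftSubst σ (.sym c)) := by
    intro v hv'
    have : (∃ w ∈ r.vars, v = .obj w) ∨ v = .X := by
      have hdv' : v ∉ d.flatMap Atom.vars := by
        simp only [List.mem_flatMap, not_exists, not_and]
        intro b hb
        simp [hdv b hb]
      simp only [Rule.vars, addPos, mmrRule, Head.vars, mat, Atom.vars, List.flatMap_cons,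
        List.flatMap_nil, List.flatMap_append, List.mem_append, varX, Term.vars,
        List.mem_singleton, List.not_mem_nil, or_false] at hv'
      rcases hv' with (((hv' | hv') | (hv' | hv') | hv') | hv') | hv'
      · exact hv v (.inl hv')
      · exact .inr hv'
      · exact (mem_vars_map_reifyAtom hv').imp
          (fun ⟨w, hw, h⟩ => ⟨w, vars_subset (.inr (.inl hw)), h⟩) id
      · exact hv v (.inr (.inl hv'))
      · exact absurd hv' hdv'
      · exact (mem_vars_map_reifyAtom hv').imp
          (fun ⟨w, hw, h⟩ => ⟨w, vars_subset (.inr (.inr hw)), h⟩) id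
      · exact hv v (.inr (.inr hv'))
    rcases this with ⟨w, hw, rfl⟩ | rfl
    · obtain ⟨b, hb, hwb⟩ := hs.safe w hw
      exact mem_herbrandUniverse_of_atom (hA.subset_base (hpos b hb)) (obj_mem_vars_reifyAtom hwb)
    · exact hX
  have := derive hA hr (by decide) rfl hg ⟨?_, ?_, ?_⟩
  · simpa [mat, Atom.subst, varX, Term.subst, liftSubst] using this
  · intro b hb
    simp only [addPos, mmrRule, List.mem_append, List.mem_map] at hb
    rcases hb with (⟨b, hb, rfl⟩ | hb) | hb
    · exact hpos b hb
    · exact he b hb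
    · exact hd _ b hb
  · intro b hb
    simp only [addPos, mmrRule, List.mem_map] at hb
    obtain ⟨b, hb, rfl⟩ := hb
    rw [hq.neg hb]
    intro hbA
    refine hn b hb ?_
    rw [← hc.proj_eq hA]
    exact hbA
  · exact hbs _

/-- The atoms `mmr(a, c)` are closed under the reduct. -/
theorem mmr_closed (hA : StableAbove (fullMeta T VR) rank A) (hc : VsId VR c I)
    {r : ORule K P V} (hr : r ∈ T.prog (decodeHyp T A)) {σ : V → GTerm (objSig K P)}
    (hn : ∀ b ∈ r.neg, b.subst σ ∉ I) (hp : ∀ b ∈ r.pos, b.subst σ ∈ proj .mmr A (.sym c)) :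
    r.head.ReductHolds σ I (proj .mmr A (.sym c)) ∨ ⟨.mmr, [.sym .bot, .sym c]⟩ ∈ A := by
  obtain ⟨d, hs, hdv, hd⟩ := exists_src hr
  have hq := quotes_liftSubst r σ (.sym c)
  have hvs : (⟨.vs, [.sym c]⟩ : GAtom (metaSig K P V)) ∈ A := (vs_iff hA _).2 ⟨c, I, hc, rfl⟩
  have hI : proj .in_vs A (liftSubst σ (.sym c) .X) = I := hc.proj_eq hA
  cases hh : r.head with
  | atom h =>
    left
    have := mmr_derive (σ := σ) hA hc hs hdv hd (.mmrNormal hs hh) ?_ hn hp ?_ (by simp)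
    · rw [hq.quoteHead (a := h) (by rw [hh]; rfl)] at this
      exact this
    · intro v hv
      simp only [List.flatMap_cons, List.flatMap_nil, List.append_nil, mat, Atom.vars, varX,
        Term.vars, List.mem_singleton, List.not_mem_nil, or_false] at hv
      rcases hv with hv | hv
      · obtain ⟨w, hw, rfl⟩ := mem_vars_quoteAtom hv
        exact .inl ⟨w, vars_subset (.inl (by rw [hh]; exact hw)), rfl⟩
      · exact .inr hv
    · simpa [mat, Atom.subst, varX, Term.subst, liftSubst] using hvs
  | bot =>
    right
    have := mmr_derive (σ := σ) hA hc hs hdv hd (.mmrHard hs hh) ?_ hn hp ?_ (by simp)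
    · simpa [Term.subst] using this
    · intro v hv
      simp only [List.flatMap_cons, List.flatMap_nil, List.append_nil, mat, Atom.vars, varX,
        Term.vars, List.mem_singleton, List.not_mem_nil, or_false, false_or] at hv
      exact .inr hv
    · simpa [mat, Atom.subst, varX, Term.subst, liftSubst] using hvs
  | weak wt lev ts => exact .inl trivial
  | choice l hs' u =>
    have hcount := countTrue_reify hq hh .in_vs A
    rw [hI] at hcount
    have hvars : ∀ v, v ∈ (hs'.map (reifyAtom .in_vs varX : _ → MAtom K P V)).flatMap Atom.vars →
        (∃ w ∈ r.vars, v = .obj w) ∨ v = .X := by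
      intro v hv
      exact (mem_vars_map_reifyAtom hv).imp
          (fun ⟨w, hw, h⟩ => ⟨w, vars_subset (.inl (by rw [hh]; exact hw)), h⟩) id
    by_cases hl : l ≤ countTrue σ hs' I
    · by_cases hu : countTrue σ hs' I ≤ u
      · left
        refine ⟨⟨hl, hu⟩, fun h hm hhI => ?_⟩
        have hoff : r.head.Offers h := by rw [hh]; exact hm
        have := mmr_derive (σ := σ) hA hc hs hdv hd (.mmrChoice hs hh hm) ?_ hn hp ?_ ?_
        · rw [hq.quoteHead hoff] at this
          exact this
        · intro v hv
          simp only [List.flatMap_cons, List.flatMap_nil, List.append_nil,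
            Builtin.globalVars] at hv
          rcases hv with hv | hv | hv
          · obtain ⟨w, hw, rfl⟩ := mem_vars_quoteAtom hv
            exact .inl ⟨w, vars_subset (.inl (hoff.mem_vars hw)), rfl⟩
          · exact (mem_vars_reifyAtom hv).imp
              (fun ⟨w, hw, h⟩ => ⟨w, vars_subset (.inl (hoff.mem_vars hw)), h⟩) id
          · exact hvars v hv
        · intro b hb
          obtain rfl := List.mem_singleton.1 hb
          rw [hq.head hoff]
          rw [← hI] at hhI
          exact hhI
        · intro G b hb
          obtain rfl := List.mem_singleton.1 hb
          simpa [Builtin.Holds, hcount] using ⟨hl, hu⟩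
      · right
        have := mmr_derive (σ := σ) hA hc hs hdv hd (.mmrAbove hs hh) ?_ hn hp (by simp) ?_
        · simpa [Term.subst] using this
        · intro v hv
          simp only [List.flatMap_cons, List.flatMap_nil, List.append_nil, Term.vars,
            Builtin.globalVars, List.not_mem_nil, false_or] at hv
          exact hvars v hv
        · intro G b hb
          obtain rfl := List.mem_singleton.1 hb
          simp only [Builtin.Holds, hcount, Option.mem_some_iff, forall_eq', Option.not_mem_none,
            false_imp_iff, implies_true, and_true]
          omega
    · right
      have := mmr_derive (σ := σ) hA hc hs hdv hd (.mmrBelow hs hh) ?_ hn hp (by simp) ?_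
      · simpa [Term.subst] using this
      · intro v hv
        simp only [List.flatMap_cons, List.flatMap_nil, List.append_nil, Term.vars,
          Builtin.globalVars, List.not_mem_nil, false_or] at hv
        exact hvars v hv
      · intro G b hb
        obtain rfl := List.mem_singleton.1 hb
        simp only [Builtin.Holds, hcount, Option.mem_some_iff, forall_eq', Option.not_mem_none,
          false_imp_iff, implies_true, true_and]
        omega

/-- By `h1` the true `mmr` atoms for `c` outside `D` quote atoms of `J`. A body that avoids `D` is
thus the quotation of a rule instance whose positive body holds in `J`. -/
theorem exists_quotes_of_mmr_body (hA : StableAbove (fullMeta T VR) rank A) (hc : VsId VR c I)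
    {D : Set (GAtom (metaSig K P V))} {J : Set (OAtom K P)}
    (h1 : ∀ x, ⟨.mmr, [x, .sym c]⟩ ∈ A → ⟨.mmr, [x, .sym c]⟩ ∉ D → ∃ a ∈ J, x = qAtom a)
    {r : ORule K P V} {d : List (MAtom K P V)} (hs : Src T r d)
    {h : MTerm K P V} {extra : List (MAtom K P V)} {bs : List (Builtin (metaSig K P V) (MVar V))}
    {σ' : MVar V → GTerm (metaSig K P V)} (hX : σ' .X = .sym c)
    (hb : (addPos (mmrRule h r extra bs) d).BodyHolds σ' A)
    (hp : ∀ b ∈ (addPos (mmrRule h r extra bs) d).pos, b.subst σ' ∉ D) :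
    ∃ σ, Quotes r σ σ' ∧ r ∈ T.prog (decodeHyp T A) ∧ (∀ b ∈ r.pos, b.subst σ ∈ J) ∧
      ∀ b ∈ r.neg, b.subst σ ∉ I := by
  have hpos : ∀ b ∈ r.pos, ∃ a ∈ J, (quoteAtom b).subst σ' = qAtom a := by
    intro b hbp
    have hmem : reifyAtom .mmr varX b ∈ (addPos (mmrRule h r extra bs) d).pos := by
      simp only [addPos, mmrRule, List.mem_append, List.mem_map]
      exact .inl (.inl ⟨b, hbp, rfl⟩)
    have e1 := hb.1 _ hmem
    have e2 := hp _ hmem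
    simp only [reifyAtom, mat, Atom.subst, List.map_cons, List.map_nil, varX, Term.subst,
      hX] at e1 e2
    exact h1 _ e1 e2
  obtain ⟨σ, hσ⟩ := exists_quotes hs.safe (fun b hb => (hpos b hb).imp fun _ h => h.2)
  refine ⟨σ, hσ, hs.mem_prog (σ := σ') fun b hbd => hb.1 b (by
    simp only [addPos, List.mem_append]; exact .inr hbd), fun b hbp => ?_, fun b hbn hbI => ?_⟩
  · obtain ⟨a, ha, hae⟩ := hpos b hbp
    have := hσ.pos hbp .mmr
    simp only [reifyAtom, mat, Atom.subst, List.map_cons, List.map_nil, hae, Atom.mk.injEq,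
      List.cons.injEq, qAtom_inj, true_and] at this
    have h2 : a = b.subst σ := this.1
    rwa [← h2]
  · refine hb.2.1 (reifyAtom .in_vs varX b) (List.mem_map_of_mem hbn) ?_
    rw [hσ.neg hbn, hX]
    rw [← hc.proj_eq hA] at hbI
    exact hbI

/-- A set of atoms `mmr(a, c)` that are all true is supported by the reduct. -/
theorem not_modelsReductAll_of_mmr (hA : StableAbove (fullMeta T VR) rank A) (hc : VsId VR c I)
    {D : Set (GAtom (metaSig K P V))} (hD : D ⊆ A) (hne : D.Nonempty)
    (hDm : ∀ g ∈ D, ∃ x, g = ⟨.mmr, [x, .sym c]⟩) {J : Set (OAtom K P)}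
    (h1 : ∀ x, ⟨.mmr, [x, .sym c]⟩ ∈ A → ⟨.mmr, [x, .sym c]⟩ ∉ D → ∃ a ∈ J, x = qAtom a)
    (h2 : ∀ a ∈ J, ⟨.mmr, [qAtom a, .sym c]⟩ ∉ D) :
    ¬ ModelsReductAll (T.prog (decodeHyp T A)) I J := by
  intro hm
  -- Foundedness gives a rule with head in `D` and body outside `D`. The corresponding object rule
  -- fires in `J`: an atomic head would lie in `J`, against `h2`, and a head `⊥` means that the
  -- reduct requires a contradiction.
  obtain ⟨r', hr', h, hh, σ', -, hb, hhD, hp⟩ := hA.founded D hD hne (by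
    intro g hg
    obtain ⟨x, rfl⟩ := hDm g hg
    exact (by decide : 0 < rank .mmr))
  obtain ⟨x, hx⟩ := hDm _ hhD
  have hr := metaRule_of_head hr' hh
  rw [show h.pred = .mmr from congrArg Atom.pred hx] at hr
  have hX : ∀ y : MTerm K P V, h = mat .mmr [y, varX] → σ' .X = .sym c := by
    rintro y rfl
    simp only [mat, Atom.subst, List.map_cons, List.map_nil, varX, Term.subst, Atom.mk.injEq,
      List.cons.injEq, true_and, and_true] at hx
    exact hx.2
  have hhead : ∀ (r : ORule K P V) (σ : V → GTerm (objSig K P)) (a : Atom (objSig K P) V),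
      Quotes r σ σ' → r.head.Offers a → h = mat .mmr [quoteAtom a, varX] → a.subst σ ∉ J := by
    rintro r σ a hq ha rfl haJ
    refine h2 _ haJ ?_
    have hX := hX _ rfl
    simp only [mat, Atom.subst, List.map_cons, List.map_nil, varX, Term.subst, hX] at hhD
    rw [hq.quoteHead ha] at hhD
    exact hhD
  have hI : proj .in_vs A (.sym c) = I := hc.proj_eq hA
  cases hr with
  | @mmrNormal r d a hs ha =>
    obtain ⟨σ, hq, hr, hpos, hneg⟩ := exists_quotes_of_mmr_body hA hc h1 hs
      (hX _ (Head.atom.inj hh).symm) hb hp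
    have := hm r hr σ hneg hpos
    rw [ha] at this
    exact hhead r σ a hq (by rw [ha]; rfl) (Head.atom.inj hh).symm this
  | @mmrHard r d hs ha =>
    obtain ⟨σ, hq, hr, hpos, hneg⟩ := exists_quotes_of_mmr_body hA hc h1 hs
      (hX _ (Head.atom.inj hh).symm) hb hp
    have := hm r hr σ hneg hpos
    rw [ha] at this
    exact this
  | @mmrChoice r d l hs' u a hs ha hma =>
    have hX := hX _ (Head.atom.inj hh).symm
    obtain ⟨σ, hq, hr, hpos, hneg⟩ := exists_quotes_of_mmr_body hA hc h1 hs hX hb hp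
    have := hm r hr σ hneg hpos
    rw [ha] at this
    have hoff : r.head.Offers a := by rw [ha]; exact hma
    refine hhead r σ a hq hoff (Head.atom.inj hh).symm (this.2 a hma ?_)
    have hin := hb.1 (reifyAtom .in_vs varX a) (by simp [addPos, mmrRule])
    rw [hq.head hoff, hX] at hin
    rw [← hI]
    exact hin
  | @mmrAbove r d l hs' u hs ha =>
    have hX := hX _ (Head.atom.inj hh).symm
    obtain ⟨σ, hq, hr, hpos, hneg⟩ := exists_quotes_of_mmr_body hA hc h1 hs hX hb hp
    have := hm r hr σ hneg hpos
    rw [ha] at this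
    have hcount := hb.2.2 _ (List.mem_singleton_self _)
    simp only [Builtin.Holds, countTrue_reify hq ha, hX, hI, Option.mem_some_iff, forall_eq'] at hcount
    have := this.1.2
    omega
  | @mmrBelow r d l hs' u hs ha =>
    have hX := hX _ (Head.atom.inj hh).symm
    obtain ⟨σ, hq, hr, hpos, hneg⟩ := exists_quotes_of_mmr_body hA hc h1 hs hX hb hp
    have := hm r hr σ hneg hpos
    rw [ha] at this
    have hcount := hb.2.2 _ (List.mem_singleton_self _)
    simp only [Builtin.Holds, countTrue_reify hq ha, hX, hI, Option.mem_some_iff, forall_eq'] at hcount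
    have := this.1.1
    omega

theorem nas_iff_mmr (hA : StableAbove (fullMeta T VR) rank A) (t : GTerm (metaSig K P V)) :
    ⟨.nas, [t]⟩ ∈ A ↔ (∃ x, ⟨.in_vs, [x, t]⟩ ∈ A ∧ ⟨.mmr, [x, t]⟩ ∉ A) ∨
      ∃ x, ⟨.mmr, [x, t]⟩ ∈ A ∧ ⟨.in_vs, [x, t]⟩ ∉ A := by
  constructor
  · intro h
    obtain ⟨r, σ, h, hr, hh, hs, hb⟩ := support hA (by decide) h
    cases hr with
    | nasIn =>
      obtain rfl := Head.atom.inj hh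
      simp only [mat, Atom.subst, List.map_cons, List.map_nil, varX, Term.subst, Atom.mk.injEq,
        List.cons.injEq, true_and, and_true] at hs
      subst hs
      exact .inl ⟨σ .ATOM, by
        simpa [mat, Atom.subst, varX, Term.subst] using hb.1 _ (List.mem_singleton_self _), by
        simpa [mat, Atom.subst, varX, Term.subst] using hb.2.1 _ (List.mem_singleton_self _)⟩
    | nasOut =>
      obtain rfl := Head.atom.inj hh
      simp only [mat, Atom.subst, List.map_cons, List.map_nil, varX, Term.subst, Atom.mk.injEq,
        List.cons.injEq, true_and, and_true] at hs
      subst hs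
      exact .inr ⟨σ .ATOM, by
        simpa [mat, Atom.subst, varX, Term.subst] using hb.1 _ (List.mem_singleton_self _), by
        simpa [mat, Atom.subst, varX, Term.subst] using hb.2.1 _ (List.mem_singleton_self _)⟩
  · rintro (⟨x, h1, h2⟩ | ⟨x, h1, h2⟩)
    · have := derive_of_safe (σ := fun v => match v with | .ATOM => x | _ => t) hA
        MetaRule.nasIn (by decide) rfl
        (by simp [Rule.IsSafe, Rule.vars, Head.vars, mat, Atom.vars, Term.vars, varX])
        ⟨by simpa [mat, Atom.subst, varX, Term.subst] using h1,
          by simpa [mat, Atom.subst, varX, Term.subst] using h2, by simp⟩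
      simpa [mat, Atom.subst, varX, Term.subst] using this
    · have := derive_of_safe (σ := fun v => match v with | .ATOM => x | _ => t) hA
        MetaRule.nasOut (by decide) rfl
        (by simp [Rule.IsSafe, Rule.vars, Head.vars, mat, Atom.vars, Term.vars, varX])
        ⟨by simpa [mat, Atom.subst, varX, Term.subst] using h1,
          by simpa [mat, Atom.subst, varX, Term.subst] using h2, by simp⟩
      simpa [mat, Atom.subst, varX, Term.subst] using this

/-- `nas(c)` says that the interpretation named by `c` is not an answer set. -/
theorem nas_iff (hA : StableAbove (fullMeta T VR) rank A) (hc : VsId VR c I) :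
    ⟨.nas, [.sym c]⟩ ∈ A ↔ I ∉ answerSets (T.prog (decodeHyp T A)) := by
  have hin : ∀ x, (⟨.in_vs, [x, .sym c]⟩ : GAtom (metaSig K P V)) ∈ A ↔ ∃ a ∈ I, x = qAtom a := by
    intro x
    rw [in_vs_iff hA]
    constructor
    · rintro ⟨c', I', a, hc', ha, heq⟩
      simp only [List.cons.injEq, Term.sym.injEq, and_true] at heq
      obtain ⟨rfl, rfl⟩ := heq
      exact ⟨a, by rwa [hc.unique hc'], rfl⟩
    · rintro ⟨a, ha, rfl⟩
      exact ⟨c, I, a, hc, ha, rfl⟩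
  rw [nas_iff_mmr hA, mem_answerSets_iff_of_safe (T.prog_wf decodeHyp_subset)]
  constructor
  · rintro h ⟨hm, hmin⟩
    -- With `J = I`, the `mmr` atoms that quote nothing in `I` would be a founded set, impossible
    -- since `I` models its reduct. In particular `⊥` is not derived, as it is not a quoted atom.
    have hout : ∀ x, (⟨.mmr, [x, .sym c]⟩ : GAtom (metaSig K P V)) ∈ A → ∃ a ∈ I, x = qAtom a := by
      by_contra hcon
      push Not at hcon
      obtain ⟨x, hx, hxI⟩ := hcon
      refine not_modelsReductAll_of_mmr hA hc
        (D := {g | g ∈ A ∧ ∃ x, g = ⟨.mmr, [x, .sym c]⟩ ∧ ∀ a ∈ I, x ≠ qAtom a})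
        (fun g hg => hg.1) ⟨_, hx, x, rfl, hxI⟩ (fun g hg => hg.2.imp fun _ h => h.1)
        (J := I) ?_ ?_ hm
      · intro y hy hyD
        by_contra hcon
        push Not at hcon
        exact hyD ⟨hy, y, rfl, hcon⟩
      · rintro a ha ⟨-, y, hy, hyI⟩
        simp only [Atom.mk.injEq, List.cons.injEq, true_and, and_true] at hy
        exact hyI a ha hy.symm
    have hbot : (⟨.mmr, [.sym .bot, .sym c]⟩ : GAtom (metaSig K P V)) ∉ A := by
      intro h
      obtain ⟨a, -, ha⟩ := hout _ h
      simp [qAtom] at ha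
    have hJ : proj .mmr A (.sym c) = I := by
      refine hmin _ (fun a ha => ?_) (fun r hr σ hn hp => ?_)
      · obtain ⟨b, hb, hab⟩ := hout _ ha
        rwa [qAtom_inj.1 hab]
      · exact (mmr_closed hA hc hr hn hp).resolve_right hbot
    rcases h with ⟨x, h1, h2⟩ | ⟨x, h1, h2⟩
    · obtain ⟨a, ha, rfl⟩ := (hin x).1 h1
      rw [← hJ] at ha
      exact h2 ha
    · exact h2 ((hin x).2 (hout x h1))
  · intro hnot
    by_contra hcon
    push Not at hcon
    obtain ⟨hc1, hc2⟩ := hcon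
    have hiff : ∀ x, (⟨.mmr, [x, .sym c]⟩ : GAtom (metaSig K P V)) ∈ A ↔ ∃ a ∈ I, x = qAtom a :=
      fun x => ⟨fun h => (hin x).1 (hc2 x h), fun h => hc1 x ((hin x).2 h)⟩
    have hJ : proj .mmr A (.sym c) = I := by
      ext a
      refine (hiff _).trans ⟨?_, fun ha => ⟨a, ha, rfl⟩⟩
      rintro ⟨b, hb, hab⟩
      rwa [qAtom_inj.1 hab]
    have hbot : (⟨.mmr, [.sym .bot, .sym c]⟩ : GAtom (metaSig K P V)) ∉ A := by
      intro h
      obtain ⟨a, -, ha⟩ := (hiff _).1 h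
      simp [qAtom] at ha
    refine hnot ⟨fun r hr σ hn hp => ?_, fun J hJI hm => ?_⟩
    · have := (mmr_closed hA hc hr hn (by rwa [hJ])).resolve_right hbot
      rwa [hJ] at this
    · by_contra hne
      obtain ⟨a, haI, haJ⟩ : ∃ a ∈ I, a ∉ J := by
        by_contra hcon
        push Not at hcon
        exact hne (hJI.antisymm hcon)
      -- Minimality: for a smaller model `J`, the atoms `mmr(a, c)` with `a ∈ I \ J` would be
      -- founded without any rule of the reduct accounting for them.
      refine not_modelsReductAll_of_mmr hA hc
        (D := {g | ∃ a ∈ I, a ∉ J ∧ g = ⟨.mmr, [qAtom a, .sym c]⟩}) ?_ ⟨_, a, haI, haJ, rfl⟩ ?_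
        (J := J) ?_ ?_ hm
      · rintro _ ⟨b, hb, -, rfl⟩
        exact (hiff _).2 ⟨b, hb, rfl⟩
      · rintro _ ⟨b, -, -, rfl⟩
        exact ⟨_, rfl⟩
      · intro x hx hxD
        obtain ⟨b, hb, rfl⟩ := (hiff x).1 hx
        exact ⟨b, by_contra fun hbJ => hxD ⟨b, hb, hbJ, rfl⟩, rfl⟩
      · rintro b hb ⟨b', -, hb', heq⟩
        simp only [Atom.mk.injEq, List.cons.injEq, true_and, and_true, qAtom_inj] at heq
        exact hb' (heq ▸ hb)

end Stability

end LOAS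

namespace LOAS

open ASP

universe u v w

/-! ### Answer sets of the meta program represent remaining hypotheses -/

section AnswerSets

variable {K : Type u} {P : Type v} {V : Type w} {T : Task K P V} {VR : Set (Reason K P)}
  {A : Set (GAtom (metaSig K P V))}

/-- The rule `R[in_as, X]` with `as(X)` and the condition `c`. -/
def asRule (r : ORule K P V) (c : List (MAtom K P V)) : MRule K P V :=
  addPos (append (reify .in_as varX r) (mat .as [varX])) c

theorem mem_asRule_pos {r : ORule K P V} {c : List (MAtom K P V)} {b : MAtom K P V} :
    b ∈ (asRule r c).pos ↔
      (∃ a ∈ r.pos, b = reifyAtom .in_as varX a) ∨ b = mat .as [varX] ∨ b ∈ c := by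
  simp only [asRule, addPos, append, reify, List.mem_append, List.mem_map, List.mem_singleton,
    or_assoc, eq_comm (a := b)]

theorem mem_vars_reifyHead {p : MPred} {hd : Head (objSig K P) V} {v : MVar V}
    (hv : v ∈ (reifyHead p varX hd : Head (metaSig K P V) (MVar V)).vars) :
    (∃ w ∈ hd.vars, v = .obj w) ∨ v = .X := by
  cases hd with
  | atom h => exact mem_vars_reifyAtom hv
  | bot => simp [reifyHead, Head.vars] at hv
  | choice l hs u => exact mem_vars_map_reifyAtom hv
  | weak wt lev ts =>
    left
    simp only [reifyHead, Head.vars, List.mem_append, List.mem_flatMap, List.mem_map] at hv ⊢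
    rcases hv with (hv | hv) | ⟨_, ⟨t, ht, rfl⟩, hv⟩
    · obtain ⟨w, hw, rfl⟩ := mem_vars_quoteTerm hv
      exact ⟨w, .inl (.inl hw), rfl⟩
    · obtain ⟨w, hw, rfl⟩ := mem_vars_quoteTerm hv
      exact ⟨w, .inl (.inr hw), rfl⟩
    · obtain ⟨w, hw, rfl⟩ := mem_vars_quoteTerm hv
      exact ⟨w, .inr ⟨t, ht, hw⟩, rfl⟩

theorem asRule_safe {r : ORule K P V} {c : List (MAtom K P V)} (hs : Src T r c)
    (hc : ∀ b ∈ c, b.vars = []) : (asRule r c).IsSafe := by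
  refine safe_addPos (p := .in_as) hs.safe ?_ ?_ hc
  · intro b hb
    exact List.mem_append_left _ (List.mem_map_of_mem hb)
  · intro v hv
    have hX : ∃ b ∈ (append (reify .in_as varX r) (mat .as [varX])).pos, MVar.X ∈ b.vars :=
      ⟨mat .as [varX], by simp [append], by simp [mat, varX, Atom.vars, Term.vars]⟩
    have key : (∃ w ∈ r.vars, v = .obj w) ∨ v = .X := by
      simp only [Rule.vars, append, reify, List.flatMap_append, List.flatMap_cons,
        List.flatMap_nil, List.append_nil, List.mem_append] at hv
      rcases hv with (hv | hv | hv) | hv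
      · exact (mem_vars_reifyHead hv).imp
          (fun ⟨w, hw, h⟩ => ⟨w, vars_subset (.inl hw), h⟩) id
      · exact (mem_vars_map_reifyAtom hv).imp
          (fun ⟨w, hw, h⟩ => ⟨w, vars_subset (.inr (.inl hw)), h⟩) id
      · simp only [mat, Atom.vars, varX, List.flatMap_cons, List.flatMap_nil, List.append_nil,
          Term.vars, List.mem_singleton] at hv
        exact .inr hv
      · exact (mem_vars_map_reifyAtom hv).imp
          (fun ⟨w, hw, h⟩ => ⟨w, vars_subset (.inr (.inr hw)), h⟩) id
    rcases key with h | rfl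
    · exact .inl h
    · exact .inr hX

theorem reductHolds_reify {r : ORule K P V} {σ : V → GTerm (objSig K P)}
    {σ' : MVar V → GTerm (metaSig K P V)} (hq : Quotes r σ σ')
    (I J : Set (GAtom (metaSig K P V))) (p : MPred) :
    (reifyHead p varX r.head).ReductHolds σ' I J ↔
      r.head.ReductHolds σ (proj p I (σ' .X)) (proj p J (σ' .X)) := by
  cases hh : r.head with
  | atom h =>
    simp only [reifyHead, Head.ReductHolds]
    rw [hq.head (a := h) (by rw [hh]; rfl)]
    rfl
  | bot => exact Iff.rfl
  | weak => exact Iff.rfl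
  | choice l hs u =>
    simp only [reifyHead, Head.ReductHolds, countTrue_reify hq hh, List.forall_mem_map]
    refine and_congr_right fun _ => forall₂_congr fun h hm => ?_
    rw [hq.head (a := h) (by rw [hh]; exact hm)]
    rfl

/-- The models of the reduct of the meta program project to models of the reduct of the program
that is represented. -/
theorem modelsReductAll_proj {J : Set (GAtom (metaSig K P V))}
    (hA : J ⊆ herbrandBase (fullMeta T VR)) (hm : ModelsReduct (fullMeta T VR) A J)
    (hH : ∀ r ∈ T.S, inHAtom r ∈ A → inHAtom r ∈ J) {c : MConst K P V}
    (hc : ⟨.as, [.sym c]⟩ ∈ J) :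
    ModelsReductAll (T.prog (decodeHyp T A)) (proj .in_as A (.sym c)) (proj .in_as J (.sym c)) := by
  intro r hr σ hn hp
  by_cases hw : r.IsWeak
  · obtain ⟨wt, lev, ts, h⟩ := hw
    rw [h]
    trivial
  -- The hypothesis is decoded from `A`, but the conditions `in_h` are positive body atoms and must
  -- hold in `J`; this is what `hH` supplies.
  obtain ⟨d, hs, hdv, hd⟩ : ∃ d, Src T r d ∧ (∀ b ∈ d, b.vars = []) ∧
      ∀ σ : MVar V → GTerm (metaSig K P V), ∀ b ∈ d, b.subst σ ∈ J := by
    rcases hr with hr | hr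
    · exact ⟨[], .bg hr, by simp, by simp⟩
    · obtain ⟨hr, hrA⟩ := mem_decodeHyp.1 hr
      exact ⟨_, .hyp hr, by simp [inH, mat, Atom.vars, Term.vars],
        by simpa [inH_subst] using fun _ => hH r hr hrA⟩
  have hq := quotes_liftSubst r σ (.sym c)
  have hpos : ∀ b ∈ (asRule r d).pos, b.subst (liftSubst σ (.sym c)) ∈ J := by
    intro b hb
    rcases mem_asRule_pos.1 hb with ⟨a, ha, rfl⟩ | rfl | hb
    · rw [hq.pos ha]
      exact hp a ha
    · simpa [mat, Atom.subst, varX, Term.subst, liftSubst] using hc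
    · exact hd _ b hb
  have hneg : ∀ b ∈ (asRule r d).neg, b.subst (liftSubst σ (.sym c)) ∉ A := by
    intro b hb
    obtain ⟨a, ha, rfl⟩ := List.mem_map.1 hb
    rw [hq.neg ha]
    exact hn a ha
  have hnil : (asRule r d).builtins = [] := rfl
  have := hm (asRule r d) (reify_mem hs hw) (liftSubst σ (.sym c))
    (Grounds.of_safe (asRule_safe hs hdv) hA hpos) hneg (by simp [hnil]) hpos (by simp [hnil])
  exact (reductHolds_reify hq A J .in_as).1 this

/-- The rules whose head offers an atom. -/
theorem MetaRule.of_offers {p : Option MPred} {R : MRule K P V} (hR : MetaRule T VR p R)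
    {h : MAtom K P V} (hh : R.head.Offers h) :
    p = some h.pred ∧ R.head = .atom h ∨ (∃ r ∈ T.S, h = inH r) ∨
      ∃ r c h₀, Src T r c ∧ r.head.Offers h₀ ∧ R = asRule r c ∧ h = reifyAtom .in_as varX h₀ := by
  cases hd : R.head with
  | atom h' =>
    rw [hd] at hh
    cases hh
    have := hR.headPred_eq
    rw [hd] at this
    exact .inl ⟨this.symm, rfl⟩
  | bot => rw [hd] at hh; exact hh.elim
  | weak => rw [hd] at hh; exact hh.elim
  | choice l hs u =>
    right
    rw [hd] at hh
    cases hR with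
    | normal hs' hh' => simp [addPos, append, reify, hh', reifyHead] at hd
    | hard hs' hh' => simp [addPos, append, reify, hh', reifyHead] at hd
    | @choice r c l' hs'' u' hs' hh' =>
      right
      simp only [addPos, append, reify, hh', reifyHead, Head.choice.injEq] at hd
      obtain ⟨rfl, rfl, rfl⟩ := hd
      obtain ⟨h₀, hm, rfl⟩ := List.mem_map.1 hh
      exact ⟨r, c, h₀, hs', by rw [hh']; exact hm, rfl, rfl⟩
    | guess =>
      left
      simp only [Head.choice.injEq] at hd
      obtain ⟨rfl, rfl, rfl⟩ := hd
      obtain ⟨r, hr, rfl⟩ := List.mem_map.1 hh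
      exact ⟨r, Finset.mem_toList.1 hr, rfl⟩
    | _ => cases hd

theorem MetaRule.of_offers_in_as {p : Option MPred} {R : MRule K P V} (hR : MetaRule T VR p R)
    {h : MAtom K P V} (hh : R.head.Offers h) (hp : h.pred = .in_as) :
    ∃ r c h₀, Src T r c ∧ r.head.Offers h₀ ∧ R = asRule r c ∧ h = reifyAtom .in_as varX h₀ := by
  rcases hR.of_offers hh with ⟨rfl, hd⟩ | ⟨r, hr, rfl⟩ | h
  · rw [hp] at hR
    cases hR with
    | @normal r c h₀ hs hr =>
      refine ⟨r, c, h₀, hs, by rw [hr]; rfl, rfl, ?_⟩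
      simp only [addPos, append, reify, hr, reifyHead, Head.atom.injEq] at hd
      exact hd.symm
  · cases hp
  · exact h

/-- Choice rules of the meta program offer only atoms `in_h` and `in_as`, both of rank zero. -/
theorem stableAbove_of_answerSet (hA : A ∈ answerSets (fullMeta T VR)) :
    StableAbove (fullMeta T VR) rank A := by
  refine StableAbove.of_answerSet (fun R hR l hs u hd h hm => ?_) hA
  obtain ⟨p, hR⟩ := exists_metaRule hR
  rcases hR.of_offers (h := h) (by rw [hd]; exact hm) with ⟨-, h⟩ | ⟨r, -, rfl⟩ |
    ⟨r, c, h₀, -, -, -, rfl⟩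
  · rw [hd] at h; cases h
  · rfl
  · rfl

/-- `B` is a parameter because the lemma is needed before all `in_as` atoms of the answer set are
known to be well formed, with `B` restricted to the well-formed ones. -/
theorem exists_quotes_of_asRule {B : Set (GAtom (metaSig K P V))}
    (hB : ∀ x t, ⟨.in_as, [x, t]⟩ ∈ B → ∃ a : OAtom K P, x = qAtom a) {r : ORule K P V}
    {d : List (MAtom K P V)} (hs : Src T r d) {σ' : MVar V → GTerm (metaSig K P V)}
    (hp : ∀ b ∈ (asRule r d).pos, b.subst σ' ∈ B) :
    ∃ σ, Quotes r σ σ' ∧ ∀ b ∈ r.pos, b.subst σ ∈ proj .in_as B (σ' .X) := by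
  have hp' : ∀ b ∈ r.pos, (reifyAtom .in_as varX b).subst σ' ∈ B := fun b hb =>
    hp _ (mem_asRule_pos.2 (.inl ⟨b, hb, rfl⟩))
  obtain ⟨σ, hσ⟩ := exists_quotes (σ' := σ') hs.safe (fun b hb => by
    have := hp' b hb
    simp only [reifyAtom, mat, Atom.subst, List.map_cons, List.map_nil] at this
    exact hB _ _ this)
  refine ⟨σ, hσ, fun b hb => ?_⟩
  have := hp' b hb
  rw [hσ.pos hb] at this
  exact this

/-- Three uses of unfounded sets: `as` comes from facts only, malformed `in_as` atoms cannot found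
themselves, and a smaller model of the reduct for one identifier would make the missing atoms
unfounded. -/
theorem coherent_of_answerSet (hA : A ∈ answerSets (fullMeta T VR)) : Coherent T VR A := by
  have has : ∀ ts, ⟨.as, ts⟩ ∈ A ↔ ∃ c, AsId T c ∧ ts = [.sym c] := by
    intro ts
    constructor
    · intro h
      obtain ⟨R, hR, σ, -, hb, -, a, ha, hD⟩ := exists_founding_rule hA
        (Set.singleton_subset_iff.2 h) (Set.singleton_nonempty _)
      have hD : a.subst σ = ⟨.as, ts⟩ := hD
      have hap : a.pred = .as := congrArg Atom.pred hD
      obtain ⟨p, hR⟩ := exists_metaRule hR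
      rcases hR.of_offers ha with ⟨rfl, hd⟩ | ⟨r, -, rfl⟩ | ⟨r, c, h₀, -, -, -, rfl⟩
      · rw [hap] at hR
        cases hR with
        | @as c hc =>
          obtain rfl := Head.atom.inj hd
          exact ⟨c, hc, by simpa [mat, Atom.subst, Term.subst] using hD.symm⟩
      · cases hap
      · cases hap
    · rintro ⟨c, hc, rfl⟩
      have := hA.2.1 _ (MetaRule.as hc).mem (fun _ => .int 0)
        (by intro v hv; simp [fact, mat, Rule.vars, Head.vars, Atom.vars, Term.vars] at hv)
        (by simp [fact]) (by simp [fact]) (by simp [fact]) (by simp [fact])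
      simpa [fact, Head.ReductHolds, mat, Atom.subst, Term.subst] using this
  have hin : ∀ ts, ⟨.in_as, ts⟩ ∈ A → ∃ a c, AsId T c ∧ ts = [qAtom a, .sym c] := by
    by_contra hcon
    push Not at hcon
    obtain ⟨ts, hts, hne⟩ := hcon
    -- `D` collects the malformed `in_as` atoms. A founding rule has a well-formed body, hence a
    -- quoted substitution and a true `as(X)`, and so its head is well formed too.
    obtain ⟨R, hR, σ', -, hb, hpD, a, ha, hD⟩ := exists_founding_rule hA
      (D := {g | g ∈ A ∧ ∃ ts, g = ⟨.in_as, ts⟩ ∧ ∀ a c, AsId T c → ts ≠ [qAtom a, .sym c]})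
      (fun g hg => hg.1) ⟨_, hts, ts, rfl, hne⟩
    obtain ⟨-, us, hus, hne⟩ := hD
    obtain ⟨p, hR⟩ := exists_metaRule hR
    obtain ⟨r, d, h₀, hs, hh₀, rfl, rfl⟩ := hR.of_offers_in_as ha (congrArg Atom.pred hus)
    have hX := hb.1 (mat .as [varX]) (mem_asRule_pos.2 (.inr (.inl rfl)))
    simp only [mat, Atom.subst, varX, List.map_cons, List.map_nil, Term.subst] at hX
    obtain ⟨c, hc, hcX⟩ := (has _).1 hX
    simp only [List.cons.injEq, and_true] at hcX
    obtain ⟨σ, hq, -⟩ := exists_quotes_of_asRule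
      (B := {g | g ∈ A ∧ (g.pred = .in_as → ∃ a c, AsId T c ∧ g.args = [qAtom a, .sym c])})
      (fun x t hx => by
        obtain ⟨a, c, -, h⟩ := hx.2 rfl
        simp only [List.cons.injEq] at h
        exact ⟨a, h.1⟩) hs (fun b hbp => ⟨hb.1 b hbp, fun hpred => by
          by_contra hcon
          push Not at hcon
          exact hpD b hbp ⟨hb.1 b hbp, _, by rw [← hpred], hcon⟩⟩)
    rw [hq.head hh₀, hcX] at hus
    exact hne _ _ hc (congrArg Atom.args hus).symm
  refine ⟨stableAbove_of_answerSet hA, has, hin, fun c hc => ?_⟩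
  rw [mem_answerSets_iff_of_safe (T.prog_wf decodeHyp_subset)]
  refine ⟨modelsReductAll_proj hA.1 hA.2.1 (fun _ _ h => h) ((has _).2 ⟨c, hc, rfl⟩),
    fun J hJ hm => ?_⟩
  by_contra hne
  obtain ⟨a, haI, haJ⟩ : ∃ a ∈ proj .in_as A (.sym c), a ∉ J := by
    by_contra hcon
    push Not at hcon
    exact hne (hJ.antisymm hcon)
  -- Now `D` collects what the smaller model `J` lacks. The founding rule has its positive body in
  -- `J`, so `J` contains the head after all.
  obtain ⟨R, hR, σ', -, hb, hpD, a, ha, hD⟩ := exists_founding_rule hA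
    (D := {g | ∃ a ∈ proj .in_as A (.sym c), a ∉ J ∧ g = ⟨.in_as, [qAtom a, .sym c]⟩})
    (by rintro _ ⟨a, ha, -, rfl⟩; exact ha) ⟨_, a, haI, haJ, rfl⟩
  obtain ⟨b, hbI, hbJ, hbe⟩ := hD
  obtain ⟨p, hR⟩ := exists_metaRule hR
  obtain ⟨r, d, h₀, hs, hh₀, rfl, rfl⟩ := hR.of_offers_in_as ha (congrArg Atom.pred hbe)
  obtain ⟨σ, hq, hpos⟩ := exists_quotes_of_asRule
    (fun x t hx => by
      obtain ⟨a, c, -, h⟩ := hin _ hx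
      simp only [List.cons.injEq] at h
      exact ⟨a, h.1⟩) hs hb.1
  rw [hq.head hh₀] at hbe
  simp only [Atom.mk.injEq, List.cons.injEq, qAtom_inj, true_and, and_true] at hbe
  obtain ⟨rfl, hX⟩ := hbe
  rw [hX] at hpos
  have hred := hm r (hs.mem_prog (σ := σ') fun b hbd =>
      hb.1 b (mem_asRule_pos.2 (.inr (.inr hbd)))) σ
    (fun n hn hnA => hb.2.1 (reifyAtom .in_as varX n) (List.mem_map_of_mem hn) (by
      rw [hq.neg hn, hX]; exact hnA))
    (fun b hbp => by
      by_contra hbJ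
      refine hpD (reifyAtom .in_as varX b) (mem_asRule_pos.2 (.inl ⟨b, hbp, rfl⟩))
        ⟨_, hpos b hbp, hbJ, ?_⟩
      rw [hq.pos hbp, hX])
  cases hd : r.head with
  | atom h =>
    rw [hd] at hh₀ hred
    cases hh₀
    exact hbJ hred
  | bot => rw [hd] at hh₀; exact hh₀
  | weak => rw [hd] at hh₀; exact hh₀
  | choice l hs u =>
    rw [hd] at hh₀ hred
    exact hbJ (hred.2 _ hh₀ hbI)

/-- The negated atoms are ground, so the substitution by `0` is only a filler. -/
theorem not_constraint (hA : A ∈ answerSets (fullMeta T VR)) {ns : List (MAtom K P V)}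
    (hr : MetaRule T VR none { head := .bot, neg := ns }) (hv : ∀ b ∈ ns, b.vars = []) :
    ∃ b ∈ ns, b.subst (fun _ => .int 0) ∈ A := by
  by_contra hcon
  push Not at hcon
  refine hA.2.1 _ hr.mem (fun _ => .int 0) ?_ hcon (by simp) (by simp) (by simp)
  intro v hv'
  simp only [Rule.vars, Head.vars, List.flatMap_nil, List.nil_append, List.append_nil,
    List.mem_flatMap] at hv'
  obtain ⟨b, hb, hvb⟩ := hv'
  rw [hv b hb] at hvb
  simp at hvb

/-- An identifier belongs to a single example, so `cov(c)` can only have been derived from `e`. -/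
theorem covered_of_answerSet (hA : A ∈ answerSets (fullMeta T VR)) {e : PartialInterp K P}
    {c : MConst K P V} (hc : CoverId T e c) : Extends (proj .in_as A (.sym c)) e := by
  obtain ⟨b, hb, hbA⟩ := not_constraint hA (.covered hc) (by simp [mat, Atom.vars, Term.vars])
  obtain rfl := List.mem_singleton.1 hb
  simp only [mat, Atom.subst, List.map_cons, List.map_nil, Term.subst] at hbA
  obtain ⟨e', hc', he⟩ := (cov_iff (stableAbove_of_answerSet hA) _).1 hbA
  cases hc <;> cases hc' <;> exact he

/-- The answer sets of the meta program represent remaining hypotheses. -/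
theorem isRemaining_of_answerSet (hA : A ∈ answerSets (fullMeta T VR)) :
    T.IsRemaining VR (decodeHyp T A) := by
  have hco := coherent_of_answerSet hA
  refine ⟨⟨decodeHyp_subset, fun e he => ?_, fun o ho => ?_⟩, fun I hI => ?_,
    fun I₁ I₂ hI h1 h2 => ?_⟩
  · exact ⟨_, hco.answer _ (.ex he), covered_of_answerSet hA (.ex he)⟩
  · refine ⟨_, hco.answer _ (.ord1 ho), _, hco.answer _ (.ord2 ho),
      covered_of_answerSet hA (.ord1 ho), covered_of_answerSet hA (.ord2 ho), ?_⟩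
    obtain ⟨b, hb, hbA⟩ := not_constraint hA (.brave ho) (by simp [mat, Atom.vars, Term.vars])
    obtain rfl := List.mem_singleton.1 hb
    simp only [mat, Atom.subst, List.map_cons, List.map_nil, Term.subst] at hbA
    exact (hco.dom_iff (.ob ho) (.inl ⟨.ord1 ho, rfl⟩) (.inl ⟨.ord2 ho, rfl⟩)
      (hco.answer _ (.ord1 ho)) (hco.answer _ (.ord2 ho))).1 hbA
  · obtain ⟨b, hb, hbA⟩ := not_constraint hA (.excludeInterp hI)
      (by simp [mat, Atom.vars, Term.vars])
    obtain rfl := List.mem_singleton.1 hb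
    simp only [mat, Atom.subst, List.map_cons, List.map_nil, Term.subst] at hbA
    exact (nas_iff hco.stable (.interp hI)).1 hbA
  · obtain ⟨b, hb, hbA⟩ := not_constraint hA (.excludePair hI)
      (by simp [mat, Atom.vars, Term.vars])
    simp only [List.mem_cons, List.not_mem_nil, or_false] at hb
    rcases hb with rfl | rfl | rfl <;>
      simp only [mat, Atom.subst, List.map_cons, List.map_nil, Term.subst] at hbA
    · exact absurd h1 ((nas_iff hco.stable (.fst hI)).1 hbA)
    · exact absurd h2 ((nas_iff hco.stable (.snd hI)).1 hbA)
    · exact (hco.dom_iff (.vp hI) (.inr (.fst hI)) (.inr (.snd hI)) h1 h2).1 hbA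

/-- The guess contains the reason: the answer set at `n`, or the pair at the identifiers of the two
ordered examples, which their coverage constraints force to extend these examples. -/
theorem isViolating_of_answerSet (hA : A ∈ answerSets (fullMeta T VR))
    (hv : violatingAtom ∈ A) : T.IsViolating (decodeHyp T A) := by
  have hco := coherent_of_answerSet hA
  have hpos := (isRemaining_of_answerSet hA).1
  rcases hco.violating_iff.1 hv with ⟨e, he, hext⟩ | ⟨o, ho, hnd⟩
  · exact ⟨.interp _, hpos, hco.answer _ (.n ⟨e, he⟩), e, he, hext⟩
  · obtain ⟨h1, h2⟩ := T.Oc_pos o ho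
    exact ⟨.pair _ _, hpos, hco.answer _ (.ex h1), hco.answer _ (.ex h2),
      ⟨o, ho, covered_of_answerSet hA (.ex h1), covered_of_answerSet hA (.ex h2)⟩, hnd⟩

end AnswerSets

end LOAS

namespace LOAS

open ASP

universe u v w

/-! ### From remaining hypotheses to answer sets of the meta program -/

section Construction

variable {K : Type u} {P : Type v} {V : Type w} {T : Task K P V} {VR : Set (Reason K P)}

/-- The atoms of rank zero that represent the hypothesis `H` and the interpretations `F`. -/
def guessAtoms (T : Task K P V) (H : Finset (ORule K P V)) (F : MConst K P V → Set (OAtom K P)) :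
    Set (GAtom (metaSig K P V)) :=
  {g | (∃ r ∈ H, g = inHAtom r) ∨ (∃ c, AsId T c ∧ g = ⟨.as, [.sym c]⟩) ∨
    ∃ c, AsId T c ∧ ∃ a ∈ F c, g = ⟨.in_as, [qAtom a, .sym c]⟩}

variable {H : Finset (ORule K P V)} {F : MConst K P V → Set (OAtom K P)}

theorem inHAtom_mem_base {r : ORule K P V} (hr : r ∈ T.S) :
    inHAtom r ∈ herbrandBase (fullMeta T VR) := by
  rw [← inH_subst r (fun _ => .int 0)]
  refine Grounds.head_mem (MetaRule.guess (T := T) (VR := VR)).mem ?_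
    (List.mem_map_of_mem (Finset.mem_toList.2 hr))
  intro v hv
  simp [Rule.vars, Head.vars, List.flatMap_map, inH, mat, Atom.vars, Term.vars] at hv

theorem as_mem_base {c : MConst K P V} (hc : AsId T c) :
    ⟨.as, [.sym c]⟩ ∈ herbrandBase (fullMeta T VR) := by
  have := Grounds.head_mem (σ := fun _ => .int 0) (MetaRule.as (VR := VR) hc).mem
    (by intro v hv; simp [fact, mat, Rule.vars, Head.vars, Atom.vars, Term.vars] at hv)
    (h := mat .as [.sym c]) rfl
  simpa [mat, Atom.subst, Term.subst] using this

/-- The atoms of `I` whose reified form lies in the meta Herbrand base still form a model of the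
reduct, because reified rules have their heads in the base; minimality of `I` makes this all of `I`.
-/
theorem in_as_mem_base (hH : H ⊆ T.S) {c : MConst K P V} (hc : AsId T c) {I : Set (OAtom K P)}
    (hI : I ∈ answerSets (T.prog H)) {a : OAtom K P} (ha : a ∈ I) :
    ⟨.in_as, [qAtom a, .sym c]⟩ ∈ herbrandBase (fullMeta T VR) := by
  rw [mem_answerSets_iff_of_safe (T.prog_wf hH)] at hI
  have hJ : I ∩ proj .in_as (herbrandBase (fullMeta T VR)) (.sym c) = I := by
    refine hI.2 _ Set.inter_subset_left fun r hr σ hn hp => ?_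
    have hred := hI.1 r hr σ hn fun b hb => (hp b hb).1
    by_cases hw : r.IsWeak
    · obtain ⟨wt, lev, ts, h⟩ := hw
      rw [h]
      trivial
    obtain ⟨d, hs, hdv, hd⟩ : ∃ d, Src T r d ∧ (∀ b ∈ d, b.vars = []) ∧
        ∀ σ : MVar V → GTerm (metaSig K P V), ∀ b ∈ d,
          b.subst σ ∈ herbrandBase (fullMeta T VR) := by
      rcases hr with hr | hr
      · exact ⟨[], .bg hr, by simp, by simp⟩
      · exact ⟨_, .hyp (hH hr), by simp [inH, mat, Atom.vars, Term.vars],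
          by simpa [inH_subst] using fun _ => inHAtom_mem_base (hH hr)⟩
    have hq := quotes_liftSubst r σ (.sym c)
    have hg : Grounds (fullMeta T VR) (asRule r d) (liftSubst σ (.sym c)) := by
      refine Grounds.of_safe (asRule_safe hs hdv) subset_rfl fun b hb => ?_
      rcases mem_asRule_pos.1 hb with ⟨a, ha, rfl⟩ | rfl | hb
      · rw [hq.pos ha]
        exact (hp a ha).2
      · simpa [mat, Atom.subst, varX, Term.subst, liftSubst] using as_mem_base hc
      · exact hd _ b hb
    have key : ∀ h, r.head.Offers h →
        h.subst σ ∈ proj .in_as (herbrandBase (fullMeta T VR)) (.sym c) := by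
      intro h hh
      have : (asRule r d).head.Offers (reifyAtom .in_as varX h) := by
        change (reifyHead .in_as varX r.head).Offers _
        cases hd : r.head with
        | atom h' => rw [hd] at hh; cases hh; rfl
        | bot => rw [hd] at hh; exact hh.elim
        | weak => rw [hd] at hh; exact hh.elim
        | choice l hs u => rw [hd] at hh; exact List.mem_map_of_mem hh
      have := hg.head_mem (reify_mem hs hw) this
      rw [hq.head hh] at this
      exact this
    revert hred key
    cases r.head with
    | atom h => exact fun hred key => ⟨hred, key _ rfl⟩
    | bot => exact fun hred _ => hred
    | choice l hs u => exact fun hred key => ⟨hred.1, fun h hh hI => ⟨hI, key _ hh⟩⟩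
    | weak => exact fun _ _ => trivial
  rw [← hJ] at ha
  exact ha.2

/-- The upper bound in the choice rule for hypotheses never excludes a guess. -/
theorem countTrue_inH_le (A : Set (GAtom (metaSig K P V))) (σ : MVar V → GTerm (metaSig K P V)) :
    countTrue σ (T.S.toList.map inH) A ≤ (T.S.card : ℤ) := by
  unfold countTrue
  rw [Nat.cast_le, ← Set.ncard_coe_finset T.S]
  refine (Set.ncard_le_ncard (t := inHAtom '' (T.S : Set (ORule K P V))) ?_
    (T.S.finite_toSet.image _)).trans (Set.ncard_image_le T.S.finite_toSet)
  rintro _ ⟨-, b, hb, rfl⟩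
  obtain ⟨r, hr, rfl⟩ := List.mem_map.1 hb
  exact ⟨r, Finset.mem_coe.2 (Finset.mem_toList.1 hr), (inH_subst r σ).symm⟩

/-- A coherent interpretation that satisfies the constraints is an answer set. -/
theorem Coherent.mem_answerSets {A : Set (GAtom (metaSig K P V))} (hA : Coherent T VR A)
    (hin : ∀ ts, ⟨.in_h, ts⟩ ∈ A → ∃ r ∈ T.S, ts = [.sym (.ruleId r)])
    (hcov : ∀ e c, CoverId T e c → Extends (proj .in_as A (.sym c)) e)
    (hob : ∀ o ∈ T.Ob, Dominates (T.prog (decodeHyp T A)) (proj .in_as A (.sym (.ordId1 o)))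
      (proj .in_as A (.sym (.ordId2 o))))
    (hR : T.IsRemaining VR (decodeHyp T A)) : A ∈ answerSets (fullMeta T VR) := by
  have hqin : ∀ x t, ⟨.in_as, [x, t]⟩ ∈ A → ∃ a : OAtom K P, x = qAtom a := by
    intro x t hx
    obtain ⟨a, c, -, h⟩ := hA.in_as _ hx
    simp only [List.cons.injEq] at h
    exact ⟨a, h.1⟩
  have hreify : ∀ r d, Src T r d → ∀ σ', (∀ b ∈ (asRule r d).neg, b.subst σ' ∉ A) →
      (∀ b ∈ (asRule r d).pos, b.subst σ' ∈ A) → (asRule r d).head.ReductHolds σ' A A := by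
    intro r d hs σ' hn hp
    obtain ⟨σ, hq, hpos⟩ := exists_quotes_of_asRule hqin hs hp
    have hX := hp (mat .as [varX]) (mem_asRule_pos.2 (.inr (.inl rfl)))
    simp only [mat, Atom.subst, varX, List.map_cons, List.map_nil, Term.subst] at hX
    obtain ⟨c, hc, hcX⟩ := (hA.as_iff _).1 hX
    simp only [List.cons.injEq, and_true] at hcX
    refine (reductHolds_reify hq A A .in_as).2 ?_
    rw [hcX] at hpos ⊢
    refine ((mem_answerSets_iff_of_safe (T.prog_wf decodeHyp_subset)).1 (hA.answer c hc)).1 r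
      (hs.mem_prog (σ := σ') fun b hb => hp b (mem_asRule_pos.2 (.inr (.inr hb)))) σ
      (fun b hb hbA => hn (reifyAtom .in_as varX b) (List.mem_map_of_mem hb) ?_) hpos
    rw [hq.neg hb, hcX]
    exact hbA
  refine ⟨hA.stable.subset_base, ?_, ?_⟩
  · intro r hr σ hg hn hb hp _
    obtain ⟨p, hr'⟩ := exists_metaRule hr
    cases p with
    | some p =>
      by_cases hp0 : 0 < rank p
      · cases hh : r.head with
        | atom h => exact derive hA.stable hr' hp0 hh hg ⟨hp, hn, hb⟩
        | _ =>
          have := hr'.headPred_eq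
          rw [hh] at this
          cases this
      · cases hr' with
        | normal hs hh => exact hreify _ _ hs σ hn hp
        | as hc =>
          refine (hA.as_iff _).2 ⟨_, hc, ?_⟩
          simp [mat, Term.subst]
        | _ => exact absurd (by decide) hp0
    | none =>
      cases hr' with
      | hard hs hh => exact hreify _ _ hs σ hn hp
      | choice hs hh => exact hreify _ _ hs σ hn hp
      | score hr => trivial
      | penalty => trivial
      | guess =>
        exact ⟨⟨Int.natCast_nonneg _, countTrue_inH_le A σ⟩, fun _ _ h => h⟩
      | @covered e c hc =>
        refine hn _ (List.mem_singleton_self _) ?_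
        have := (cov_iff hA.stable c).2 ⟨e, hc, hcov e c hc⟩
        simpa [mat, Atom.subst, Term.subst] using this
      | @brave o ho =>
        refine hn _ (List.mem_singleton_self _) ?_
        have := (hA.dom_iff (.ob ho) (.inl ⟨.ord1 ho, rfl⟩) (.inl ⟨.ord2 ho, rfl⟩)
          (hA.answer _ (.ord1 ho)) (hA.answer _ (.ord2 ho))).2 (hob o ho)
        simpa [mat, Atom.subst, Term.subst] using this
      | @excludeInterp I hI =>
        refine hn _ (List.mem_singleton_self _) ?_
        have := (nas_iff hA.stable (.interp hI)).2 (hR.2.1 I hI)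
        simpa [mat, Atom.subst, Term.subst] using this
      | @excludePair I₁ I₂ hI =>
        simp only [List.forall_mem_cons, mat, Atom.subst, List.map_cons, List.map_nil,
          Term.subst] at hn
        obtain ⟨n1, n2, n3, -⟩ := hn
        rw [nas_iff hA.stable (.fst hI), not_not] at n1
        rw [nas_iff hA.stable (.snd hI), not_not] at n2
        exact n3 ((hA.dom_iff (.vp hI) (.inr (.fst hI)) (.inr (.snd hI)) n1 n2).2
          (hR.2.2 I₁ I₂ hI n1 n2))
  -- A model of the reduct keeps the true `in_h` atoms, as the reduct of the choice rule contains
  -- them as facts; it keeps the facts `as`; and it keeps `in_as` because each guessed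
  -- interpretation is minimal. Stratification recovers the rest.
  · intro J hJ hm
    have hJin : ∀ r ∈ T.S, inHAtom r ∈ A → inHAtom r ∈ J := by
      intro r hr hrA
      have := hm _ (MetaRule.guess (T := T) (VR := VR)).mem (fun _ => .int 0)
        (by
          intro v hv
          simp [Rule.vars, Head.vars, List.flatMap_map, inH, mat, Atom.vars, Term.vars] at hv)
        (by simp) (by simp) (by simp) (by simp)
      have := this.2 (inH r) (List.mem_map_of_mem (Finset.mem_toList.2 hr))
      rw [inH_subst] at this
      exact this hrA
    have hJas : ∀ c, AsId T c → ⟨.as, [.sym c]⟩ ∈ J := by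
      intro c hc
      have := hm _ (MetaRule.as hc).mem (fun _ => .int 0)
        (by intro v hv; simp [fact, mat, Rule.vars, Head.vars, Atom.vars, Term.vars] at hv)
        (by simp [fact]) (by simp [fact]) (by simp [fact]) (by simp [fact])
      simpa [fact, Head.ReductHolds, mat, Atom.subst, Term.subst] using this
    refine hA.stable.eq_of_modelsReduct stratified_fullMeta hJ hm ?_
    rintro ⟨p, ts⟩ ha h0
    cases p with
    | in_as =>
      obtain ⟨a, c, hc, rfl⟩ := hA.in_as ts ha
      have heq := ((mem_answerSets_iff_of_safe (T.prog_wf decodeHyp_subset)).1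
        (hA.answer c hc)).2 (proj .in_as J (.sym c)) (fun a ha => hJ ha)
        (modelsReductAll_proj (hJ.trans hA.stable.subset_base) hm hJin (hJas c hc))
      have : a ∈ proj .in_as A (.sym c) := ha
      rw [← heq] at this
      exact this
    | as =>
      obtain ⟨c, hc, rfl⟩ := (hA.as_iff ts).1 ha
      exact hJas c hc
    | in_h =>
      obtain ⟨r, hr, rfl⟩ := hin ts ha
      exact hJin r hr ha
    | _ => exact absurd h0 (by simp [rank])

/-- A remaining hypothesis and suitable answer sets are represented by an answer set of the meta
program. -/
theorem exists_answerSet (hR : T.IsRemaining VR H)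
    (hF : ∀ c, AsId T c → F c ∈ answerSets (T.prog H))
    (hcov : ∀ e c, CoverId T e c → Extends (F c) e)
    (hob : ∀ o ∈ T.Ob, Dominates (T.prog H) (F (.ordId1 o)) (F (.ordId2 o))) :
    ∃ A ∈ answerSets (fullMeta T VR), decodeHyp T A = H ∧
      (violatingAtom ∈ A ↔ (∃ e ∈ T.Eneg, Extends (F .n) e) ∨
        ∃ o ∈ T.Oc, ¬ Dominates (T.prog H) (F (.exId o.1)) (F (.exId o.2))) := by
  have hH : H ⊆ T.S := hR.1.1
  obtain ⟨A, hA, hAG⟩ := exists_stableAbove (stratified_fullMeta (T := T) (VR := VR)) rank_lt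
    (G := guessAtoms T H F)
    (by
      rintro _ (⟨r, hr, rfl⟩ | ⟨c, hc, rfl⟩ | ⟨c, hc, a, ha, rfl⟩)
      · exact inHAtom_mem_base (hH hr)
      · exact as_mem_base hc
      · exact in_as_mem_base hH hc (hF c hc) ha)
    (by rintro _ (⟨r, hr, rfl⟩ | ⟨c, hc, rfl⟩ | ⟨c, hc, a, ha, rfl⟩) <;> rfl)
  have hin : ∀ ts, ⟨.in_h, ts⟩ ∈ A ↔ ∃ r ∈ H, ts = [.sym (.ruleId r)] := by
    intro ts
    rw [hAG _ rfl]
    constructor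
    · rintro (⟨r, hr, h⟩ | ⟨c, hc, h⟩ | ⟨c, hc, a, ha, h⟩)
      · exact ⟨r, hr, congrArg Atom.args h⟩
      · cases h
      · cases h
    · rintro ⟨r, hr, rfl⟩
      exact .inl ⟨r, hr, rfl⟩
  have hdec : decodeHyp T A = H := by
    ext r
    rw [mem_decodeHyp]
    constructor
    · rintro ⟨-, h⟩
      obtain ⟨r', hr', h⟩ := (hin _).1 h
      simp only [List.cons.injEq, Term.sym.injEq, MConst.ruleId.injEq, and_true] at h
      rwa [h]
    · exact fun hr => ⟨hH hr, (hin _).2 ⟨r, hr, rfl⟩⟩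
  have hproj : ∀ c, AsId T c → proj .in_as A (.sym c) = F c := by
    intro c hc
    ext a
    change (⟨.in_as, _⟩ : GAtom (metaSig K P V)) ∈ A ↔ _
    rw [hAG _ rfl]
    constructor
    · rintro (⟨r, hr, h⟩ | ⟨c, hc, h⟩ | ⟨c', hc', a', ha, h⟩)
      · cases h
      · cases h
      · simp only [Atom.mk.injEq, List.cons.injEq, qAtom_inj, Term.sym.injEq, true_and,
          and_true] at h
        obtain ⟨rfl, rfl⟩ := h
        exact ha
    · exact fun ha => .inr (.inr ⟨c, hc, a, ha, rfl⟩)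
  have hco : Coherent T VR A := by
    refine ⟨hA, fun ts => ?_, fun ts h => ?_, fun c hc => ?_⟩
    · rw [hAG _ rfl]
      constructor
      · rintro (⟨r, hr, h⟩ | ⟨c, hc, h⟩ | ⟨c, hc, a, ha, h⟩)
        · cases h
        · exact ⟨c, hc, congrArg Atom.args h⟩
        · cases h
      · rintro ⟨c, hc, rfl⟩
        exact .inr (.inl ⟨c, hc, rfl⟩)
    · rw [hAG _ rfl] at h
      rcases h with ⟨r, hr, h⟩ | ⟨c, hc, h⟩ | ⟨c, hc, a, ha, h⟩
      · cases h
      · cases h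
      · exact ⟨a, c, hc, congrArg Atom.args h⟩
    · rw [hdec, hproj c hc]
      exact hF c hc
  have hasId : ∀ {e c}, CoverId T e c → AsId T c := by
    rintro e c (he | ho | ho)
    exacts [.ex he, .ord1 ho, .ord2 ho]
  refine ⟨A, hco.mem_answerSets ?_ ?_ ?_ ?_, hdec, ?_⟩
  · intro ts h
    obtain ⟨r, hr, rfl⟩ := (hin ts).1 h
    exact ⟨r, hH hr, rfl⟩
  · intro e c hc
    rw [hproj c (hasId hc)]
    exact hcov e c hc
  · intro o ho
    rw [hdec, hproj _ (.ord1 ho), hproj _ (.ord2 ho)]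
    exact hob o ho
  · rwa [hdec]
  · rw [hco.violating_iff, hdec]
    refine or_congr ⟨?_, ?_⟩ (exists_congr fun o => and_congr_right fun ho => ?_)
    · rintro ⟨e, he, h⟩
      rw [hproj _ (.n ⟨e, he⟩)] at h
      exact ⟨e, he, h⟩
    · rintro ⟨e, he, h⟩
      rw [← hproj _ (.n ⟨e, he⟩)] at h
      exact ⟨e, he, h⟩
    · rw [hproj _ (.ex (T.Oc_pos o ho).1), hproj _ (.ex (T.Oc_pos o ho).2)]

/-- A remaining hypothesis is represented, and a violating one with the atom `violating`. -/
theorem exists_answerSet_of_isRemaining (hE : T.Eneg.Nonempty → T.Epos.Nonempty)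
    (hR : T.IsRemaining VR H) :
    ∃ A ∈ answerSets (fullMeta T VR), decodeHyp T A = H ∧
      (T.IsViolating H → violatingAtom ∈ A) := by
  classical
  choose! Fe hFe hFext using hR.1.2.1
  choose! Fo₁ hFo₁ Fo₂ hFo₂ ho₁ ho₂ hdom using hR.1.2.2
  -- The witnesses for the brave orderings stay fixed; those for the examples and for `n` are left
  -- free, so that a given violating reason can be placed there.
  have main : ∀ (f : PartialInterp K P → Set (OAtom K P)) (Fn : Set (OAtom K P)),
      (∀ e ∈ T.Epos, f e ∈ answerSets (T.prog H) ∧ Extends (f e) e) →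
      (T.Eneg.Nonempty → Fn ∈ answerSets (T.prog H)) →
      ∃ A ∈ answerSets (fullMeta T VR), decodeHyp T A = H ∧
      (violatingAtom ∈ A ↔ (∃ e ∈ T.Eneg, Extends Fn e) ∨
        ∃ o ∈ T.Oc, ¬ Dominates (T.prog H) (f o.1) (f o.2)) := by
    intro f Fn hf hn
    refine exists_answerSet hR (F := fun c => match c with
      | .exId e => f e
      | .ordId1 o => Fo₁ o
      | .ordId2 o => Fo₂ o
      | _ => Fn) ?_ ?_ hdom
    · rintro c (he | hne | ho | ho)
      exacts [(hf _ he).1, hn hne, hFo₁ _ ho, hFo₂ _ ho]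
    · rintro e c (he | ho | ho)
      exacts [(hf _ he).2, ho₁ _ ho, ho₂ _ ho]
  have hFe' : ∀ e ∈ T.Epos, Fe e ∈ answerSets (T.prog H) ∧ Extends (Fe e) e :=
    fun e he => ⟨hFe e he, hFext e he⟩
  -- With negative examples, the witness for some positive example also serves for `n`; otherwise
  -- `n` is not an identifier and `∅` is a dummy.
  obtain ⟨Fn, hFn⟩ : ∃ Fn, T.Eneg.Nonempty → Fn ∈ answerSets (T.prog H) := by
    by_cases hne : T.Eneg.Nonempty
    · obtain ⟨e, he⟩ := hE hne
      exact ⟨Fe e, fun _ => hFe e he⟩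
    · exact ⟨∅, fun h => absurd h hne⟩
  by_cases hv : T.IsViolating H
  · obtain ⟨R, hR'⟩ := hv
    cases R with
    | interp I =>
      obtain ⟨-, hI, e, he, hext⟩ := hR'
      obtain ⟨A, hA, hdec, hviol⟩ := main Fe I hFe' fun _ => hI
      exact ⟨A, hA, hdec, fun _ => hviol.2 (.inl ⟨e, he, hext⟩)⟩
    | pair I J =>
      obtain ⟨-, hI, hJ, ⟨o, ho, hx1, hx2⟩, hnd⟩ := hR'
      obtain ⟨A, hA, hdec, hviol⟩ := main
        (Function.update (Function.update Fe o.2 J) o.1 I) Fn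
        (by
          intro e he
          by_cases h1 : e = o.1
          · subst h1
            simpa using ⟨hI, hx1⟩
          · by_cases h2 : e = o.2
            · subst h2
              rw [Function.update_of_ne h1, Function.update_self]
              exact ⟨hJ, hx2⟩
            · rw [Function.update_of_ne h1, Function.update_of_ne h2]
              exact hFe' e he) hFn
      refine ⟨A, hA, hdec, fun _ => hviol.2 (.inr ⟨o, ho, ?_⟩)⟩
      -- If both components are the same example, its identifier can hold only one answer set. That
      -- suffices, since no interpretation dominates itself.
      by_cases h12 : o.2 = o.1
      · rw [h12]
        rintro ⟨l, hl, -⟩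
        exact lt_irrefl _ hl
      · rw [Function.update_self, Function.update_of_ne h12, Function.update_self]
        exact hnd
  · obtain ⟨A, hA, hdec, -⟩ := main Fe Fn hFe' hFn
    exact ⟨A, hA, hdec, fun h => absurd h hv⟩

end Construction

end LOAS

namespace LOAS

open ASP

universe u v w

/-! ### Costs of the answer sets and the parity argument -/

section Optimisation

variable {K : Type u} {P : Type v} {V : Type w} {T : Task K P V} {VR : Set (Reason K P)}
  {A : Set (GAtom (metaSig K P V))}

/-- The tuple of the weak constraint for the rule `r` of the search space. -/
def scoreTuple (r : ORule K P V) : ℤ × ℤ × List (GTerm (metaSig K P V)) :=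
  (2 * (r.length : ℤ), 0, [.sym (.ruleId r)])

open Classical in
/-- The sum of weights of an answer set of the meta program at level `0`. -/
noncomputable def score (T : Task K P V) (A : Set (GAtom (metaSig K P V))) : ℤ :=
  2 * (hypLength (decodeHyp T A) : ℤ) + if violatingAtom ∈ A then 0 else 1

/-- The weak constraints of the task have become ordinary rules for `w`, so only the rule lengths
and the penalty for a missing `violating` contribute. -/
theorem weakTuples_fullMeta : weakTuples (fullMeta T VR) A =
    scoreTuple '' (decodeHyp T A : Set (ORule K P V)) ∪
      {q | q = (1, 0, []) ∧ violatingAtom ∉ A} := by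
  have hv : ∀ σ : MVar V → GTerm (metaSig K P V),
      (mat .violating [] : MAtom K P V).subst σ = violatingAtom := fun _ => rfl
  ext ⟨n, l, us⟩
  constructor
  · rintro ⟨R, hR, σ, -, hb, wt, lev, ts, hh, h1, h2, h3⟩
    obtain ⟨p, hR⟩ := exists_metaRule hR
    cases hR with
    | normal hs hd => simp [addPos, append, reify, hd, reifyHead] at hh
    | hard hs hd => simp [addPos, append, reify, hd, reifyHead] at hh
    | choice hs hd => simp [addPos, append, reify, hd, reifyHead] at hh
    | @score r hr =>
      left
      obtain ⟨rfl, rfl, rfl⟩ := Head.weak.inj hh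
      simp only [Term.subst, Term.int.injEq, List.map_cons, List.map_nil] at h1 h2 h3
      have := hb.1 _ (List.mem_singleton_self _)
      rw [inH_subst] at this
      refine ⟨r, mem_decodeHyp.2 ⟨hr, this⟩, ?_⟩
      simp [scoreTuple, h1, ← h2, ← h3]
    | penalty =>
      right
      obtain ⟨rfl, rfl, rfl⟩ := Head.weak.inj hh
      simp only [Term.subst, Term.int.injEq, List.map_nil] at h1 h2 h3
      refine ⟨by simp [← h1, ← h2, ← h3], ?_⟩
      have := hb.2.1 _ (List.mem_singleton_self _)
      rwa [hv] at this
    | _ => cases hh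
  · rintro (⟨r, hr, heq⟩ | ⟨heq, hn⟩)
    · rw [← heq]
      obtain ⟨hr, hrA⟩ := mem_decodeHyp.1 (Finset.mem_coe.1 hr)
      refine ⟨_, (MetaRule.score hr).mem, fun _ => .int 0, ?_, ⟨?_, by simp, by simp⟩,
        _, _, _, rfl, ?_⟩
      · intro v hv
        simp [Rule.vars, Head.vars, inH, mat, Atom.vars, Term.vars] at hv
      · simpa [inH_subst] using hrA
      · simp [scoreTuple, Term.subst]
    · rw [heq]
      refine ⟨_, MetaRule.penalty.mem, fun _ => .int 0, ?_, ⟨by simp, ?_, by simp⟩,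
        _, _, _, rfl, ?_⟩
      · intro v hv
        simp [Rule.vars, Head.vars, mat, Atom.vars, Term.vars] at hv
      · simpa [hv] using hn
      · simp [Term.subst]

theorem levelSum_fullMeta_of_ne {l : ℤ} (hl : l ≠ 0) : levelSum (fullMeta T VR) l A = 0 := by
  refine finsum_mem_eq_zero_of_forall_eq_zero ?_
  rintro q ⟨hq, rfl⟩
  rw [weakTuples_fullMeta] at hq
  rcases hq with ⟨r, -, rfl⟩ | ⟨rfl, -⟩
  · exact absurd rfl hl
  · exact absurd rfl hl

/-- Tuples are summed as a set: rule identifiers keep rules of equal length apart, and the penalty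
tuple has an empty list of terms, so no two contributions coincide. -/
theorem levelSum_fullMeta_zero : levelSum (fullMeta T VR) 0 A = score T A := by
  have hset : {q ∈ weakTuples (fullMeta T VR) A | q.2.1 = 0} =
      weakTuples (fullMeta T VR) A := by
    refine Set.Subset.antisymm (fun q hq => hq.1) fun q hq => ⟨hq, ?_⟩
    rw [weakTuples_fullMeta] at hq
    rcases hq with ⟨r, -, rfl⟩ | ⟨rfl, -⟩ <;> rfl
  have hinj : Set.InjOn scoreTuple (decodeHyp T A : Set (ORule K P V)) := by
    intro r _ r' _ h
    simp only [scoreTuple, Prod.mk.injEq, List.cons.injEq, Term.sym.injEq,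
      MConst.ruleId.injEq] at h
    exact h.2.2.1
  have hfin : {q : ℤ × ℤ × List (GTerm (metaSig K P V)) |
      q = (1, 0, []) ∧ violatingAtom ∉ A}.Finite :=
    (Set.finite_singleton (1, 0, [])).subset fun q hq => hq.1
  rw [levelSum, hset, weakTuples_fullMeta, finsum_mem_union ?_ ((Finset.finite_toSet _).image _)
    hfin, finsum_mem_image hinj, finsum_mem_coe_finset, score, hypLength]
  · congr 1
    · push_cast
      rw [Finset.mul_sum]
      rfl
    · split_ifs with hv
      · exact finsum_mem_eq_zero_of_forall_eq_zero fun q hq => absurd hv hq.2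
      · have : {q : ℤ × ℤ × List (GTerm (metaSig K P V)) |
            q = (1, 0, []) ∧ violatingAtom ∉ A} = {(1, 0, [])} := by
          ext q
          exact ⟨fun h => h.1, fun h => ⟨h, hv⟩⟩
        rw [this, finsum_mem_singleton]
  · rw [Set.disjoint_left]
    rintro _ ⟨r, -, rfl⟩ ⟨h, -⟩
    simp [scoreTuple] at h

theorem dominates_fullMeta_iff {A A' : Set (GAtom (metaSig K P V))} :
    Dominates (fullMeta T VR) A A' ↔ score T A < score T A' := by
  rw [← levelSum_fullMeta_zero (VR := VR), ← levelSum_fullMeta_zero (VR := VR)]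
  constructor
  · rintro ⟨l, hl, -⟩
    by_cases h0 : l = 0
    · rwa [h0] at hl
    · rw [levelSum_fullMeta_of_ne h0, levelSum_fullMeta_of_ne h0] at hl
      exact absurd hl (lt_irrefl _)
  · intro h
    refine ⟨0, h, fun m hm => ?_⟩
    rw [levelSum_fullMeta_of_ne hm.ne', levelSum_fullMeta_of_ne hm.ne']

theorem mem_optimalAnswerSets_iff : A ∈ optimalAnswerSets (fullMeta T VR) ↔
    A ∈ answerSets (fullMeta T VR) ∧
      ∀ A' ∈ answerSets (fullMeta T VR), score T A ≤ score T A' := by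
  refine and_congr_right fun _ => ?_
  simp only [dominates_fullMeta_iff, not_exists, not_and, not_lt]

theorem score_nonneg (T : Task K P V) (A : Set (GAtom (metaSig K P V))) : 0 ≤ score T A := by
  unfold score
  split_ifs <;> positivity

theorem score_of_violating (hv : violatingAtom ∈ A) :
    score T A = 2 * (hypLength (decodeHyp T A) : ℤ) := by
  simp [score, hv]

theorem score_of_not_violating (hv : violatingAtom ∉ A) :
    score T A = 2 * (hypLength (decodeHyp T A) : ℤ) + 1 := by
  simp [score, hv]

/-- There may be infinitely many answer sets, but the cost is a nonnegative integer, so a least one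
exists. -/
theorem exists_optimalAnswerSet (hne : (answerSets (fullMeta T VR)).Nonempty) :
    (optimalAnswerSets (fullMeta T VR)).Nonempty := by
  obtain ⟨A, hA, hmin⟩ := exists_minimalFor_of_wellFoundedLT
    (fun A => A ∈ answerSets (fullMeta T VR)) (fun A => (score T A).toNat) hne
  refine ⟨A, mem_optimalAnswerSets_iff.2 ⟨hA, fun A' hA' => ?_⟩⟩
  by_contra hlt
  have h0 := score_nonneg T A'
  have := hmin hA' (by simp only; omega)
  simp only at this
  omega

/-- The optimum is `2|H|`, hence even, while answer sets without `violating` have odd cost. Thus all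
optimal answer sets contain `violating`, and among these comparing costs is comparing lengths. -/
theorem optimalRemainingViolating_eq (hE : T.Eneg.Nonempty → T.Epos.Nonempty)
    (hA : A ∈ optimalAnswerSets (fullMeta T VR)) (hv : violatingAtom ∈ A) :
    T.optimalRemainingViolating VR =
      {H | ∃ A ∈ optimalAnswerSets (fullMeta T VR), H = decodeHyp T A} := by
  obtain ⟨hA, hmin⟩ := mem_optimalAnswerSets_iff.1 hA
  rw [score_of_violating hv] at hmin
  ext H
  constructor
  · rintro ⟨⟨hR, hV⟩, hle⟩
    obtain ⟨A', hA', rfl, hv'⟩ := exists_answerSet_of_isRemaining hE hR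
    refine ⟨A', mem_optimalAnswerSets_iff.2 ⟨hA', fun A'' hA'' => ?_⟩, rfl⟩
    rw [score_of_violating (hv' hV)]
    refine le_trans ?_ (hmin A'' hA'')
    have := hle _ ⟨isRemaining_of_answerSet hA, isViolating_of_answerSet hA hv⟩
    omega
  · rintro ⟨A', hA', rfl⟩
    obtain ⟨hA', hmin'⟩ := mem_optimalAnswerSets_iff.1 hA'
    have hle := hmin' A hA
    rw [score_of_violating hv] at hle
    -- Two optimal answer sets have equal cost, so `A'` cannot have odd cost.
    have hv' : violatingAtom ∈ A' := by
      by_contra hv'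
      have := hmin A' hA'
      rw [score_of_not_violating hv'] at this hle
      omega
    rw [score_of_violating hv'] at hle
    refine ⟨⟨isRemaining_of_answerSet hA', isViolating_of_answerSet hA' hv'⟩, ?_⟩
    rintro H ⟨hR, hV⟩
    obtain ⟨A'', hA'', rfl, hv''⟩ := exists_answerSet_of_isRemaining hE hR
    have := hmin A'' hA''
    rw [score_of_violating (hv'' hV)] at this
    omega

/-- The optimum is `2|H| + 1`, and a remaining hypothesis `H'` is represented at cost at most `2|H'|
+ 1`, so optimality is least length. A violating `H'` of least length would be represented by an
optimal answer set containing `violating`. -/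
theorem optimalRemaining_eq (hE : T.Eneg.Nonempty → T.Epos.Nonempty)
    (hv : ∀ A ∈ optimalAnswerSets (fullMeta T VR), violatingAtom ∉ A) :
    T.optimalRemaining VR =
      {H | ∃ A ∈ optimalAnswerSets (fullMeta T VR), H = decodeHyp T A} ∧
    ∀ H ∈ T.optimalRemaining VR, ¬ T.IsViolating H := by
  have key : ∀ H ∈ T.optimalRemaining VR, ∃ A ∈ optimalAnswerSets (fullMeta T VR),
      H = decodeHyp T A ∧ (T.IsViolating H → violatingAtom ∈ A) := by
    rintro H ⟨hR, hle⟩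
    obtain ⟨A', hA', rfl, hv'⟩ := exists_answerSet_of_isRemaining hE hR
    refine ⟨A', mem_optimalAnswerSets_iff.2 ⟨hA', fun A'' hA'' => ?_⟩, rfl, hv'⟩
    obtain ⟨A, hAopt⟩ := exists_optimalAnswerSet ⟨A', hA'⟩
    obtain ⟨hA, hmin⟩ := mem_optimalAnswerSets_iff.1 hAopt
    refine le_trans ?_ (hmin A'' hA'')
    rw [score_of_not_violating (hv A hAopt)]
    -- The optimal `A` lacks `violating`, so it pays the extra 1; hence `A'` costs no more than `A`,
    -- whether or not it contains `violating`.
    have h1 : hypLength (decodeHyp T A') ≤ hypLength (decodeHyp T A) :=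
      hle _ (isRemaining_of_answerSet hA)
    unfold score
    split_ifs <;> omega
  refine ⟨Set.Subset.antisymm (fun H hH => ?_) ?_, fun H hH hV => ?_⟩
  · obtain ⟨A, hA, h, -⟩ := key H hH
    exact ⟨A, hA, h⟩
  · rintro _ ⟨A, hAopt, rfl⟩
    obtain ⟨hA, hmin⟩ := mem_optimalAnswerSets_iff.1 hAopt
    refine ⟨isRemaining_of_answerSet hA, fun H hR => ?_⟩
    obtain ⟨A', hA', rfl, -⟩ := exists_answerSet_of_isRemaining hE hR
    have := hmin A' hA'
    rw [score_of_not_violating (hv A hAopt)] at this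
    unfold score at this
    split_ifs at this <;> omega
  · obtain ⟨A, hA, -, h⟩ := key H hH
    exact hv A hA (h hV)

end Optimisation

end LOAS

theorem mainTheorem2 {K : Type*} {P : Type*} {V : Type*} (T : LOAS.Task K P V)
    (hE : T.Eneg.Nonempty → T.Epos.Nonempty)
    (VR : Set (LOAS.Reason K P)) (hVR : ∀ R ∈ VR, T.IsReason R) :
    ((∃ A ∈ ASP.optimalAnswerSets (LOAS.taskMeta T ∪ LOAS.reasonMeta T VR),
        LOAS.violatingAtom ∈ A) →
      (T.optimalRemainingViolating VR).Nonempty ∧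
      T.optimalRemainingViolating VR =
        {H | ∃ A ∈ ASP.optimalAnswerSets (LOAS.taskMeta T ∪ LOAS.reasonMeta T VR),
          H = LOAS.decodeHyp T A}) ∧
    ((∀ A ∈ ASP.optimalAnswerSets (LOAS.taskMeta T ∪ LOAS.reasonMeta T VR),
        LOAS.violatingAtom ∉ A) →
      T.optimalRemaining VR =
        {H | ∃ A ∈ ASP.optimalAnswerSets (LOAS.taskMeta T ∪ LOAS.reasonMeta T VR),
          H = LOAS.decodeHyp T A} ∧
      ∀ H ∈ T.optimalRemaining VR, ¬ T.IsViolating H) := by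
  refine ⟨?_, LOAS.optimalRemaining_eq hE⟩
  rintro ⟨A, hA, hv⟩
  have h := LOAS.optimalRemainingViolating_eq hE hA hv
  exact ⟨h ▸ ⟨_, A, hA, rfl⟩, h⟩
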